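/- Let $N\ge 1$, $\beta>0$, $h,\lambda\in\mathbb R$, $K\ge 0$, and let $0=q_0\le q_1\le\dots\le q_K=Q$ and $0=m_0\le m_1\le\dots\le m_K\le m_{K+1}=1$ be real numbers. Let $J_{ij}$ and $J^a_i$ ($1\le i,j\le N$, $1\le a\le K$) be independent standard Gaussian variables; write $\mathbb E_0$ for the average over all $J_{ij}$, $\mathbb E_a$ for the average over $J^a_1,\dots,J^a_N$, $\mathbb E$ for the average over all of them, and $\mathbb E_z$ for the average over a standard Gaussian vector $z\in\mathbb R^N$. For $t\in[0,1]$ and $C\in\mathbb R$ put $$\tilde Z_N(t)=\mathbb E_z B_t(z),\qquad B_t(z)=\exp\Big(\beta\sqrt{\tfrac{t}{2N}}\sum_{i,j}J_{ij}z_iz_j-t\tfrac{\beta^2}{4N}\big(\sum_i z_i^2\big)^2+\beta\sqrt{1-t}\sum_{a=1}^K\sqrt{q_a-q_{a-1}}\sum_iJ^a_iz_i+(1-t)\tfrac C2\sum_iz_i^2+\beta h\sum_iz_i+\tfrac\lambda2\sum_iz_i^2\Big).$$ Define $Z_K=\tilde Z_N$ and, for $a=K,\dots,1$, $Z_{a-1}=(\mathbb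 E_aZ_a^{m_a})^{1/m_a}$, read as $\exp(\mathbb E_a\log Z_a)$ if $m_a=0$, and let $$\varphi_N(t)=\tfrac1N\,\mathbb E_0\log Z_0 .$$ Put $f_a=Z_a^{m_a}/\mathbb E_aZ_a^{m_a}$ for $1\le a\le K$, $\omega(O)=\tilde Z_N(t)^{-1}\,\mathbb E_z\big(O(z)B_t(z)\big)$, and, for $0\le a\le K$, $\tilde\omega_a(O)=\mathbb E_{a+1}\cdots\mathbb E_K\big(f_{a+1}\cdots f_K\,\omega(O)\big)$ (so $\tilde\omega_K=\omega$), $\tilde\Omega_a=\tilde\omega_a\otimes\tilde\omega_a$ acting on two replicas $z^{(1)},z^{(2)}$, and $\langle F\rangle_a=\mathbb E\big(f_1\cdots f_a\,\tilde\Omega_a(F)\big)$. Let $q_{12}=\frac1N\sum_iz^{(1)}_iz^{(2)}_i$. If $C=-\beta^2\sum_{a=1}^K(q_a-q_{a-1})=-\beta^2Q$, then for every $t\in(0,1)$ the integrals defining $\varphi_N(t)$ converge, $f_1\cdots f_a\,\tilde\Omega_a((q_{12}-q_a)^2)$ is integrable for every $0\le a\le K$, and $\varphi_N$ is differentiable at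 $t$ with $$\frac{d}{dt}\varphi_N(t)=\frac{\beta^2}{4}\sum_{a=0}^K(m_{a+1}-m_a)\,q_a^2-\frac{\beta^2}{4}\sum_{a=0}^K(m_{a+1}-m_a)\,\big\langle(q_{12}-q_a)^2\big\rangle_a .$$ -/

import Mathlib

open MeasureTheory ProbabilityTheory

noncomputable section

namespace GaussianSpinGlass

/-- A piecewise constant functional order parameter with `K` steps:
`0 = q_0 ≤ q_1 ≤ … ≤ q_K` and `0 = m_0 ≤ m_1 ≤ … ≤ m_K ≤ m_{K+1} = 1`. -/
structure StepOrderParameter (K : ℕ) where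
  q : Fin (K + 1) → ℝ
  m : Fin (K + 2) → ℝ
  q_zero : q 0 = 0
  q_mono : Monotone q
  m_zero : m 0 = 0
  m_last : m (Fin.last (K + 1)) = 1
  m_mono : Monotone m

/-- The largest value `Q = q_K` of the overlap. -/
def StepOrderParameter.Q {K : ℕ} (x : StepOrderParameter K) : ℝ := x.q (Fin.last K)

/-- The standard Gaussian measure on `ℝ^N`. -/
def gaussVec (N : ℕ) : Measure (Fin N → ℝ) := Measure.pi fun _ => gaussianReal 0 1

/-- The law of the couplings `J_{ij}`, i.i.d. standard Gaussian. -/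
def couplingLaw (N : ℕ) : Measure (Fin N → Fin N → ℝ) := Measure.pi fun _ => gaussVec N

/-- The law of the fields `J^1, …, J^K`; the field `J^{a+1}` is the coordinate `a : Fin K`. -/
def fieldLaw (N K : ℕ) : Measure (Fin K → Fin N → ℝ) := Measure.pi fun _ => gaussVec N

/-- A realization of the whole external noise: the couplings `J_{ij}` and the fields `J^a_i`. -/
abbrev Noise (N K : ℕ) : Type := (Fin N → Fin N → ℝ) × (Fin K → Fin N → ℝ)

/-- The law of the whole external noise. -/
def noiseLaw (N K : ℕ) : Measure (Noise N K) := (couplingLaw N).prod (fieldLaw N K)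

/-- The average over the single field `J^{a+1}`, all the other noise being kept fixed. -/
def levelAvg {N K : ℕ} (a : Fin K) (g : Noise N K → ℝ) (ξ : Noise N K) : ℝ :=
  ∫ y, g (ξ.1, Function.update ξ.2 a y) ∂(gaussVec N)

/-- The fields `J^1, …, J^a` are taken from `Y`, the fields `J^{a+1}, …, J^K` from `Y'`. -/
def splice {N K : ℕ} (a : Fin (K + 1)) (Y Y' : Fin K → Fin N → ℝ) : Fin K → Fin N → ℝ :=
  fun b => if b.castSucc < a then Y b else Y' b

/-- The average `E_{a+1} ⋯ E_K` over all the fields `J^{a+1}, …, J^K`. -/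
def tailAvg {N K : ℕ} (a : Fin (K + 1)) (g : Noise N K → ℝ) (ξ : Noise N K) : ℝ :=
  ∫ Y', g (ξ.1, splice a ξ.2 Y') ∂(fieldLaw N K)

/-- The exponent of the Boltzmann factor of the interpolating system. -/
def boltzmannExponent {N K : ℕ} (β h lam C : ℝ) (x : StepOrderParameter K) (t : ℝ)
    (ξ : Noise N K) (z : Fin N → ℝ) : ℝ :=
  β * √(t / (2 * N)) * ∑ i, ∑ j, ξ.1 i j * z i * z j
    - t * (β ^ 2 / (4 * N)) * (∑ i, z i ^ 2) ^ 2
    + β * √(1 - t) * ∑ a : Fin K, √(x.q a.succ - x.q a.castSucc) * ∑ i, ξ.2 a i * z i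
    + (1 - t) * (C / 2) * ∑ i, z i ^ 2
    + β * h * ∑ i, z i + lam / 2 * ∑ i, z i ^ 2

/-- The Boltzmann factor of the interpolating system. -/
def boltzmannFactor {N K : ℕ} (β h lam C : ℝ) (x : StepOrderParameter K) (t : ℝ)
    (ξ : Noise N K) (z : Fin N → ℝ) : ℝ :=
  Real.exp (boltzmannExponent β h lam C x t ξ z)

/-- The interpolating partition function. -/
def interpZ {N K : ℕ} (β h lam C : ℝ) (x : StepOrderParameter K) (t : ℝ) (ξ : Noise N K) : ℝ :=
  ∫ z, boltzmannFactor β h lam C x t ξ z ∂(gaussVec N)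

/-- The random variables `Z_K, …, Z_0`, where `Z_K` is the interpolating partition function and
`Z_a = (E_{a+1} Z_{a+1}^{m_{a+1}})^{1 / m_{a+1}}`; for `m_{a+1} = 0` the right-hand side is
its limit as `m_{a+1} → 0`, namely `exp (E_{a+1} log Z_{a+1})`. -/
def levelZ {N K : ℕ} (β h lam C : ℝ) (x : StepOrderParameter K) (t : ℝ) (a : Fin (K + 1)) :
    Noise N K → ℝ :=
  Fin.reverseInduction (motive := fun _ => Noise N K → ℝ)
    (interpZ β h lam C x t)
    (fun b Z ξ =>
      if x.m b.succ.castSucc = 0 then Real.exp (levelAvg b (fun η => Real.log (Z η)) ξ)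
      else (levelAvg b (fun η => Z η ^ x.m b.succ.castSucc) ξ) ^ (1 / x.m b.succ.castSucc))
    a

/-- The interpolating function `φ_N(t) = N⁻¹ E log Z_0`; as `Z_0` depends on the couplings
`J_{ij}` only, the average over the whole noise is the average over the couplings. -/
def interpPhi (N : ℕ) {K : ℕ} (β h lam C : ℝ) (x : StepOrderParameter K) (t : ℝ) : ℝ :=
  1 / (N : ℝ) * ∫ ξ, Real.log (levelZ β h lam C x t 0 ξ) ∂(noiseLaw N K)

/-- The weight `f_{a+1} = Z_{a+1}^{m_{a+1}} / E_{a+1} Z_{a+1}^{m_{a+1}}`, for `a : Fin K`. -/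
def levelWeight {N K : ℕ} (β h lam C : ℝ) (x : StepOrderParameter K) (t : ℝ) (a : Fin K)
    (ξ : Noise N K) : ℝ :=
  levelZ β h lam C x t a.succ ξ ^ x.m a.succ.castSucc /
    levelAvg a (fun η => levelZ β h lam C x t a.succ η ^ x.m a.succ.castSucc) ξ

/-- The product `f_1 ⋯ f_a`. -/
def headWeight {N K : ℕ} (β h lam C : ℝ) (x : StepOrderParameter K) (t : ℝ) (a : Fin (K + 1))
    (ξ : Noise N K) : ℝ :=
  ∏ b : Fin K with b.castSucc < a, levelWeight β h lam C x t b ξ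

/-- The product `f_{a+1} ⋯ f_K`. -/
def tailWeight {N K : ℕ} (β h lam C : ℝ) (x : StepOrderParameter K) (t : ℝ) (a : Fin (K + 1))
    (ξ : Noise N K) : ℝ :=
  ∏ b : Fin K with a ≤ b.castSucc, levelWeight β h lam C x t b ξ

/-- The Boltzmann state `ω`. -/
def gibbs {N K : ℕ} (β h lam C : ℝ) (x : StepOrderParameter K) (t : ℝ)
    (O : (Fin N → ℝ) → ℝ) (ξ : Noise N K) : ℝ :=
  (interpZ β h lam C x t ξ)⁻¹ * ∫ z, O z * boltzmannFactor β h lam C x t ξ z ∂(gaussVec N)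

/-- The state `ω̃_a = E_{a+1} ⋯ E_K (f_{a+1} ⋯ f_K ω(·))`. -/
def levelState {N K : ℕ} (β h lam C : ℝ) (x : StepOrderParameter K) (t : ℝ) (a : Fin (K + 1))
    (O : (Fin N → ℝ) → ℝ) (ξ : Noise N K) : ℝ :=
  tailAvg a (fun η => tailWeight β h lam C x t a η * gibbs β h lam C x t O η) ξ

/-- The state `Ω̃_a` on two replicas, the product of two copies of `ω̃_a` with the same noise. -/
def levelState₂ {N K : ℕ} (β h lam C : ℝ) (x : StepOrderParameter K) (t : ℝ) (a : Fin (K + 1))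
    (F : (Fin N → ℝ) → (Fin N → ℝ) → ℝ) (ξ : Noise N K) : ℝ :=
  levelState β h lam C x t a
    (fun z₁ => levelState β h lam C x t a (fun z₂ => F z₁ z₂) ξ) ξ

/-- The average `⟨F⟩_a = E (f_1 ⋯ f_a Ω̃_a(F))`. -/
def bracket {N K : ℕ} (β h lam C : ℝ) (x : StepOrderParameter K) (t : ℝ) (a : Fin (K + 1))
    (F : (Fin N → ℝ) → (Fin N → ℝ) → ℝ) : ℝ :=
  ∫ ξ, headWeight β h lam C x t a ξ * levelState₂ β h lam C x t a F ξ ∂(noiseLaw N K)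

/-- The overlap `q_{12}` of two configurations. -/
def overlap {N : ℕ} (z₁ z₂ : Fin N → ℝ) : ℝ := 1 / (N : ℝ) * ∑ i, z₁ i * z₂ i

/-- The integrals that define `φ_N(t)` converge. -/
def PhiConverges (N : ℕ) {K : ℕ} (β h lam C : ℝ) (x : StepOrderParameter K) (t : ℝ) : Prop :=
  (∀ ξ : Noise N K, Integrable (boltzmannFactor β h lam C x t ξ) (gaussVec N)) ∧
  (∀ (a : Fin K) (ξ : Noise N K),
    Integrable (fun y => levelZ β h lam C x t a.succ (ξ.1, Function.update ξ.2 a y) ^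
      x.m a.succ.castSucc) (gaussVec N) ∧
    Integrable (fun y => Real.log (levelZ β h lam C x t a.succ
      (ξ.1, Function.update ξ.2 a y))) (gaussVec N)) ∧
  Integrable (fun ξ : Noise N K => Real.log (levelZ β h lam C x t 0 ξ)) (noiseLaw N K)

end GaussianSpinGlass

end

open MeasureTheory ProbabilityTheory

noncomputable section

namespace GaussianSpinGlass

/-! The theorem is differentiation in t followed by Gaussian integration by parts. The integral over
z is itself one more step of the recursion, with exponent m_{K+1} = 1. So couplings, fields and
configuration form one Gaussian vector, indexed by `Site`, with levels 0, then 1, …, K, then K+1.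
Let U be the exponent of the Boltzmann factor. Each log Z_a is an iterated L^m log-average of exp U
(`levelZ_noise`), and the derivative of a log-average is a tilted average of the derivative
(`hasDerivAt_logAvg`). Hence the derivative of E log Z_0 is E(f_1 ⋯ f_{K+1} ∂_t U), where f_{K+1} is
the normalized Boltzmann factor.

The noise terms of ∂_t U are products of a coordinate with a function F of z, and U has derivative
κF in that coordinate. Integration by parts then only differentiates the density f_1 ⋯ f_{K+1}. Its
logarithmic derivative is Σ_b m_{b+1}(D_{b+1} - D_b), where D_b, the derivative of log Z_b, is κ
ω̃_b(F) if the coordinate has level at most b and 0 otherwise. Abel summation turns this into κF -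
Σ_b (m_{b+1} - m_b) D_b. Conditioning on the levels up to b turns E(f_1 ⋯ f_{K+1} F ω̃_b(F)) into
E(f_1 ⋯ f_b ω̃_b(F)²), which is where two replicas with common noise appear
(`integral_density_mul_coord_mul`).

The relevant F are z_i z_j for couplings and z_i for fields. Their diagonal terms cancel the
derivative of the quartic term and, by the choice of C, that of the quadratic term. The fields seen
by level b have variances adding up to q_b (`sum_fin_eq_q`). After division by N, the increment
m_{b+1} - m_b multiplies (β²/2) q_b ⟨q_12⟩_b - (β²/4) ⟨q_12²⟩_b, and completing the square gives the
claim.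

The analysis rests on two growth classes that the recursion preserves: polynomial growth (`PolyBdd`)
and a quadratic upper bound with small coefficients (`QuadBdd`). For t bounded away from 0 the
negative quartic term yields the latter (`quadBdd_ham`). Jensen bounds log-averages from below, and
`PolyBdd.comp_tilt` keeps tilted averages polynomial, so Fubini and dominated differentiation apply
at every level. -/

open Set Filter Topology

/-! ### Averages over subsets of independent Gaussian coordinates -/

section Averages

variable {ι : Type*}

open Classical in
/-- The point with the coordinates of `η` on `S` and those of `ω` outside `S`. -/
def mix (S : Set ι) (η ω : ι → ℝ) : ι → ℝ := fun i => if i ∈ S then η i else ω i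

lemma mix_of_mem {S : Set ι} {i : ι} (hi : i ∈ S) (η ω : ι → ℝ) : mix S η ω i = η i := if_pos hi

lemma mix_of_notMem {S : Set ι} {i : ι} (hi : i ∉ S) (η ω : ι → ℝ) : mix S η ω i = ω i :=
  if_neg hi

lemma mix_univ (η ω : ι → ℝ) : mix univ η ω = η := by
  ext i; exact mix_of_mem (mem_univ i) η ω

/-- The pointwise form of Fubini: if the Gaussian point is itself spliced from two independent
copies, the coordinates in `S` come from the first copy and those in `T` from the second. -/
lemma mix_mix_left (S T : Set ι) (hST : Disjoint S T) (η η' ω : ι → ℝ) :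
    mix (S ∪ T) (mix S η η') ω = mix T η' (mix S η ω) := by
  ext i
  by_cases hS : i ∈ S
  · have hT : i ∉ T := fun h => hST.ne_of_mem hS h rfl
    simp [mix, hS, hT]
  · by_cases hT : i ∈ T <;> simp [mix, hS, hT]

lemma measurable_mix (S : Set ι) :
    Measurable fun p : (ι → ℝ) × (ι → ℝ) => mix S p.1 p.2 := by
  classical
  refine measurable_pi_lambda _ fun i => ?_
  by_cases h : i ∈ S
  · simp only [mix, h, if_true]; fun_prop
  · simp only [mix, h, if_false]; fun_prop

lemma measurable_mix_left (S : Set ι) (ω : ι → ℝ) : Measurable fun η => mix S η ω :=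
  (measurable_mix S).comp (measurable_id.prodMk measurable_const)

lemma dependsOn_mix {S : Set ι} {g : (ι → ℝ) → ℝ} (hg : DependsOn g Sᶜ) (η ω : ι → ℝ) :
    g (mix S η ω) = g ω := hg fun _ hi => mix_of_notMem hi η ω

variable [Fintype ι]

/-- The standard Gaussian measure on `ι → ℝ`. -/
def stdGauss (ι : Type*) [Fintype ι] : Measure (ι → ℝ) := Measure.pi fun _ => gaussianReal 0 1

instance : IsProbabilityMeasure (stdGauss ι) := by unfold stdGauss; infer_instance

lemma norm_mix_le (S : Set ι) (η ω : ι → ℝ) : ‖mix S η ω‖ ≤ ‖η‖ + ‖ω‖ := by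
  refine (pi_norm_le_iff_of_nonneg (by positivity)).2 fun i => ?_
  by_cases h : i ∈ S
  · rw [mix_of_mem h]; linarith [norm_le_pi_norm η i, norm_nonneg ω]
  · rw [mix_of_notMem h]; linarith [norm_le_pi_norm ω i, norm_nonneg η]

/-- The coordinates are independent, so drawing some from one copy and the rest from an independent
copy does not change the law; the two sides are compared on boxes. -/
lemma measurePreserving_mix (S : Set ι) :
    MeasurePreserving (fun p : (ι → ℝ) × (ι → ℝ) => mix S p.1 p.2)
      ((stdGauss ι).prod (stdGauss ι)) (stdGauss ι) := by
  classical
  refine ⟨measurable_mix S, ?_⟩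
  symm
  rw [stdGauss]
  refine Measure.pi_eq fun s hs => ?_
  rw [Measure.map_apply (measurable_mix S) (MeasurableSet.univ_pi hs)]
  have : (fun p : (ι → ℝ) × (ι → ℝ) => mix S p.1 p.2) ⁻¹' (univ.pi s)
      = (univ.pi fun i => if i ∈ S then s i else univ) ×ˢ
        (univ.pi fun i => if i ∈ S then univ else s i) := by
    ext p
    simp only [mem_preimage, Set.mem_pi, mem_univ, true_implies, mem_prod, ← forall_and]
    refine forall_congr' fun i => ?_
    by_cases h : i ∈ S <;> simp [mix, h]
  rw [this, Measure.prod_prod, Measure.pi_pi, Measure.pi_pi, ← Finset.prod_mul_distrib]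
  refine Finset.prod_congr rfl fun i _ => ?_
  by_cases h : i ∈ S <;> simp [h]

/-- The Gaussian average over the coordinates in `S`, the others being kept fixed. -/
def avg (S : Set ι) (g : (ι → ℝ) → ℝ) (ω : ι → ℝ) : ℝ := ∫ η, g (mix S η ω) ∂(stdGauss ι)

/-- Integrability over the coordinates in `S`, whatever the values of the others. -/
def AvgIntegrable (S : Set ι) (g : (ι → ℝ) → ℝ) : Prop :=
  ∀ ω, Integrable (fun η => g (mix S η ω)) (stdGauss ι)

lemma avg_univ (g : (ι → ℝ) → ℝ) (ω : ι → ℝ) : avg univ g ω = ∫ η, g η ∂(stdGauss ι) := by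
  simp [avg, mix_univ]

lemma AvgIntegrable.integrable {g : (ι → ℝ) → ℝ} (h : AvgIntegrable univ g) :
    Integrable g (stdGauss ι) := by
  simpa [mix_univ] using h 0

lemma avg_mul_of_dependsOn {S : Set ι} {f : (ι → ℝ) → ℝ} (hf : DependsOn f Sᶜ)
    (g : (ι → ℝ) → ℝ) (ω : ι → ℝ) : avg S (fun η => f η * g η) ω = f ω * avg S g ω := by
  simp only [avg, dependsOn_mix hf, integral_const_mul]

lemma avg_of_dependsOn {S : Set ι} {f : (ι → ℝ) → ℝ} (hf : DependsOn f Sᶜ) :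
    avg S f = f := by
  funext ω
  simp [avg, dependsOn_mix hf]

lemma avg_const (S : Set ι) (r : ℝ) (ω : ι → ℝ) : avg S (fun _ => r) ω = r := by
  simp [avg]

lemma dependsOn_avg {S T : Set ι} {g : (ι → ℝ) → ℝ} (hg : DependsOn g T) :
    DependsOn (avg S g) (T \ S) := by
  intro ω ω' h
  refine integral_congr_ae (Eventually.of_forall fun η => hg fun i hi => ?_)
  by_cases hS : i ∈ S
  · simp [mix, hS]
  · simpa [mix, hS] using h i ⟨hi, hS⟩

lemma dependsOn_avg_compl (S : Set ι) (g : (ι → ℝ) → ℝ) : DependsOn (avg S g) Sᶜ := by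
  simpa [compl_eq_univ_sdiff] using dependsOn_avg (S := S) (dependsOn_univ g)

lemma measurable_avg (S : Set ι) {g : (ι → ℝ) → ℝ} (hg : Measurable g) :
    Measurable (avg S g) := by
  have h : StronglyMeasurable (fun p : (ι → ℝ) × (ι → ℝ) => g (mix S p.2 p.1)) :=
    (hg.comp ((measurable_mix S).comp measurable_swap)).stronglyMeasurable
  exact h.integral_prod_right'.measurable

/-- Iterated averages over disjoint sets of coordinates. -/
lemma avgIntegrable_union {S T : Set ι} (hST : Disjoint S T) {g : (ι → ℝ) → ℝ}
    (hg : Measurable g) (hT : AvgIntegrable T g)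
    (hS : AvgIntegrable S (avg T fun η => |g η|)) : AvgIntegrable (S ∪ T) g := by
  intro ω
  have hm : Measurable fun η => g (mix (S ∪ T) η ω) := hg.comp (measurable_mix_left _ _)
  rw [← (measurePreserving_mix S).integrable_comp hm.aestronglyMeasurable]
  simp only [Function.comp_def, mix_mix_left S T hST]
  rw [integrable_prod_iff]
  · exact ⟨Eventually.of_forall fun η => hT (mix S η ω), hS ω⟩
  · have := (hm.comp (measurable_mix S)).aestronglyMeasurable
      (μ := (stdGauss ι).prod (stdGauss ι))
    simpa only [Function.comp_def, mix_mix_left S T hST] using this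

lemma avg_union {S T : Set ι} (hST : Disjoint S T) {g : (ι → ℝ) → ℝ}
    (hg : Measurable g) (h : AvgIntegrable (S ∪ T) g) : avg (S ∪ T) g = avg S (avg T g) := by
  funext ω
  have hm : Measurable fun η => g (mix (S ∪ T) η ω) := hg.comp (measurable_mix_left _ _)
  have hi := h ω
  rw [← (measurePreserving_mix S).integrable_comp hm.aestronglyMeasurable] at hi
  have h1 : avg (S ∪ T) g ω =
      ∫ p, g (mix (S ∪ T) (mix S p.1 p.2) ω) ∂((stdGauss ι).prod (stdGauss ι)) := by
    have := integral_map (measurable_mix S).aemeasurable (μ := (stdGauss ι).prod (stdGauss ι))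
      hm.aestronglyMeasurable
    rwa [(measurePreserving_mix S).map_eq] at this
  rw [h1]
  refine (integral_prod _ hi).trans ?_
  simp only [Function.comp_def, mix_mix_left S T hST, avg]

/-- Averaging over `T` and then over its complement is full integration; the inner average does not
depend on `T`, so the outer one may run over all coordinates. -/
lemma integral_avg {g : (ι → ℝ) → ℝ} (T : Set ι) (hm : Measurable g)
    (hg : Integrable g (stdGauss ι)) : ∫ ω, avg T g ω ∂(stdGauss ι) = ∫ ω, g ω ∂(stdGauss ι) := by
  have hd : Disjoint Tᶜ T := disjoint_compl_left
  have hU : AvgIntegrable (Tᶜ ∪ T) g := by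
    intro ω; simpa [compl_union_self, mix_univ] using hg
  have := congrFun (avg_union hd hm hU) 0
  rw [compl_union_self, avg_univ] at this
  rw [this, avg]
  have hdep := dependsOn_avg_compl T g
  refine integral_congr_ae (Eventually.of_forall fun η => hdep fun i hi => ?_)
  exact (mix_of_mem hi _ _).symm

end Averages

/-! ### Gaussian integrability of quadratic exponentials -/

section GaussianBounds

variable {ι : Type*} [Fintype ι]

lemma integrable_exp_mul_sq_gaussianReal {a : ℝ} (ha : a < 1 / 2) :
    Integrable (fun x : ℝ => Real.exp (a * x ^ 2)) (gaussianReal 0 1) := by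
  rw [gaussianReal_of_var_ne_zero _ one_ne_zero,
    integrable_withDensity_iff (measurable_gaussianPDF 0 1) (Eventually.of_forall fun _ =>
      gaussianPDF_lt_top)]
  have h := (integrable_exp_neg_mul_sq (b := 1 / 2 - a) (by linarith)).const_mul
    ((√(2 * Real.pi * (1 : NNReal)))⁻¹)
  refine h.congr (Eventually.of_forall fun x => ?_)
  simp only [toReal_gaussianPDF, gaussianPDFReal]
  rw [mul_left_comm, ← Real.exp_add]
  congr 2
  simp; ring

lemma integrable_exp_sum_sq {a : ℝ} (ha : a < 1 / 2) :
    Integrable (fun η : ι → ℝ => Real.exp (a * ∑ i, η i ^ 2)) (stdGauss ι) := by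
  have := Integrable.fintype_prod (ι := ι) (E := ℝ) (𝕜 := ℝ)
    (f := fun _ x => Real.exp (a * x ^ 2)) (μ := fun _ => gaussianReal 0 1)
    fun _ => integrable_exp_mul_sq_gaussianReal ha
  simpa [stdGauss, Finset.mul_sum, Real.exp_sum] using this

lemma sq_norm_le_sum_sq (η : ι → ℝ) : ‖η‖ ^ 2 ≤ ∑ i, η i ^ 2 := by
  have h0 : 0 ≤ ∑ i, η i ^ 2 := Finset.sum_nonneg fun i _ => sq_nonneg _
  have : ‖η‖ ≤ √(∑ i, η i ^ 2) := by
    refine (pi_norm_le_iff_of_nonneg (Real.sqrt_nonneg _)).2 fun i => ?_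
    rw [Real.norm_eq_abs]
    refine Real.abs_le_sqrt ?_
    exact Finset.single_le_sum (f := fun i => η i ^ 2) (fun i _ => sq_nonneg _) (Finset.mem_univ i)
  calc ‖η‖ ^ 2 ≤ √(∑ i, η i ^ 2) ^ 2 := by gcongr
    _ = _ := Real.sq_sqrt h0

/-- Any polynomial factor costs only 1/8 in the quadratic exponent, where the total must stay below
1/2. The 3 comes from 1 + x ≤ 3 + x²/8. -/
lemma one_add_norm_pow_le_exp (k : ℕ) (η : ι → ℝ) :
    (1 + ‖η‖) ^ k ≤ (k.factorial * Real.exp 3) * Real.exp (1 / 8 * ∑ i, η i ^ 2) := by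
  have h1 := Real.pow_div_factorial_le_exp (1 + ‖η‖) (by positivity) k
  rw [div_le_iff₀ (by positivity)] at h1
  refine h1.trans ?_
  rw [mul_comm, mul_assoc, ← Real.exp_add]
  refine mul_le_mul_of_nonneg_left (Real.exp_le_exp.2 ?_) (by positivity)
  nlinarith [sq_norm_le_sum_sq η, sq_nonneg (‖η‖ - 4)]

lemma integrable_of_le_exp {g : (ι → ℝ) → ℝ} (hg : Measurable g) {A a : ℝ} (ha : a < 1 / 2)
    (h : ∀ η, |g η| ≤ A * Real.exp (a * ∑ i, η i ^ 2)) : Integrable g (stdGauss ι) :=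
  ((integrable_exp_sum_sq ha).const_mul A).mono' hg.aestronglyMeasurable (Eventually.of_forall h)

end GaussianBounds

/-! ### Families of uniform polynomial growth -/

section PolyBdd

variable {ι : Type*} [Fintype ι] {I : Set ℝ} {F G : ℝ → (ι → ℝ) → ℝ}

/-- A family of measurable functions of polynomial growth, uniformly in the parameter. -/
def PolyBdd (I : Set ℝ) (F : ℝ → (ι → ℝ) → ℝ) : Prop :=
  (∀ θ ∈ I, Measurable (F θ)) ∧
    ∃ (C : ℝ) (k : ℕ), 0 ≤ C ∧ ∀ θ ∈ I, ∀ ω, |F θ ω| ≤ C * (1 + ‖ω‖) ^ k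

lemma PolyBdd.mono (hF : ∀ θ ∈ I, Measurable (F θ)) (hG : PolyBdd I G)
    (h : ∀ θ ∈ I, ∀ ω, |F θ ω| ≤ G θ ω) : PolyBdd I F := by
  obtain ⟨-, C, k, hC, hb⟩ := hG
  exact ⟨hF, C, k, hC, fun θ hθ ω => (h θ hθ ω).trans ((le_abs_self _).trans (hb θ hθ ω))⟩

lemma polyBdd_coeff {a : ℝ → ℝ} (h : ∃ C, ∀ θ ∈ I, |a θ| ≤ C) :
    PolyBdd I fun θ (_ : ι → ℝ) => a θ := by
  obtain ⟨C, hC⟩ := h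
  refine ⟨fun θ _ => measurable_const, |C|, 0, abs_nonneg _, fun θ hθ ω => ?_⟩
  simpa using (hC θ hθ).trans (le_abs_self C)

lemma polyBdd_const (r : ℝ) : PolyBdd I fun _ (_ : ι → ℝ) => r :=
  polyBdd_coeff ⟨|r|, fun _ _ => le_rfl⟩

lemma polyBdd_coord (i : ι) : PolyBdd I fun _ (ω : ι → ℝ) => ω i := by
  refine ⟨fun θ _ => measurable_pi_apply i, 1, 1, zero_le_one, fun θ _ ω => ?_⟩
  have := norm_le_pi_norm ω i
  rw [Real.norm_eq_abs] at this
  linarith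

lemma polyBdd_norm : PolyBdd I fun _ (ω : ι → ℝ) => 1 + ‖ω‖ := by
  refine ⟨fun θ _ => by fun_prop, 1, 1, zero_le_one, fun θ _ ω => ?_⟩
  rw [abs_of_nonneg (by positivity)]; simp

lemma PolyBdd.abs (hF : PolyBdd I F) : PolyBdd I fun θ ω => |F θ ω| := by
  obtain ⟨hm, C, k, hC, hb⟩ := hF
  refine ⟨fun θ hθ => (hm θ hθ).abs, C, k, hC, fun θ hθ ω => ?_⟩
  rw [abs_abs]; exact hb θ hθ ω

lemma PolyBdd.neg (hF : PolyBdd I F) : PolyBdd I fun θ ω => -F θ ω := by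
  obtain ⟨hm, C, k, hC, hb⟩ := hF
  refine ⟨fun θ hθ => (hm θ hθ).neg, C, k, hC, fun θ hθ ω => ?_⟩
  rw [abs_neg]; exact hb θ hθ ω

lemma PolyBdd.add (hF : PolyBdd I F) (hG : PolyBdd I G) :
    PolyBdd I fun θ ω => F θ ω + G θ ω := by
  obtain ⟨hm, C, k, hC, hb⟩ := hF
  obtain ⟨hm', C', k', hC', hb'⟩ := hG
  refine ⟨fun θ hθ => (hm θ hθ).add (hm' θ hθ), C + C', max k k', by positivity,
    fun θ hθ ω => ?_⟩
  have h1 : 1 ≤ 1 + ‖ω‖ := by linarith [norm_nonneg ω]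
  calc |F θ ω + G θ ω| ≤ |F θ ω| + |G θ ω| := abs_add_le _ _
    _ ≤ C * (1 + ‖ω‖) ^ k + C' * (1 + ‖ω‖) ^ k' := add_le_add (hb θ hθ ω) (hb' θ hθ ω)
    _ ≤ C * (1 + ‖ω‖) ^ max k k' + C' * (1 + ‖ω‖) ^ max k k' := by
        gcongr
        · exact le_max_left _ _
        · exact le_max_right _ _
    _ = _ := by ring

lemma PolyBdd.sub (hF : PolyBdd I F) (hG : PolyBdd I G) :
    PolyBdd I fun θ ω => F θ ω - G θ ω := by
  simpa only [sub_eq_add_neg] using hF.add hG.neg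

lemma PolyBdd.mul (hF : PolyBdd I F) (hG : PolyBdd I G) :
    PolyBdd I fun θ ω => F θ ω * G θ ω := by
  obtain ⟨hm, C, k, hC, hb⟩ := hF
  obtain ⟨hm', C', k', hC', hb'⟩ := hG
  refine ⟨fun θ hθ => (hm θ hθ).mul (hm' θ hθ), C * C', k + k', by positivity, fun θ hθ ω => ?_⟩
  rw [abs_mul, pow_add]
  calc _ ≤ (C * (1 + ‖ω‖) ^ k) * (C' * (1 + ‖ω‖) ^ k') :=
        mul_le_mul (hb θ hθ ω) (hb' θ hθ ω) (abs_nonneg _) (by positivity)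
    _ = _ := by ring

lemma PolyBdd.const_mul (hF : PolyBdd I F) (r : ℝ) : PolyBdd I fun θ ω => r * F θ ω :=
  (polyBdd_const r).mul hF

lemma PolyBdd.pow (hF : PolyBdd I F) (n : ℕ) : PolyBdd I fun θ ω => F θ ω ^ n := by
  induction n with
  | zero => simpa using polyBdd_const 1
  | succ n ih => simpa only [pow_succ] using ih.mul hF

lemma PolyBdd.sum {κ : Type*} (s : Finset κ) {F : κ → ℝ → (ι → ℝ) → ℝ}
    (hF : ∀ j ∈ s, PolyBdd I (F j)) : PolyBdd I fun θ ω => ∑ j ∈ s, F j θ ω := by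
  classical
  induction s using Finset.induction_on with
  | empty => simpa using polyBdd_const 0
  | insert j s hj ih =>
    simp only [Finset.sum_insert hj]
    exact (hF j (Finset.mem_insert_self _ _)).add
      (ih fun i hi => hF i (Finset.mem_insert_of_mem hi))

lemma one_add_norm_mix_pow_le (S : Set ι) (η ω : ι → ℝ) (k : ℕ) :
    (1 + ‖mix S η ω‖) ^ k ≤ (1 + ‖ω‖) ^ k * (1 + ‖η‖) ^ k := by
  rw [← mul_pow]
  gcongr
  nlinarith [norm_mix_le S η ω, norm_nonneg η, norm_nonneg ω]

lemma PolyBdd.avgIntegrable (hF : PolyBdd I F) (S : Set ι) {θ : ℝ} (hθ : θ ∈ I) :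
    AvgIntegrable S (F θ) := by
  obtain ⟨hm, C, k, hC, hb⟩ := hF
  intro ω
  refine integrable_of_le_exp ((hm θ hθ).comp (measurable_mix_left _ _)) (a := 1 / 8)
    (A := C * (1 + ‖ω‖) ^ k * (k.factorial * Real.exp 3)) (by norm_num) fun η => ?_
  calc _ ≤ C * (1 + ‖mix S η ω‖) ^ k := hb θ hθ _
    _ ≤ C * ((1 + ‖ω‖) ^ k * (1 + ‖η‖) ^ k) := by gcongr; exact one_add_norm_mix_pow_le S η ω k
    _ ≤ C * ((1 + ‖ω‖) ^ k * (k.factorial * Real.exp 3 * Real.exp (1 / 8 * ∑ i, η i ^ 2))) := by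
        gcongr; exact one_add_norm_pow_le_exp k η
    _ = _ := by ring

lemma PolyBdd.integrable (hF : PolyBdd I F) {θ : ℝ} (hθ : θ ∈ I) :
    Integrable (F θ) (stdGauss ι) := (hF.avgIntegrable univ hθ).integrable

lemma integrable_one_add_norm_pow (k : ℕ) :
    Integrable (fun η : ι → ℝ => (1 + ‖η‖) ^ k) (stdGauss ι) :=
  (polyBdd_norm.pow k).integrable (mem_univ (0 : ℝ))

/-- The growth bound factors into a power of 1 + ‖ω‖ and a power of 1 + ‖η‖, and the latter has a
finite Gaussian moment. -/
lemma PolyBdd.comp_avg (hF : PolyBdd I F) (S : Set ι) : PolyBdd I fun θ => avg S (F θ) := by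
  have hF' := hF
  obtain ⟨hm, C, k, hC, hb⟩ := hF
  refine PolyBdd.mono (fun θ hθ => measurable_avg S (hm θ hθ))
    (((polyBdd_norm.pow k).const_mul (C * ∫ η : ι → ℝ, (1 + ‖η‖) ^ k ∂(stdGauss ι))))
    fun θ hθ ω => ?_
  calc |avg S (F θ) ω| ≤ ∫ η, |F θ (mix S η ω)| ∂(stdGauss ι) :=
        abs_integral_le_integral_abs
    _ ≤ ∫ η, C * (1 + ‖ω‖) ^ k * (1 + ‖η‖) ^ k ∂(stdGauss ι) := by
        refine integral_mono (hF'.avgIntegrable S hθ ω).abs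
          ((integrable_one_add_norm_pow k).const_mul _) fun η => ?_
        calc _ ≤ C * (1 + ‖mix S η ω‖) ^ k := hb θ hθ _
          _ ≤ C * ((1 + ‖ω‖) ^ k * (1 + ‖η‖) ^ k) := by
            gcongr; exact one_add_norm_mix_pow_le S η ω k
          _ = _ := by ring
    _ = _ := by rw [integral_const_mul]; ring

end PolyBdd

/-! ### Log-averages and tilted averages: growth and differentiation -/

section Tilt

variable {ι : Type*} [Fintype ι]

/-- The logarithm of the `L^m` average over the coordinates in `S` of `exp W`. -/
def logAvg (S : Set ι) (m : ℝ) (W : (ι → ℝ) → ℝ) (ω : ι → ℝ) : ℝ :=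
  if m = 0 then avg S W ω else 1 / m * Real.log (avg S (fun η => Real.exp (m * W η)) ω)

/-- The average over the coordinates in `S` with density proportional to `exp (m W)`. -/
def tilt (S : Set ι) (m : ℝ) (W F : (ι → ℝ) → ℝ) (ω : ι → ℝ) : ℝ :=
  avg S (fun η => Real.exp (m * (W η - logAvg S m W η)) * F η) ω

/-- A family of functions with a common quadratic upper bound. -/
def QuadBdd (c : ι → ℝ) (I : Set ℝ) (W : ℝ → (ι → ℝ) → ℝ) : Prop :=
  ∃ C, 0 ≤ C ∧ ∀ θ ∈ I, ∀ ω, W θ ω ≤ C + ∑ i, c i * ω i ^ 2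

lemma measurable_logAvg (S : Set ι) (m : ℝ) {W : (ι → ℝ) → ℝ} (hW : Measurable W) :
    Measurable (logAvg S m W) := by
  unfold logAvg
  by_cases hm : m = 0
  · simpa [hm] using measurable_avg S hW
  · simp only [hm, if_false]
    exact (Real.measurable_log.comp (measurable_avg S (by fun_prop))).const_mul _

lemma dependsOn_logAvg {S T : Set ι} {m : ℝ} {W : (ι → ℝ) → ℝ} (hW : DependsOn W T) :
    DependsOn (logAvg S m W) (T \ S) := by
  intro ω ω' h
  unfold logAvg
  rw [dependsOn_avg hW h,
    dependsOn_avg (g := fun η => Real.exp (m * W η)) (fun _ _ h' => by simp only [hW h']) h]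

lemma dependsOn_logAvg_compl (S : Set ι) (m : ℝ) (W : (ι → ℝ) → ℝ) :
    DependsOn (logAvg S m W) Sᶜ := by
  simpa [compl_eq_univ_sdiff] using dependsOn_logAvg (S := S) (m := m) (dependsOn_univ W)

/-- The log-average no longer depends on the coordinates in `S`, so the normalization leaves the
average. -/
lemma tilt_eq (S : Set ι) (m : ℝ) (W F : (ι → ℝ) → ℝ) (ω : ι → ℝ) :
    tilt S m W F ω = Real.exp (-(m * logAvg S m W ω)) *
      avg S (fun η => Real.exp (m * W η) * F η) ω := by
  rw [tilt, ← avg_mul_of_dependsOn (f := fun ω => Real.exp (-(m * logAvg S m W ω)))]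
  · congr 1
    funext η
    rw [← mul_assoc, ← Real.exp_add]
    ring_nf
  · intro x y h
    simp only [dependsOn_logAvg_compl S m W h]

variable {I : Set ℝ} {c : ι → ℝ} {S : Set ι} {m : ℝ} {W F : ℝ → (ι → ℝ) → ℝ}

lemma sum_mul_sq_mix_le (hc : ∀ i, 0 ≤ c i) (hcS : ∀ i ∈ S, c i ≤ 1 / 8) (η ω : ι → ℝ) :
    ∑ i, c i * mix S η ω i ^ 2 ≤ ∑ i, c i * ω i ^ 2 + 1 / 8 * ∑ i, η i ^ 2 := by
  rw [Finset.mul_sum, ← Finset.sum_add_distrib]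
  refine Finset.sum_le_sum fun i _ => ?_
  by_cases h : i ∈ S
  · rw [mix_of_mem h]
    nlinarith [hcS i h, hc i, sq_nonneg (η i), sq_nonneg (ω i), mul_nonneg (hc i) (sq_nonneg (ω i))]
  · rw [mix_of_notMem h]
    nlinarith [sq_nonneg (η i)]

lemma exp_mul_mix_le (hc : ∀ i, 0 ≤ c i) (hcS : ∀ i ∈ S, c i ≤ 1 / 8) (hm0 : 0 ≤ m)
    (hm1 : m ≤ 1) {W : (ι → ℝ) → ℝ} {C : ℝ} (hW : ∀ ω, W ω ≤ C + ∑ i, c i * ω i ^ 2)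
    (η ω : ι → ℝ) : Real.exp (m * W (mix S η ω)) ≤
      Real.exp (m * (C + ∑ i, c i * ω i ^ 2)) * Real.exp (1 / 8 * ∑ i, η i ^ 2) := by
  rw [← Real.exp_add]
  refine Real.exp_le_exp.2 ?_
  have h0 : 0 ≤ ∑ i, η i ^ 2 := Finset.sum_nonneg fun i _ => sq_nonneg _
  calc m * W (mix S η ω) ≤ m * (C + (∑ i, c i * ω i ^ 2 + 1 / 8 * ∑ i, η i ^ 2)) := by
        gcongr
        exact (hW _).trans (by gcongr; exact sum_mul_sq_mix_le hc hcS η ω)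
    _ ≤ _ := by nlinarith

/-- At fixed `ω` the bound is uniform in the parameter, so it can dominate a derivative. The
exponent 1/4 is 1/8 for the energy plus 1/8 for the polynomial factor. -/
lemma exists_exp_mul_mul_le (hc : ∀ i, 0 ≤ c i) (hcS : ∀ i ∈ S, c i ≤ 1 / 8) (hm0 : 0 ≤ m)
    (hm1 : m ≤ 1) (hW : QuadBdd c I W) (hF : PolyBdd I F) (ω : ι → ℝ) :
    ∃ A, ∀ θ ∈ I, ∀ η, |Real.exp (m * W θ (mix S η ω)) * F θ (mix S η ω)| ≤
      A * Real.exp (1 / 4 * ∑ i, η i ^ 2) := by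
  obtain ⟨C, hC, hW⟩ := hW
  obtain ⟨-, B, k, hB, hb⟩ := hF
  refine ⟨Real.exp (m * (C + ∑ i, c i * ω i ^ 2)) *
    (B * ((1 + ‖ω‖) ^ k * (k.factorial * Real.exp 3))), fun θ hθ η => ?_⟩
  rw [abs_mul, abs_of_pos (Real.exp_pos _)]
  have h1 := exp_mul_mix_le hc hcS hm0 hm1 (hW θ hθ) η ω
  have h2 : |F θ (mix S η ω)| ≤ B * ((1 + ‖ω‖) ^ k *
      ((k.factorial * Real.exp 3) * Real.exp (1 / 8 * ∑ i, η i ^ 2))) :=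
    (hb θ hθ _).trans (by
      gcongr
      refine (one_add_norm_mix_pow_le S η ω k).trans ?_
      gcongr; exact one_add_norm_pow_le_exp k η)
  refine (mul_le_mul h1 h2 (abs_nonneg _) (by positivity)).trans (le_of_eq ?_)
  have : Real.exp (1 / 4 * ∑ i, η i ^ 2) =
      Real.exp (1 / 8 * ∑ i, η i ^ 2) * Real.exp (1 / 8 * ∑ i, η i ^ 2) := by
    rw [← Real.exp_add]; ring_nf
  rw [this]; ring

lemma avgIntegrable_exp_mul_mul (hc : ∀ i, 0 ≤ c i) (hcS : ∀ i ∈ S, c i ≤ 1 / 8) (hm0 : 0 ≤ m)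
    (hm1 : m ≤ 1) (hWp : PolyBdd I W) (hW : QuadBdd c I W) (hF : PolyBdd I F) {θ : ℝ}
    (hθ : θ ∈ I) : AvgIntegrable S fun η => Real.exp (m * W θ η) * F θ η := by
  intro ω
  obtain ⟨A, hA⟩ := exists_exp_mul_mul_le hc hcS hm0 hm1 hW hF ω
  have h1 := hWp.1 θ hθ
  have h2 := hF.1 θ hθ
  refine integrable_of_le_exp (a := 1 / 4) (A := A) ?_ (by norm_num) (hA θ hθ)
  exact Measurable.comp (g := fun η => Real.exp (m * W θ η) * F θ η) (by fun_prop)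
    (measurable_mix_left _ _)

lemma avgIntegrable_exp_mul (hc : ∀ i, 0 ≤ c i) (hcS : ∀ i ∈ S, c i ≤ 1 / 8) (hm0 : 0 ≤ m)
    (hm1 : m ≤ 1) (hWp : PolyBdd I W) (hW : QuadBdd c I W) {θ : ℝ}
    (hθ : θ ∈ I) : AvgIntegrable S fun η => Real.exp (m * W θ η) := by
  simpa using avgIntegrable_exp_mul_mul hc hcS hm0 hm1 hWp hW (polyBdd_const 1) hθ

lemma avg_exp_pos (hc : ∀ i, 0 ≤ c i) (hcS : ∀ i ∈ S, c i ≤ 1 / 8) (hm0 : 0 ≤ m)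
    (hm1 : m ≤ 1) (hWp : PolyBdd I W) (hW : QuadBdd c I W) {θ : ℝ}
    (hθ : θ ∈ I) (ω : ι → ℝ) : 0 < avg S (fun η => Real.exp (m * W θ η)) ω :=
  integral_exp_pos (avgIntegrable_exp_mul hc hcS hm0 hm1 hWp hW hθ ω)

/-- At m = 0 both sides are 1. Hence the tilting density has average one without a case distinction
on m. -/
lemma exp_mul_logAvg (hc : ∀ i, 0 ≤ c i) (hcS : ∀ i ∈ S, c i ≤ 1 / 8) (hm0 : 0 ≤ m)
    (hm1 : m ≤ 1) (hWp : PolyBdd I W) (hW : QuadBdd c I W) {θ : ℝ}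
    (hθ : θ ∈ I) (ω : ι → ℝ) : Real.exp (m * logAvg S m (W θ) ω) =
      avg S (fun η => Real.exp (m * W θ η)) ω := by
  by_cases h : m = 0
  · simp [h, avg_const]
  · rw [logAvg, if_neg h, ← mul_assoc, mul_one_div_cancel h, one_mul,
      Real.exp_log (avg_exp_pos hc hcS hm0 hm1 hWp hW hθ ω)]

/-- Jensen's inequality. -/
lemma avg_le_logAvg (hc : ∀ i, 0 ≤ c i) (hcS : ∀ i ∈ S, c i ≤ 1 / 8) (hm0 : 0 ≤ m)
    (hm1 : m ≤ 1) (hWp : PolyBdd I W) (hW : QuadBdd c I W) {θ : ℝ}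
    (hθ : θ ∈ I) (ω : ι → ℝ) : avg S (W θ) ω ≤ logAvg S m (W θ) ω := by
  by_cases h : m = 0
  · simp [h, logAvg]
  · have hm : 0 < m := lt_of_le_of_ne hm0 (Ne.symm h)
    refine le_of_mul_le_mul_left (Real.exp_le_exp.1 ?_) hm
    rw [exp_mul_logAvg hc hcS hm0 hm1 hWp hW hθ, avg, ← integral_const_mul]
    exact convexOn_exp.map_integral_le Real.continuous_exp.continuousOn isClosed_univ
      (Eventually.of_forall fun _ => mem_univ _) ((hWp.avgIntegrable S hθ ω).const_mul m)
      (avgIntegrable_exp_mul hc hcS hm0 hm1 hWp hW hθ ω)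

/-- Replacing the coordinates in `S` by Gaussian ones adds at most Σ η_i²/8 to the bound. Its
exponential has a finite mean `E`, so only the constant changes, by (log E)/m, or by at most E when
m = 0. -/
lemma QuadBdd.comp_logAvg (hc : ∀ i, 0 ≤ c i) (hcS : ∀ i ∈ S, c i ≤ 1 / 8) (hm0 : 0 ≤ m)
    (hm1 : m ≤ 1) (hWp : PolyBdd I W) (hW : QuadBdd c I W) :
    QuadBdd c I fun θ => logAvg S m (W θ) := by
  have hW' := hW
  obtain ⟨C, hC, hb⟩ := hW
  have hE := integrable_exp_sum_sq (ι := ι) (a := 1 / 8) (by norm_num)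
  set E := ∫ η : ι → ℝ, Real.exp (1 / 8 * ∑ i, η i ^ 2) ∂(stdGauss ι) with hEdef
  have hE1 : 1 ≤ E := by
    have : ∫ η : ι → ℝ, (1 : ℝ) ∂(stdGauss ι) ≤ E := by
      refine integral_mono (integrable_const _) hE fun η => ?_
      exact Real.one_le_exp (mul_nonneg (by norm_num) (Finset.sum_nonneg fun i _ => sq_nonneg _))
    simpa using this
  by_cases h : m = 0
  · refine ⟨C + E, by positivity, fun θ hθ ω => ?_⟩
    simp only [logAvg, h, if_true]
    calc avg S (W θ) ω ≤ ∫ η, ((C + ∑ i, c i * ω i ^ 2) + Real.exp (1 / 8 * ∑ i, η i ^ 2))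
          ∂(stdGauss ι) := by
          refine integral_mono (hWp.avgIntegrable S hθ ω) ((integrable_const _).add hE) fun η => ?_
          have := hb θ hθ (mix S η ω)
          have h2 := sum_mul_sq_mix_le hc hcS η ω
          have h3 := Real.add_one_le_exp (1 / 8 * ∑ i, η i ^ 2)
          simp only
          linarith
      _ = _ := by
          rw [integral_add (integrable_const _) hE, ← hEdef, integral_const, probReal_univ,
            one_smul]
          ring
  · have hm : 0 < m := lt_of_le_of_ne hm0 (Ne.symm h)
    refine ⟨C + 1 / m * Real.log E, by
      have := Real.log_nonneg hE1
      positivity, fun θ hθ ω => ?_⟩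
    simp only [logAvg, h, if_false]
    have hpos := avg_exp_pos hc hcS hm0 hm1 hWp hW' hθ ω
    have : avg S (fun η => Real.exp (m * W θ η)) ω ≤
        Real.exp (m * (C + ∑ i, c i * ω i ^ 2)) * E := by
      rw [hEdef, ← integral_const_mul]
      exact integral_mono (avgIntegrable_exp_mul hc hcS hm0 hm1 hWp hW' hθ ω) (hE.const_mul _)
        fun η => exp_mul_mix_le hc hcS hm0 hm1 (hb θ hθ) η ω
    calc _ ≤ 1 / m * Real.log (Real.exp (m * (C + ∑ i, c i * ω i ^ 2)) * E) := by gcongr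
      _ = _ := by
        rw [Real.log_mul (Real.exp_pos _).ne' (by positivity), Real.log_exp]
        field_simp
        ring

/-- The quadratic bound controls the log-average from above, and Jensen controls it from below by
the plain average. -/
lemma PolyBdd.comp_logAvg (hc : ∀ i, 0 ≤ c i) (hcS : ∀ i ∈ S, c i ≤ 1 / 8) (hm0 : 0 ≤ m)
    (hm1 : m ≤ 1) (hWp : PolyBdd I W) (hW : QuadBdd c I W) :
    PolyBdd I fun θ => logAvg S m (W θ) := by
  obtain ⟨C, hC, hb⟩ := QuadBdd.comp_logAvg hc hcS hm0 hm1 hWp hW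
  refine PolyBdd.mono (fun θ hθ => measurable_logAvg S m (hWp.1 θ hθ))
    ((hWp.comp_avg S).abs.add ((polyBdd_const C).add
      (PolyBdd.sum Finset.univ fun i _ => ((polyBdd_coord i).pow 2).const_mul (c i))))
    fun θ hθ ω => ?_
  have h0 : 0 ≤ ∑ i, c i * ω i ^ 2 := Finset.sum_nonneg fun i _ => mul_nonneg (hc i) (sq_nonneg _)
  have h1 := hb θ hθ ω
  have h2 := avg_le_logAvg hc hcS hm0 hm1 hWp hW hθ ω
  have h3 := neg_abs_le (avg S (W θ) ω)
  have h4 := abs_nonneg (avg S (W θ) ω)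
  exact abs_le.2 ⟨by linarith, by linarith⟩

/-- For x ≤ ρ the polynomial factor is frozen at ρ. For x ≥ ρ one has ρ ≤ ρ² ≤ s, so the constant
ρ/8 in the exponent is absorbed by s/8 and the factor exp(-Q) survives. -/
lemma exp_mul_pow_le {m w Q ρ x s : ℝ} {n : ℕ} (hx : 0 ≤ x)
    (hs : x ^ 2 ≤ s) (hw : m * w ≤ 8⁻¹ * ρ - Q + 8⁻¹ * s) (hρ1 : 1 ≤ ρ) :
    Real.exp (m * w) * (1 + x) ^ n ≤
      (1 + ρ) ^ n * Real.exp (m * w) + Real.exp (-Q) * (Real.exp (1 / 4 * s) * (1 + x) ^ n) := by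
  rcases le_total x ρ with h | h
  · have : Real.exp (m * w) * (1 + x) ^ n ≤ (1 + ρ) ^ n * Real.exp (m * w) := by
      rw [mul_comm]; gcongr
    have h2 : 0 ≤ Real.exp (-Q) * (Real.exp (1 / 4 * s) * (1 + x) ^ n) := by positivity
    linarith
  · have h2 : 0 ≤ (1 + ρ) ^ n * Real.exp (m * w) := by positivity
    have : Real.exp (m * w) ≤ Real.exp (-Q) * Real.exp (1 / 4 * s) := by
      rw [← Real.exp_add]
      refine Real.exp_le_exp.2 ?_
      have : ρ ≤ s := by nlinarith
      linarith
    calc _ ≤ (Real.exp (-Q) * Real.exp (1 / 4 * s)) * (1 + x) ^ n := by gcongr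
      _ ≤ _ := by linarith

/-- Bounding numerator and denominator of the tilted average separately would lose a factor
exponential in ω. Instead the integral is cut at a radius `ρ` polynomial in ω. Inside, the numerator
is at most (1 + ρ)^n times the denominator `M`; outside, it is at most exp(-Q) times a Gaussian
constant, and exp(-Q) ≤ M by Jensen. -/
lemma PolyBdd.comp_tilt (hc : ∀ i, 0 ≤ c i) (hcS : ∀ i ∈ S, c i ≤ 1 / 8) (hm0 : 0 ≤ m)
    (hm1 : m ≤ 1) (hWp : PolyBdd I W) (hW : QuadBdd c I W) (hF : PolyBdd I F) :
    PolyBdd I fun θ => tilt S m (W θ) (F θ) := by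
  have hF' := hF
  have hW' := hW
  obtain ⟨hFm, B, n, hB, hFb⟩ := hF
  obtain ⟨C, hC, hb⟩ := hW
  set E := ∫ η : ι → ℝ, Real.exp (1 / 4 * ∑ i, η i ^ 2) * (1 + ‖η‖) ^ n ∂(stdGauss ι) with hEdef
  have hEi : Integrable (fun η : ι → ℝ => Real.exp (1 / 4 * ∑ i, η i ^ 2) * (1 + ‖η‖) ^ n)
      (stdGauss ι) := by
    -- 3/8 is the given 1/4 plus 1/8 for the polynomial factor.
    refine integrable_of_le_exp (a := 3 / 8) (A := n.factorial * Real.exp 3) (by fun_prop)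
      (by norm_num) fun η => ?_
    rw [abs_of_nonneg (by positivity)]
    calc _ ≤ Real.exp (1 / 4 * ∑ i, η i ^ 2) *
          ((n.factorial * Real.exp 3) * Real.exp (1 / 8 * ∑ i, η i ^ 2)) := by
            gcongr; exact one_add_norm_pow_le_exp n η
      _ = (n.factorial * Real.exp 3) * (Real.exp (1 / 4 * ∑ i, η i ^ 2) *
          Real.exp (1 / 8 * ∑ i, η i ^ 2)) := by ring
      _ = _ := by rw [← Real.exp_add]; ring_nf
  have hE0 : 0 ≤ E := integral_nonneg fun η => by positivity
  -- The factor 8 matches the exponent s/8 in `exp_mul_pow_le`; the summands are 1 for ρ ≥ 1, the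
  -- Jensen term, and the quadratic bound.
  let ρ : ℝ → (ι → ℝ) → ℝ := fun θ ω => 8 * (1 + |avg S (W θ) ω| + (C + ∑ i, c i * ω i ^ 2))
  have hρ : PolyBdd I ρ := (((polyBdd_const 1).add (hWp.comp_avg S).abs).add ((polyBdd_const C).add
      (PolyBdd.sum Finset.univ fun i _ => ((polyBdd_coord i).pow 2).const_mul (c i)))).const_mul 8
  refine PolyBdd.mono (fun θ hθ => ?_)
    (((polyBdd_norm.pow n).const_mul B).mul ((((polyBdd_const 1).add hρ).pow n).add
      (polyBdd_const E))) fun θ hθ ω => ?_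
  · have h1 := measurable_logAvg S m (hWp.1 θ hθ)
    have h2 := hWp.1 θ hθ
    have h3 := hFm θ hθ
    exact measurable_avg S (by fun_prop)
  rw [tilt_eq, Real.exp_neg, exp_mul_logAvg hc hcS hm0 hm1 hWp hW' hθ, abs_mul, abs_inv,
    abs_of_pos (avg_exp_pos hc hcS hm0 hm1 hWp hW' hθ ω), inv_mul_le_iff₀
    (avg_exp_pos hc hcS hm0 hm1 hWp hW' hθ ω)]
  have hMi := avgIntegrable_exp_mul (S := S) hc hcS hm0 hm1 hWp hW' hθ ω
  have h0 : 0 ≤ ∑ i, c i * ω i ^ 2 := Finset.sum_nonneg fun i _ => mul_nonneg (hc i) (sq_nonneg _)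
  set Q := |avg S (W θ) ω| with hQ
  have hQ0 : 0 ≤ Q := abs_nonneg _
  have hMQ : Real.exp (-Q) ≤ avg S (fun η => Real.exp (m * W θ η)) ω := by
    rw [← exp_mul_logAvg hc hcS hm0 hm1 hWp hW' hθ]
    refine Real.exp_le_exp.2 ?_
    have h1 := avg_le_logAvg hc hcS hm0 hm1 hWp hW' hθ ω
    have h3 := neg_abs_le (avg S (W θ) ω)
    have h4 : -Q ≤ logAvg S m (W θ) ω := by linarith
    nlinarith
  set M := avg S (fun η => Real.exp (m * W θ η)) ω with hM
  have hρ1 : 1 ≤ ρ θ ω := by simp only [ρ]; linarith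
  have key : ∀ η, |Real.exp (m * W θ (mix S η ω)) * F θ (mix S η ω)| ≤ B * (1 + ‖ω‖) ^ n *
      ((1 + ρ θ ω) ^ n * Real.exp (m * W θ (mix S η ω)) +
        Real.exp (-Q) * (Real.exp (1 / 4 * ∑ i, η i ^ 2) * (1 + ‖η‖) ^ n)) := by
    intro η
    have hexp := exp_mul_pow_le (m := m) (w := W θ (mix S η ω)) (Q := Q) (ρ := ρ θ ω) (x := ‖η‖)
      (s := ∑ i, η i ^ 2) (n := n) (norm_nonneg _) (sq_norm_le_sum_sq η) (by
        have h1 : 0 ≤ ∑ i, η i ^ 2 := Finset.sum_nonneg fun i _ => sq_nonneg _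
        have h2 := hb θ hθ (mix S η ω)
        have h3 := sum_mul_sq_mix_le hc hcS η ω
        have h4 : W θ (mix S η ω) ≤ C + ∑ i, c i * ω i ^ 2 + 1 / 8 * ∑ i, η i ^ 2 := by linarith
        have h5 : m * W θ (mix S η ω) ≤
          1 * (C + ∑ i, c i * ω i ^ 2 + 1 / 8 * ∑ i, η i ^ 2) := by
          refine (mul_le_mul_of_nonneg_left h4 hm0).trans ?_
          gcongr
        simp only [ρ]
        linarith) hρ1
    rw [abs_mul, abs_of_pos (Real.exp_pos _)]
    calc _ ≤ Real.exp (m * W θ (mix S η ω)) * (B * ((1 + ‖ω‖) ^ n * (1 + ‖η‖) ^ n)) := by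
          gcongr
          exact (hFb θ hθ _).trans (by gcongr; exact one_add_norm_mix_pow_le S η ω n)
      _ = B * (1 + ‖ω‖) ^ n * (Real.exp (m * W θ (mix S η ω)) * (1 + ‖η‖) ^ n) := by ring
      _ ≤ _ := by gcongr
  have hi1 : Integrable (fun η => (1 + ρ θ ω) ^ n * Real.exp (m * W θ (mix S η ω)))
    (stdGauss ι) := hMi.const_mul _
  have hi2 := hEi.const_mul (Real.exp (-Q))
  calc _ ≤ ∫ η, |Real.exp (m * W θ (mix S η ω)) * F θ (mix S η ω)| ∂(stdGauss ι) :=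
        abs_integral_le_integral_abs
    _ ≤ _ := integral_mono (avgIntegrable_exp_mul_mul hc hcS hm0 hm1 hWp hW' hF' hθ ω).abs
        ((hi1.add hi2).const_mul _) key
    _ = B * (1 + ‖ω‖) ^ n * ((1 + ρ θ ω) ^ n * M + Real.exp (-Q) * E) := by
        rw [integral_const_mul]
        congr 1
        refine (integral_add hi1 hi2).trans ?_
        rw [integral_const_mul, integral_const_mul]
        rfl
    _ ≤ B * (1 + ‖ω‖) ^ n * ((1 + ρ θ ω) ^ n * M + M * E) := by gcongr
    _ = _ := by ring

/-- The derivative of `logAvg` with respect to a parameter is a tilted average. -/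
lemma hasDerivAt_logAvg {W' : ℝ → (ι → ℝ) → ℝ} (hI : IsOpen I) (hc : ∀ i, 0 ≤ c i)
    (hcS : ∀ i ∈ S, c i ≤ 1 / 8) (hm0 : 0 ≤ m) (hm1 : m ≤ 1) (hWp : PolyBdd I W)
    (hW : QuadBdd c I W) (hWp' : PolyBdd I W')
    (hderiv : ∀ θ ∈ I, ∀ ω, HasDerivAt (fun θ => W θ ω) (W' θ ω) θ) {θ : ℝ} (hθ : θ ∈ I)
    (ω : ι → ℝ) :
    HasDerivAt (fun θ => logAvg S m (W θ) ω) (tilt S m (W θ) (W' θ) ω) θ := by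
  have hexp : ∀ (m : ℝ), 0 ≤ m → m ≤ 1 → HasDerivAt
      (fun θ => avg S (fun η => Real.exp (m * W θ η)) ω)
      (avg S (fun η => Real.exp (m * W θ η) * (m * W' θ η)) ω) θ := by
    intro m hm0 hm1
    obtain ⟨A, hA⟩ := exists_exp_mul_mul_le hc hcS hm0 hm1 hW (hWp'.const_mul m) ω
    have hi := avgIntegrable_exp_mul_mul hc hcS hm0 hm1 hWp hW (hWp'.const_mul m) hθ ω
    refine (hasDerivAt_integral_of_dominated_loc_of_deriv_le
      (F := fun θ η => Real.exp (m * W θ (mix S η ω)))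
      (F' := fun θ η => Real.exp (m * W θ (mix S η ω)) * (m * W' θ (mix S η ω)))
      (hI.mem_nhds hθ) ?_ (avgIntegrable_exp_mul hc hcS hm0 hm1 hWp hW hθ ω) hi.aestronglyMeasurable
      (Eventually.of_forall fun η θ' hθ' => hA θ' hθ' η)
      ((integrable_exp_sum_sq (a := 1 / 4) (by norm_num)).const_mul A)
      (Eventually.of_forall fun η θ' hθ' => ?_)).2
    · filter_upwards [hI.mem_nhds hθ] with θ' hθ'
      exact (avgIntegrable_exp_mul hc hcS hm0 hm1 hWp hW hθ' ω).aestronglyMeasurable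
    · exact ((hderiv θ' hθ' _).const_mul m).exp
  -- At m = 0 the log-average is the plain average and the tilting density is 1, so the derivative
  -- passes directly under the integral.
  by_cases h : m = 0
  · subst h
    obtain ⟨A, hA⟩ := exists_exp_mul_mul_le (m := 0) hc hcS le_rfl zero_le_one hW hWp' ω
    have hi := hWp'.avgIntegrable S hθ ω
    have : tilt S 0 (W θ) (W' θ) ω = avg S (W' θ) ω := by simp [tilt]
    rw [this]
    simp only [logAvg, if_true]
    refine (hasDerivAt_integral_of_dominated_loc_of_deriv_le (hI.mem_nhds hθ) ?_
      (hWp.avgIntegrable S hθ ω) hi.aestronglyMeasurable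
      (Eventually.of_forall fun η θ' hθ' => ?_)
      ((integrable_exp_sum_sq (a := 1 / 4) (by norm_num)).const_mul A)
      (Eventually.of_forall fun η θ' hθ' => hderiv θ' hθ' _)).2
    · filter_upwards [hI.mem_nhds hθ] with θ' hθ'
      exact (hWp.avgIntegrable S hθ' ω).aestronglyMeasurable
    · simpa using hA θ' hθ' η
  · simp only [logAvg, h, if_false]
    have hpos := avg_exp_pos (S := S) hc hcS hm0 hm1 hWp hW hθ ω
    refine (((hexp m hm0 hm1).log hpos.ne').const_mul (1 / m)).congr_deriv ?_
    rw [tilt_eq, Real.exp_neg, exp_mul_logAvg hc hcS hm0 hm1 hWp hW hθ]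
    have : avg S (fun η => Real.exp (m * W θ η) * (m * W' θ η)) ω =
        m * avg S (fun η => Real.exp (m * W θ η) * W' θ η) ω := by
      rw [avg, avg, ← integral_const_mul]
      congr 1
      funext η
      ring
    rw [this]
    field_simp

end Tilt

/-! ### Cascades: iterated log-averages over levels and their states -/

/-- The coordinates are distributed over the levels `0, …, depth`; `m a` is the exponent of the
average over level `a`, and `c` gives the coefficients of a quadratic bound of the energy. -/
structure Cascade (ι : Type*) where
  level : ι → ℕ
  depth : ℕ
  m : ℕ → ℝ
  c : ι → ℝ
  level_le : ∀ i, level i ≤ depth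
  m_nonneg : ∀ a, 0 ≤ m a
  m_le_one : ∀ a, m a ≤ 1
  c_nonneg : ∀ i, 0 ≤ c i
  c_le : ∀ i, level i ≠ 0 → c i ≤ 1 / 8

namespace Cascade

variable {ι : Type*} (P : Cascade ι)

/-- The coordinates of level `a`. -/
def block (a : ℕ) : Set ι := {i | P.level i = a}

/-- The coordinates of level greater than `a`. -/
def above (a : ℕ) : Set ι := {i | a < P.level i}

lemma c_le_block (a : ℕ) : ∀ i ∈ P.block (a + 1), P.c i ≤ 1 / 8 := fun i hi =>
  P.c_le i (by rw [show P.level i = a + 1 from hi]; omega)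

lemma above_eq_union (a : ℕ) : P.above a = P.block (a + 1) ∪ P.above (a + 1) := by
  ext i; simp only [above, block, mem_ofPred_eq, mem_union]; omega

lemma univ_eq_union : (univ : Set ι) = P.block 0 ∪ P.above 0 := by
  ext i; simp only [above, block, mem_ofPred_eq, mem_union, mem_univ, true_iff]; omega

lemma disjoint_block_above (a : ℕ) : Disjoint (P.block a) (P.above a) :=
  Set.disjoint_left.2 fun i hi hi' => by
    simp only [above, block, mem_ofPred_eq] at hi hi'; omega

lemma above_depth : P.above P.depth = ∅ := by
  ext i; simpa [above] using P.level_le i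

lemma above_anti {a b : ℕ} (h : a ≤ b) : P.above b ⊆ P.above a := fun _ hi => lt_of_le_of_lt h hi

variable [Fintype ι]

/-- The energies, indexed from the last level downwards. -/
def energyAux (H : (ι → ℝ) → ℝ) : ℕ → (ι → ℝ) → ℝ
  | 0 => H
  | j + 1 => logAvg (P.block (P.depth - j)) (P.m (P.depth - j)) (energyAux H j)

/-- The free energy left after averaging over the levels greater than `a`. -/
def energy (H : (ι → ℝ) → ℝ) (a : ℕ) : (ι → ℝ) → ℝ := P.energyAux H (P.depth - a)

lemma energy_depth (H : (ι → ℝ) → ℝ) : P.energy H P.depth = H := by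
  simp [energy, energyAux]

lemma energy_of_lt (H : (ι → ℝ) → ℝ) {a : ℕ} (ha : a < P.depth) :
    P.energy H a = logAvg (P.block (a + 1)) (P.m (a + 1)) (P.energy H (a + 1)) := by
  have h1 : P.depth - a = (P.depth - (a + 1)) + 1 := by omega
  have h2 : P.depth - (P.depth - (a + 1)) = a + 1 := by omega
  rw [energy, energy, h1, energyAux, h2]

/-- The density of the tilted average over level `b + 1`. -/
def weight (H : (ι → ℝ) → ℝ) (b : ℕ) (ω : ι → ℝ) : ℝ :=
  Real.exp (P.m (b + 1) * (P.energy H (b + 1) ω - P.energy H b ω))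

/-- The density of the tilted averages over the levels `a + 1, …, b`. -/
def density (H : (ι → ℝ) → ℝ) (a b : ℕ) (ω : ι → ℝ) : ℝ := ∏ j ∈ Finset.Ico a b, P.weight H j ω

/-- The tilted average over the levels greater than `a`. -/
def state (H : (ι → ℝ) → ℝ) (a : ℕ) (F : (ι → ℝ) → ℝ) (ω : ι → ℝ) : ℝ :=
  avg (P.above a) (fun η => P.density H a P.depth η * F η) ω

lemma weight_pos (H : (ι → ℝ) → ℝ) (b : ℕ) (ω : ι → ℝ) : 0 < P.weight H b ω := Real.exp_pos _

lemma density_pos (H : (ι → ℝ) → ℝ) (a b : ℕ) (ω : ι → ℝ) : 0 < P.density H a b ω :=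
  Finset.prod_pos fun _ _ => P.weight_pos H _ ω

lemma density_self (H : (ι → ℝ) → ℝ) (a : ℕ) (ω : ι → ℝ) : P.density H a a ω = 1 := by
  simp [density]

lemma density_of_lt (H : (ι → ℝ) → ℝ) {a b : ℕ} (h : a < b) (ω : ι → ℝ) :
    P.density H a b ω = P.weight H a ω * P.density H (a + 1) b ω :=
  Finset.prod_eq_prod_Ico_succ_bot h _

lemma density_mul_density (H : (ι → ℝ) → ℝ) {a b d : ℕ} (hab : a ≤ b) (hbd : b ≤ d) (ω : ι → ℝ) :
    P.density H a b ω * P.density H b d ω = P.density H a d ω :=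
  Finset.prod_Ico_consecutive _ hab hbd

/-- Each log-average removes the dependence on its own block, starting from the last level. -/
lemma dependsOn_energy (H : (ι → ℝ) → ℝ) {a : ℕ} (ha : a ≤ P.depth) :
    DependsOn (P.energy H a) (P.above a)ᶜ := by
  induction ha using Nat.decreasingInduction with
  | self => simpa [P.above_depth] using dependsOn_univ (P.energy H P.depth)
  | of_succ a ha ih =>
    rw [P.energy_of_lt H ha]
    refine (dependsOn_logAvg (S := P.block (a + 1)) ih).mono ?_
    rw [P.above_eq_union a]
    intro i hi h3
    rcases (mem_union _ _ _).1 h3 with h3 | h3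
    · exact hi.2 h3
    · exact hi.1 h3

lemma dependsOn_weight (H : (ι → ℝ) → ℝ) {b : ℕ} (hb : b < P.depth) :
    DependsOn (P.weight H b) (P.above (b + 1))ᶜ := by
  intro x y h
  rw [weight, weight, P.dependsOn_energy H hb h,
    P.dependsOn_energy H hb.le fun i hi => h i
      (compl_subset_compl.2 (P.above_anti (Nat.le_succ b)) hi)]

lemma dependsOn_density (H : (ι → ℝ) → ℝ) (a : ℕ) {b : ℕ} (hb : b ≤ P.depth) :
    DependsOn (P.density H a b) (P.above b)ᶜ := by
  intro x y h
  refine Finset.prod_congr rfl fun j hj => ?_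
  have hj' := (Finset.mem_Ico.1 hj).2
  exact (P.dependsOn_weight H (hj'.trans_le hb)).mono
    (compl_subset_compl.2 (P.above_anti hj')) h

lemma dependsOn_state (H : (ι → ℝ) → ℝ) (a : ℕ) (F : (ι → ℝ) → ℝ) :
    DependsOn (P.state H a F) (P.above a)ᶜ := dependsOn_avg_compl _ _

lemma state_depth (H F : (ι → ℝ) → ℝ) : P.state H P.depth F = F := by
  unfold state
  rw [P.above_depth, avg_of_dependsOn (by simpa using dependsOn_univ _)]
  simp [density_self]

variable {P} {I : Set ℝ} {H F G : ℝ → (ι → ℝ) → ℝ}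

lemma polyBdd_energy (hH : PolyBdd I H) (hQ : QuadBdd P.c I H) {a : ℕ} (ha : a ≤ P.depth) :
    (PolyBdd I fun θ => P.energy (H θ) a) ∧ QuadBdd P.c I fun θ => P.energy (H θ) a := by
  induction ha using Nat.decreasingInduction with
  | self => simpa only [P.energy_depth] using ⟨hH, hQ⟩
  | of_succ a ha ih =>
    simp only [P.energy_of_lt _ ha]
    exact ⟨PolyBdd.comp_logAvg P.c_nonneg (P.c_le_block a) (P.m_nonneg _) (P.m_le_one _) ih.1 ih.2,
      QuadBdd.comp_logAvg P.c_nonneg (P.c_le_block a) (P.m_nonneg _) (P.m_le_one _) ih.1 ih.2⟩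

lemma measurable_weight (hH : PolyBdd I H) (hQ : QuadBdd P.c I H) {θ : ℝ} (hθ : θ ∈ I) {b : ℕ}
    (hb : b < P.depth) : Measurable (P.weight (H θ) b) := by
  have h1 := (polyBdd_energy hH hQ hb.le).1.1 θ hθ
  have h2 := (polyBdd_energy hH hQ (a := b + 1) hb).1.1 θ hθ
  unfold weight
  fun_prop

lemma measurable_density (hH : PolyBdd I H) (hQ : QuadBdd P.c I H) {θ : ℝ} (hθ : θ ∈ I) (a : ℕ)
    {b : ℕ} (hb : b ≤ P.depth) : Measurable (P.density (H θ) a b) :=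
  Finset.measurable_fun_prod _ fun _ hj =>
    measurable_weight hH hQ hθ ((Finset.mem_Ico.1 hj).2.trans_le hb)

lemma weight_mul_eq {H : (ι → ℝ) → ℝ} {a : ℕ} (ha : a < P.depth) (F : (ι → ℝ) → ℝ) :
    avg (P.block (a + 1)) (fun η => P.weight H a η * F η) =
      tilt (P.block (a + 1)) (P.m (a + 1)) (P.energy H (a + 1)) F := by
  funext ω
  simp only [tilt, weight, P.energy_of_lt H ha]

lemma avgIntegrable_weight_mul (hH : PolyBdd I H) (hQ : QuadBdd P.c I H) (hF : PolyBdd I F)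
    {a : ℕ} (ha : a < P.depth) {θ : ℝ} (hθ : θ ∈ I) :
    AvgIntegrable (P.block (a + 1)) fun η => P.weight (H θ) a η * F θ η := by
  intro ω
  obtain ⟨h1, h2⟩ := polyBdd_energy hH hQ (a := a + 1) ha
  have := (avgIntegrable_exp_mul_mul P.c_nonneg (P.c_le_block a) (P.m_nonneg (a + 1))
    (P.m_le_one _) h1 h2 hF hθ ω).const_mul (Real.exp (-(P.m (a + 1) * P.energy (H θ) a ω)))
  refine this.congr (Eventually.of_forall fun η => ?_)
  have hd : P.energy (H θ) a (mix (P.block (a + 1)) η ω) = P.energy (H θ) a ω := by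
    rw [P.energy_of_lt _ ha]
    exact dependsOn_mix (dependsOn_logAvg_compl _ _ _) η ω
  simp only [weight]
  rw [← mul_assoc, ← Real.exp_add, hd]
  ring_nf

/-- The three facts feed each other in a downward induction. Polynomial growth of the state of |F|
at level a + 1 gives integrability at level a by Tonelli; this allows Fubini and the recursion by a
tilted average; and `PolyBdd.comp_tilt` returns polynomial growth. The statement is for all `F`
because |F| is needed too. -/
lemma state_aux (hH : PolyBdd I H) (hQ : QuadBdd P.c I H) {a : ℕ} (ha : a ≤ P.depth) :
    ∀ F : ℝ → (ι → ℝ) → ℝ, PolyBdd I F →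
      (PolyBdd I fun θ => P.state (H θ) a (F θ)) ∧ ∀ θ ∈ I,
        AvgIntegrable (P.above a) (fun η => P.density (H θ) a P.depth η * F θ η) ∧
        (a < P.depth → P.state (H θ) a (F θ) = tilt (P.block (a + 1)) (P.m (a + 1))
          (P.energy (H θ) (a + 1)) (P.state (H θ) (a + 1) (F θ))) := by
  induction ha using Nat.decreasingInduction with
  | self =>
    intro F hF
    simp only [state_depth, lt_irrefl, false_implies, and_true, density_self, one_mul]
    exact ⟨hF, fun θ hθ => hF.avgIntegrable _ hθ⟩
  | of_succ a ha ih =>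
    intro F hF
    have hint : ∀ θ ∈ I,
        AvgIntegrable (P.above a) (fun η => P.density (H θ) a P.depth η * F θ η) := by
      intro θ hθ
      rw [P.above_eq_union]
      have hm := measurable_density hH hQ hθ a le_rfl
      have hm' := hF.1 θ hθ
      refine avgIntegrable_union ((P.disjoint_block_above _)) (by fun_prop) ?_ ?_
      · intro ω
        refine (((ih F hF).2 θ hθ).1 ω |>.const_mul (P.weight (H θ) a ω)).congr
          (Eventually.of_forall fun η => ?_)
        simp only [P.density_of_lt _ ha, dependsOn_mix (P.dependsOn_weight (H θ) ha), mul_assoc]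
      · have : (avg (P.above (a + 1)) fun η => |P.density (H θ) a P.depth η * F θ η|) =
            fun ω => P.weight (H θ) a ω * P.state (H θ) (a + 1) (fun η => |F θ η|) ω := by
          funext ω
          rw [state, ← avg_mul_of_dependsOn (P.dependsOn_weight (H θ) ha)]
          congr 1
          funext η
          rw [abs_mul, abs_of_pos (P.density_pos _ _ _ _), P.density_of_lt _ ha, mul_assoc]
        rw [this]
        exact avgIntegrable_weight_mul hH hQ (ih _ hF.abs).1 ha hθ
    have heq : ∀ θ ∈ I, P.state (H θ) a (F θ) = tilt (P.block (a + 1)) (P.m (a + 1))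
          (P.energy (H θ) (a + 1)) (P.state (H θ) (a + 1) (F θ)) := by
      intro θ hθ
      have hm := measurable_density hH hQ hθ a le_rfl
      have hm' := hF.1 θ hθ
      have hi := hint θ hθ
      unfold state
      rw [P.above_eq_union] at hi ⊢
      have := avg_union (P.disjoint_block_above _) (by fun_prop) hi
      rw [← weight_mul_eq ha]
      refine (funext fun ω => rfl : _ = _).trans (this.trans ?_)
      congr 1
      funext ω
      rw [← avg_mul_of_dependsOn (P.dependsOn_weight (H θ) ha)]
      congr 1
      funext η
      rw [P.density_of_lt _ ha, mul_assoc]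
    obtain ⟨h1, h2⟩ := polyBdd_energy hH hQ (a := a + 1) ha
    refine ⟨?_, fun θ hθ => ⟨hint θ hθ, fun _ => heq θ hθ⟩⟩
    have ht := PolyBdd.comp_tilt P.c_nonneg (P.c_le_block a) (P.m_nonneg (a + 1))
      (P.m_le_one _) h1 h2 (ih F hF).1
    refine ⟨fun θ hθ => ?_, ?_⟩
    · simpa only [heq θ hθ] using ht.1 θ hθ
    · obtain ⟨C, k, hC, hb⟩ := ht.2
      refine ⟨C, k, hC, fun θ hθ ω => ?_⟩
      simpa only [heq θ hθ] using hb θ hθ ω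

lemma polyBdd_state (hH : PolyBdd I H) (hQ : QuadBdd P.c I H) (hF : PolyBdd I F) {a : ℕ}
    (ha : a ≤ P.depth) : PolyBdd I fun θ => P.state (H θ) a (F θ) := (state_aux hH hQ ha F hF).1

lemma avgIntegrable_density_mul (hH : PolyBdd I H) (hQ : QuadBdd P.c I H) (hF : PolyBdd I F)
    {a : ℕ} (ha : a ≤ P.depth) {θ : ℝ} (hθ : θ ∈ I) :
    AvgIntegrable (P.above a) (fun η => P.density (H θ) a P.depth η * F θ η) :=
  ((state_aux hH hQ ha F hF).2 θ hθ).1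

lemma state_of_lt (hH : PolyBdd I H) (hQ : QuadBdd P.c I H) (hF : PolyBdd I F) {a : ℕ}
    (ha : a < P.depth) {θ : ℝ} (hθ : θ ∈ I) :
    P.state (H θ) a (F θ) = tilt (P.block (a + 1)) (P.m (a + 1))
      (P.energy (H θ) (a + 1)) (P.state (H θ) (a + 1) (F θ)) :=
  ((state_aux hH hQ ha.le F hF).2 θ hθ).2 ha

lemma state_const (hH : PolyBdd I H) (hQ : QuadBdd P.c I H) (r : ℝ) {a : ℕ}
    (ha : a ≤ P.depth) {θ : ℝ} (hθ : θ ∈ I) : P.state (H θ) a (fun _ => r) = fun _ => r := by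
  induction ha using Nat.decreasingInduction with
  | self => exact P.state_depth _ _
  | of_succ a ha ih =>
    rw [state_of_lt hH hQ (F := fun _ _ => r) (polyBdd_const r) ha hθ, ih]
    obtain ⟨h1, h2⟩ := polyBdd_energy hH hQ (a := a + 1) ha
    funext ω
    have := exp_mul_logAvg P.c_nonneg (P.c_le_block a) (P.m_nonneg (a + 1))
      (P.m_le_one _) h1 h2 hθ ω
    have h3 := avg_exp_pos P.c_nonneg (P.c_le_block a) (P.m_nonneg (a + 1))
      (P.m_le_one _) h1 h2 hθ ω
    rw [tilt_eq, Real.exp_neg, this]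
    have h4 : avg (P.block (a + 1)) (fun η => Real.exp (P.m (a + 1) * P.energy (H θ) (a + 1) η) * r)
        ω = avg (P.block (a + 1)) (fun η => Real.exp (P.m (a + 1) * P.energy (H θ) (a + 1) η)) ω
          * r := integral_mul_const _ _
    rw [h4]
    field_simp

lemma state_add (hH : PolyBdd I H) (hQ : QuadBdd P.c I H) (hF : PolyBdd I F) (hG : PolyBdd I G)
    {a : ℕ} (ha : a ≤ P.depth) {θ : ℝ} (hθ : θ ∈ I) (ω : ι → ℝ) :
    P.state (H θ) a (fun η => F θ η + G θ η) ω =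
      P.state (H θ) a (F θ) ω + P.state (H θ) a (G θ) ω := by
  simp only [state, mul_add]
  exact integral_add (avgIntegrable_density_mul hH hQ hF ha hθ ω)
    (avgIntegrable_density_mul hH hQ hG ha hθ ω)

lemma state_const_mul (H F : (ι → ℝ) → ℝ) (a : ℕ) (r : ℝ) (ω : ι → ℝ) :
    P.state H a (fun η => r * F η) ω = r * P.state H a F ω := by
  simp only [state, mul_left_comm _ r]
  exact integral_const_mul _ _

lemma state_sum {κ : Type*} (s : Finset κ) {F : κ → ℝ → (ι → ℝ) → ℝ} (hH : PolyBdd I H)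
    (hQ : QuadBdd P.c I H) (hF : ∀ j ∈ s, PolyBdd I (F j))
    {a : ℕ} (ha : a ≤ P.depth) {θ : ℝ} (hθ : θ ∈ I) (ω : ι → ℝ) :
    P.state (H θ) a (fun η => ∑ j ∈ s, F j θ η) ω = ∑ j ∈ s, P.state (H θ) a (F j θ) ω := by
  simp only [state, Finset.mul_sum]
  exact integral_finsetSum _ fun j hj => avgIntegrable_density_mul hH hQ (hF j hj) ha hθ ω

/-- The levels greater than `a` may be averaged over in two steps. -/
lemma state_eq_avg_state (hH : PolyBdd I H) (hQ : QuadBdd P.c I H) (hF : PolyBdd I F) {a b : ℕ}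
    (hab : a ≤ b) (hb : b ≤ P.depth) {θ : ℝ} (hθ : θ ∈ I) :
    P.state (H θ) a (F θ) = avg (P.above a \ P.above b)
      (fun η => P.density (H θ) a b η * P.state (H θ) b (F θ) η) := by
  have hm := measurable_density hH hQ hθ a le_rfl
  have hm' := hF.1 θ hθ
  have hi := avgIntegrable_density_mul hH hQ hF (hab.trans hb) hθ
  have hu : P.above a = (P.above a \ P.above b) ∪ P.above b :=
    (sdiff_union_of_subset (P.above_anti hab)).symm
  have h := avg_union (S := P.above a \ P.above b) (T := P.above b) disjoint_sdiff_left
    (g := fun η => P.density (H θ) a P.depth η * F θ η) (by fun_prop) (hu ▸ hi)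
  rw [← hu] at h
  refine Eq.trans h ?_
  congr 1
  funext ω
  rw [state, ← avg_mul_of_dependsOn (P.dependsOn_density (H θ) a hb)]
  congr 1
  funext η
  rw [← P.density_mul_density _ hab hb, mul_assoc]

lemma integrable_density_mul (hH : PolyBdd I H) (hQ : QuadBdd P.c I H) (hF : PolyBdd I F)
    {θ : ℝ} (hθ : θ ∈ I) :
    Integrable (fun ω => P.density (H θ) 0 P.depth ω * F θ ω) (stdGauss ι) := by
  have hm := measurable_density hH hQ hθ 0 le_rfl
  have hm' := hF.1 θ hθ
  apply AvgIntegrable.integrable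
  rw [P.univ_eq_union]
  refine avgIntegrable_union (P.disjoint_block_above 0) (by fun_prop)
    (avgIntegrable_density_mul hH hQ hF (Nat.zero_le _) hθ) ?_
  simp only [abs_mul, abs_of_pos (P.density_pos _ _ _ _)]
  exact (polyBdd_state hH hQ hF.abs (Nat.zero_le _)).avgIntegrable _ hθ

/-- The density contains no factor for level 0, whose coordinates are integrated with their original
Gaussian law. -/
lemma integral_density_mul (hH : PolyBdd I H) (hQ : QuadBdd P.c I H) (hF : PolyBdd I F)
    {θ : ℝ} (hθ : θ ∈ I) :
    ∫ ω, P.density (H θ) 0 P.depth ω * F θ ω ∂(stdGauss ι) =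
      ∫ ω, P.state (H θ) 0 (F θ) ω ∂(stdGauss ι) := by
  have hm := measurable_density hH hQ hθ 0 le_rfl
  have hm' := hF.1 θ hθ
  exact (integral_avg (P.above 0) (by fun_prop) (integrable_density_mul hH hQ hF hθ)).symm

/-- This is conditioning on the levels up to a: the first a factors of the density and `X` are
fixed, and the remaining factors form the state. -/
lemma avg_density_mul_mul (H F X : (ι → ℝ) → ℝ) {a : ℕ} (ha : a ≤ P.depth)
    (hX : DependsOn X (P.above a)ᶜ) :
    avg (P.above a) (fun ω => P.density H 0 P.depth ω * (F ω * X ω)) =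
      fun ω => P.density H 0 a ω * (P.state H a F ω * X ω) := by
  funext ω
  have hd : DependsOn (fun ω => P.density H 0 a ω * X ω) (P.above a)ᶜ := fun x y h => by
    simp only [P.dependsOn_density H 0 ha h, hX h]
  rw [mul_comm (P.state H a F ω), ← mul_assoc, state, ← avg_mul_of_dependsOn hd]
  congr 1
  funext η
  rw [← P.density_mul_density H (Nat.zero_le a) ha]
  ring

/-- The factors of the density beyond a average to one, so the function is a marginal of the full
integrand and inherits its integrability. -/
lemma integrable_density_mul_of_dependsOn (hH : PolyBdd I H) (hQ : QuadBdd P.c I H)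
    (hF : PolyBdd I F) {a : ℕ} (ha : a ≤ P.depth) {θ : ℝ} (hθ : θ ∈ I)
    (hX : DependsOn (F θ) (P.above a)ᶜ) :
    Integrable (fun ω => P.density (H θ) 0 a ω * F θ ω) (stdGauss ι) := by
  have h := avg_density_mul_mul (P := P) (H θ) (fun _ => 1) (F θ) ha hX
  rw [state_const hH hQ 1 ha hθ] at h
  simp only [one_mul] at h
  rw [← h]
  have hi := integrable_density_mul hH hQ hF hθ
  have hm := measurable_density hH hQ hθ 0 le_rfl
  have hm' := hF.1 θ hθ
  have hp : Integrable (fun p : (ι → ℝ) × (ι → ℝ) =>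
      P.density (H θ) 0 P.depth (mix (P.above a) p.2 p.1) * F θ (mix (P.above a) p.2 p.1))
      ((stdGauss ι).prod (stdGauss ι)) :=
    ((measurePreserving_mix (P.above a)).integrable_comp_of_integrable hi).swap
  exact hp.integral_prod_left

/-- The state of `G` is constant on the levels above a, so conditioning replaces `F` by its own
state. This creates the product of two replicas with the same noise. -/
lemma integral_density_mul_state (hH : PolyBdd I H) (hQ : QuadBdd P.c I H) (hF : PolyBdd I F)
    (hG : PolyBdd I G) {a : ℕ} (ha : a ≤ P.depth) {θ : ℝ} (hθ : θ ∈ I) :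
    ∫ ω, P.density (H θ) 0 P.depth ω * (F θ ω * P.state (H θ) a (G θ) ω) ∂(stdGauss ι) =
      ∫ ω, P.density (H θ) 0 a ω * (P.state (H θ) a (F θ) ω * P.state (H θ) a (G θ) ω)
        ∂(stdGauss ι) := by
  have hX := hF.mul (polyBdd_state hH hQ hG ha)
  have hm := measurable_density hH hQ hθ 0 le_rfl
  have hm' := hX.1 θ hθ
  rw [← integral_avg (P.above a) (by fun_prop) (integrable_density_mul hH hQ hX hθ),
    avg_density_mul_mul _ _ _ ha (P.dependsOn_state _ _ _)]

/-- The derivative of the free energies with respect to a parameter. -/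
lemma hasDerivAt_energy {H' : ℝ → (ι → ℝ) → ℝ} (hI : IsOpen I) (hH : PolyBdd I H)
    (hQ : QuadBdd P.c I H) (hH' : PolyBdd I H')
    (hd : ∀ θ ∈ I, ∀ ω, HasDerivAt (fun θ => H θ ω) (H' θ ω) θ) {a : ℕ} (ha : a ≤ P.depth) :
    ∀ θ ∈ I, ∀ ω, HasDerivAt (fun θ => P.energy (H θ) a ω) (P.state (H θ) a (H' θ) ω) θ := by
  induction ha using Nat.decreasingInduction with
  | self => simpa only [energy_depth, state_depth] using hd
  | of_succ a ha ih =>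
    intro θ hθ ω
    obtain ⟨h1, h2⟩ := polyBdd_energy hH hQ (a := a + 1) ha
    simp only [P.energy_of_lt _ ha]
    rw [state_of_lt hH hQ hH' ha hθ]
    exact hasDerivAt_logAvg hI P.c_nonneg (P.c_le_block a) (P.m_nonneg _) (P.m_le_one _) h1 h2
      (polyBdd_state hH hQ hH' ha) ih hθ ω

lemma hasDerivAt_integral_energy {H' : ℝ → (ι → ℝ) → ℝ} (hI : IsOpen I) (hH : PolyBdd I H)
    (hQ : QuadBdd P.c I H) (hH' : PolyBdd I H')
    (hd : ∀ θ ∈ I, ∀ ω, HasDerivAt (fun θ => H θ ω) (H' θ ω) θ) {θ : ℝ} (hθ : θ ∈ I) :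
    HasDerivAt (fun θ => ∫ ω, P.energy (H θ) 0 ω ∂(stdGauss ι))
      (∫ ω, P.density (H θ) 0 P.depth ω * H' θ ω ∂(stdGauss ι)) θ := by
  rw [integral_density_mul hH hQ hH' hθ]
  have hE := (polyBdd_energy hH hQ (Nat.zero_le P.depth)).1
  have hS := polyBdd_state hH hQ hH' (Nat.zero_le P.depth)
  obtain ⟨-, C, k, hC, hb⟩ := id hS
  refine (hasDerivAt_integral_of_dominated_loc_of_deriv_le
    (F := fun θ ω => P.energy (H θ) 0 ω) (F' := fun θ ω => P.state (H θ) 0 (H' θ) ω)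
    (hI.mem_nhds hθ) ?_ (hE.integrable hθ) (hS.1 θ hθ).aestronglyMeasurable
    (Eventually.of_forall fun ω θ' hθ' => hb θ' hθ' ω)
    ((integrable_one_add_norm_pow k).const_mul C)
    (Eventually.of_forall fun ω θ' hθ' =>
      hasDerivAt_energy hI hH hQ hH' hd (Nat.zero_le _) θ' hθ' ω)).2
  filter_upwards [hI.mem_nhds hθ] with θ' hθ'
  exact (hE.1 θ' hθ').aestronglyMeasurable

end Cascade

/-! ### Gaussian integration by parts, and coordinates as parameters -/

section IntegrationByParts

lemma hasDerivAt_gaussianPDFReal (x : ℝ) :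
    HasDerivAt (gaussianPDFReal 0 1) (-(x * gaussianPDFReal 0 1 x)) x := by
  have h1 : HasDerivAt (fun x : ℝ => -(x - 0) ^ 2 / (2 * ((1 : NNReal) : ℝ))) (-x) x := by
    have := (((hasDerivAt_id x).sub_const 0).pow 2).neg.div_const (2 * ((1 : NNReal) : ℝ))
    refine this.congr_deriv ?_
    simp
    ring
  have h2 := h1.exp.const_mul ((√(2 * Real.pi * ((1 : NNReal) : ℝ)))⁻¹)
  refine (h2.congr_deriv ?_)
  simp only [gaussianPDFReal]
  ring

lemma integrable_gaussianReal_iff {g : ℝ → ℝ} :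
    Integrable g (gaussianReal 0 1) ↔ Integrable fun x => g x * gaussianPDFReal 0 1 x := by
  rw [gaussianReal_of_var_ne_zero _ one_ne_zero,
    integrable_withDensity_iff (measurable_gaussianPDF 0 1)
      (Eventually.of_forall fun _ => gaussianPDF_lt_top)]
  simp only [toReal_gaussianPDF]

/-- Gaussian integration by parts in one variable. -/
lemma integral_id_mul_gaussianReal {g g' : ℝ → ℝ} (hd : ∀ x, HasDerivAt g (g' x) x)
    (hg : Integrable g (gaussianReal 0 1)) (hxg : Integrable (fun x => x * g x) (gaussianReal 0 1))
    (hg' : Integrable g' (gaussianReal 0 1)) :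
    ∫ x, x * g x ∂(gaussianReal 0 1) = ∫ x, g' x ∂(gaussianReal 0 1) := by
  rw [integrable_gaussianReal_iff] at hg hxg hg'
  have h := integral_mul_deriv_eq_deriv_mul_of_integrable (u := g) (u' := g')
    (v := gaussianPDFReal 0 1) (v' := fun x => -(x * gaussianPDFReal 0 1 x))
    (fun x _ => hd x) (fun x _ => hasDerivAt_gaussianPDFReal x)
    (hxg.neg.congr (Eventually.of_forall fun x => by simp; ring)) hg' hg
  rw [integral_gaussianReal_eq_integral_smul one_ne_zero,
    integral_gaussianReal_eq_integral_smul one_ne_zero]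
  simp only [mul_neg, integral_neg, neg_inj, smul_eq_mul] at h ⊢
  calc _ = ∫ x, g x * (x * gaussianPDFReal 0 1 x) := by congr 1; funext x; ring
    _ = _ := h
    _ = _ := by congr 1; funext x; ring

variable {ι : Type*} [DecidableEq ι]

lemma mix_singleton (i : ι) (η ω : ι → ℝ) : mix {i} η ω = Function.update ω i (η i) := by
  ext j
  by_cases h : j = i
  · subst h; simp [mix]
  · simp [mix, h]

lemma mix_update {S : Set ι} {i : ι} (hi : i ∉ S) (η ω : ι → ℝ) (s : ℝ) :
    mix S η (Function.update ω i s) = Function.update (mix S η ω) i s := by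
  ext j
  by_cases h : j = i
  · subst h; simp [mix, hi]
  · simp [mix, h]

lemma measurable_update_coord (i : ι) (s : ℝ) :
    Measurable fun ω : ι → ℝ => Function.update ω i s := by
  refine measurable_pi_lambda _ fun j => ?_
  by_cases h : j = i
  · subst h; simp
  · simp only [Function.update_of_ne h]; fun_prop

variable [Fintype ι]

/-- Resampling the single coordinate `i` and applying Fubini gives integrable slices almost
everywhere, which is all that integration by parts under the outer integral needs. -/
lemma ae_integrable_update {g : (ι → ℝ) → ℝ} (hm : Measurable g) (hg : Integrable g (stdGauss ι))
    (i : ι) : ∀ᵐ ω ∂(stdGauss ι),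
      Integrable (fun s => g (Function.update ω i s)) (gaussianReal 0 1) := by
  have h := ((measurePreserving_mix {i}).integrable_comp_of_integrable hg).prod_left_ae
  filter_upwards [h] with ω hω
  simp only [Function.comp_def, mix_singleton] at hω
  have hmp : MeasurePreserving (Function.eval i) (stdGauss ι) (gaussianReal 0 1) :=
    measurePreserving_eval (fun _ : ι => gaussianReal 0 1) i
  refine (hmp.integrable_comp ?_).1 hω
  exact (hm.comp (measurable_update ω)).aestronglyMeasurable

lemma avg_singleton {g : (ι → ℝ) → ℝ} (hm : Measurable g) (i : ι) (ω : ι → ℝ) :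
    avg {i} g ω = ∫ s, g (Function.update ω i s) ∂(gaussianReal 0 1) := by
  have hmp : MeasurePreserving (Function.eval i) (stdGauss ι) (gaussianReal 0 1) :=
    measurePreserving_eval (fun _ : ι => gaussianReal 0 1) i
  have hu : Measurable fun s => g (Function.update ω i s) := hm.comp (measurable_update ω)
  rw [← hmp.map_eq, integral_map hmp.measurable.aemeasurable hu.aestronglyMeasurable]
  simp only [avg, mix_singleton, Function.eval]

/-- Gaussian integration by parts in the coordinate `i`. -/
lemma integral_coord_mul {g g' : (ι → ℝ) → ℝ} (i : ι)
    (hd : ∀ ω s, HasDerivAt (fun s => g (Function.update ω i s)) (g' (Function.update ω i s)) s)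
    (hm : Measurable g) (hm' : Measurable g') (hg : Integrable g (stdGauss ι))
    (hxg : Integrable (fun ω => ω i * g ω) (stdGauss ι)) (hg' : Integrable g' (stdGauss ι)) :
    ∫ ω, ω i * g ω ∂(stdGauss ι) = ∫ ω, g' ω ∂(stdGauss ι) := by
  have hxm : Measurable fun ω : ι → ℝ => ω i * g ω := (measurable_pi_apply i).mul hm
  rw [← integral_avg {i} hxm hxg, ← integral_avg {i} hm' hg']
  refine integral_congr_ae ?_
  filter_upwards [ae_integrable_update hm hg i, ae_integrable_update hxm hxg i,
    ae_integrable_update hm' hg' i] with ω h1 h2 h3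
  rw [avg_singleton hxm, avg_singleton hm']
  simp only [Function.update_self] at h2 ⊢
  exact integral_id_mul_gaussianReal (hd ω) h1 h2 h3

lemma avg_update {S : Set ι} {i : ι} (hi : i ∉ S) (g : (ι → ℝ) → ℝ) (ω : ι → ℝ) (s : ℝ) :
    avg S g (Function.update ω i s) = avg S (fun η => g (Function.update η i s)) ω := by
  simp only [avg, mix_update hi]

lemma logAvg_update {S : Set ι} {i : ι} (hi : i ∉ S) (m : ℝ) (W : (ι → ℝ) → ℝ) (ω : ι → ℝ)
    (s : ℝ) : logAvg S m W (Function.update ω i s) =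
      logAvg S m (fun η => W (Function.update η i s)) ω := by
  simp only [logAvg, avg_update hi]

lemma tilt_update {S : Set ι} {i : ι} (hi : i ∉ S) (m : ℝ) (W F : (ι → ℝ) → ℝ) (ω : ι → ℝ)
    (s : ℝ) : tilt S m W F (Function.update ω i s) =
      tilt S m (fun η => W (Function.update η i s)) (fun η => F (Function.update η i s)) ω := by
  simp only [tilt, avg_update hi, logAvg_update hi]

lemma norm_update_le (ω : ι → ℝ) (i : ι) (s : ℝ) : ‖Function.update ω i s‖ ≤ ‖ω‖ + |s| := by
  refine (pi_norm_le_iff_of_nonneg (by positivity)).2 fun j => ?_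
  by_cases h : j = i
  · subst h; simp
  · rw [Function.update_of_ne h]; linarith [norm_le_pi_norm ω j, abs_nonneg s]

variable {I J : Set ℝ} {F W : ℝ → (ι → ℝ) → ℝ} {R : ℝ}

/-- The value of one coordinate, kept in a bounded window, takes the role of the parameter.
`hasDerivAt_logAvg` then differentiates in a coordinate as it does in t. -/
lemma PolyBdd.update (hF : PolyBdd I F) {θ : ℝ} (hθ : θ ∈ I) (hJ : ∀ s ∈ J, |s| ≤ R)
    (i : ι) : PolyBdd J fun s ω => F θ (Function.update ω i s) := by
  obtain ⟨hm, C, k, hC, hb⟩ := hF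
  refine PolyBdd.mono (fun s _ => (hm θ hθ).comp (measurable_update_coord i s))
    (((polyBdd_norm.pow k).const_mul (C * (1 + |R|) ^ k))) fun s hs ω => ?_
  refine (hb θ hθ _).trans ?_
  rw [mul_assoc, ← mul_pow]
  gcongr
  have h1 := norm_update_le ω i s
  have h2 := (hJ s hs).trans (le_abs_self R)
  nlinarith [mul_nonneg (abs_nonneg R) (norm_nonneg ω)]

lemma QuadBdd.update {c : ι → ℝ} (hc : ∀ i, 0 ≤ c i) (hW : QuadBdd c I W) {θ : ℝ} (hθ : θ ∈ I)
    (hJ : ∀ s ∈ J, |s| ≤ R) (i : ι) : QuadBdd c J fun s ω => W θ (Function.update ω i s) := by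
  obtain ⟨C, hC, hb⟩ := hW
  refine ⟨C + c i * R ^ 2, by have := hc i; positivity, fun s hs ω => (hb θ hθ _).trans ?_⟩
  have hle : ∑ j, c j * Function.update ω i s j ^ 2 ≤
      ∑ j, (c j * ω j ^ 2 + if j = i then c i * R ^ 2 else 0) := by
    refine Finset.sum_le_sum fun j _ => ?_
    by_cases h : j = i
    · subst h
      simp only [Function.update_self, if_true]
      have h1 : s ^ 2 ≤ R ^ 2 := by
        rw [← sq_abs s]; have := hJ s hs; gcongr
      have h2 := mul_nonneg (hc j) (sq_nonneg (ω j))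
      have h3 := mul_le_mul_of_nonneg_left h1 (hc j)
      linarith
    · simp [h]
  rw [Finset.sum_add_distrib] at hle
  simp only [Finset.sum_ite_eq', Finset.mem_univ, if_true] at hle
  linarith

end IntegrationByParts

/-! ### Integration by parts against the cascade density -/

namespace Cascade

/-- Abel summation, which converts the exponents of the weights into the increments of m. -/
lemma sum_mul_sub_eq (m D : ℕ → ℝ) (n : ℕ) :
    ∑ b ∈ Finset.range n, m (b + 1) * (D (b + 1) - D b) =
      m n * D n - m 0 * D 0 - ∑ b ∈ Finset.range n, (m (b + 1) - m b) * D b := by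
  induction n with
  | zero => simp
  | succ n ih => rw [Finset.sum_range_succ, Finset.sum_range_succ, ih]; ring

variable {ι : Type*} [Fintype ι] {P : Cascade ι} {I : Set ℝ} {H F H' : ℝ → (ι → ℝ) → ℝ}

/-- The derivative of the free energies with respect to the coordinate `i`. -/
def coordDeriv (P : Cascade ι) (H H' : (ι → ℝ) → ℝ) (i : ι) (a : ℕ) (ω : ι → ℝ) : ℝ :=
  if P.level i ≤ a then P.state H a H' ω else 0

lemma polyBdd_coordDeriv (hH : PolyBdd I H) (hQ : QuadBdd P.c I H) (hH' : PolyBdd I H') (i : ι)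
    {a : ℕ} (ha : a ≤ P.depth) : PolyBdd I fun θ => P.coordDeriv (H θ) (H' θ) i a := by
  unfold coordDeriv
  by_cases hi : P.level i ≤ a
  · simpa only [if_pos hi] using polyBdd_state hH hQ hH' ha
  · simpa only [if_neg hi] using polyBdd_const 0

lemma density_eq_exp (P : Cascade ι) (H : (ι → ℝ) → ℝ) (n : ℕ) (ω : ι → ℝ) : P.density H 0 n ω =
    Real.exp (∑ b ∈ Finset.range n, P.m (b + 1) * (P.energy H (b + 1) ω - P.energy H b ω)) := by
  rw [Real.exp_sum, Finset.range_eq_Ico]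
  rfl

variable [DecidableEq ι]

/-- A coordinate of level at most a is held fixed in every average above a, so it behaves like an
external parameter in the downward induction. -/
lemma hasDerivAt_energy_update (hH : PolyBdd I H) (hQ : QuadBdd P.c I H) (hH' : PolyBdd I H')
    {θ : ℝ} (hθ : θ ∈ I) {i : ι} (hd : ∀ ω s, HasDerivAt (fun s => H θ (Function.update ω i s))
      (H' θ (Function.update ω i s)) s) {a : ℕ} (ha : a ≤ P.depth) :
    P.level i ≤ a → ∀ ω s, HasDerivAt (fun s => P.energy (H θ) a (Function.update ω i s))
      (P.state (H θ) a (H' θ) (Function.update ω i s)) s := by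
  induction ha using Nat.decreasingInduction with
  | self => simpa only [energy_depth, state_depth] using fun _ => hd
  | of_succ a ha ih =>
    intro hi ω s
    obtain ⟨h1, h2⟩ := polyBdd_energy hH hQ (a := a + 1) ha
    have hiS : i ∉ P.block (a + 1) := fun h => by
      have : P.level i = a + 1 := h
      omega
    simp only [P.energy_of_lt _ ha, logAvg_update hiS]
    rw [state_of_lt hH hQ hH' ha hθ, tilt_update hiS]
    have hJ : ∀ r ∈ Ioo (s - 1) (s + 1), |r| ≤ |s| + 1 := fun r hr => by
      have h3 : |r - s| ≤ 1 := abs_le.2 ⟨by linarith [hr.1], by linarith [hr.2]⟩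
      have h4 := abs_add_le (r - s) s
      rw [sub_add_cancel] at h4
      linarith
    exact hasDerivAt_logAvg isOpen_Ioo P.c_nonneg (P.c_le_block a) (P.m_nonneg _) (P.m_le_one _)
      (h1.update hθ hJ i) (h2.update P.c_nonneg hθ hJ i)
      ((polyBdd_state hH hQ hH' (a := a + 1) ha).update hθ hJ i)
      (fun r _ ω' => ih (by omega) ω' r) (by constructor <;> linarith) ω

lemma hasDerivAt_energy_coord (hH : PolyBdd I H) (hQ : QuadBdd P.c I H) (hH' : PolyBdd I H')
    {θ : ℝ} (hθ : θ ∈ I) {i : ι} (hd : ∀ ω s, HasDerivAt (fun s => H θ (Function.update ω i s))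
      (H' θ (Function.update ω i s)) s) {a : ℕ} (ha : a ≤ P.depth) (ω : ι → ℝ) (s : ℝ) :
    HasDerivAt (fun s => P.energy (H θ) a (Function.update ω i s))
      (P.coordDeriv (H θ) (H' θ) i a (Function.update ω i s)) s := by
  by_cases hi : P.level i ≤ a
  · simpa only [coordDeriv, if_pos hi] using hasDerivAt_energy_update hH hQ hH' hθ hd ha hi ω s
  · simp only [coordDeriv, if_neg hi]
    have : (fun s => P.energy (H θ) a (Function.update ω i s)) = fun _ => P.energy (H θ) a ω := by
      funext s
      refine P.dependsOn_energy (H θ) ha fun j hj => ?_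
      rw [Function.update_of_ne]
      rintro rfl
      exact hj (not_le.1 hi)
    rw [this]
    exact hasDerivAt_const _ _

lemma hasDerivAt_density_update (hH : PolyBdd I H) (hQ : QuadBdd P.c I H) (hH' : PolyBdd I H')
    {θ : ℝ} (hθ : θ ∈ I) {i : ι} (hd : ∀ ω s, HasDerivAt (fun s => H θ (Function.update ω i s))
      (H' θ (Function.update ω i s)) s) (ω : ι → ℝ) (s : ℝ) :
    HasDerivAt (fun s => P.density (H θ) 0 P.depth (Function.update ω i s))
      (P.density (H θ) 0 P.depth (Function.update ω i s) * ∑ b ∈ Finset.range P.depth,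
        P.m (b + 1) * (P.coordDeriv (H θ) (H' θ) i (b + 1) (Function.update ω i s) -
          P.coordDeriv (H θ) (H' θ) i b (Function.update ω i s))) s := by
  simp only [density_eq_exp]
  refine HasDerivAt.exp (HasDerivAt.fun_sum fun b hb => ?_)
  have hb' : b < P.depth := Finset.mem_range.1 hb
  exact ((hasDerivAt_energy_coord hH hQ hH' hθ hd hb' ω s).sub
    (hasDerivAt_energy_coord hH hQ hH' hθ hd hb'.le ω s)).const_mul _

/-- Integration by parts in the coordinate `i`, for an energy whose derivative in this coordinate
is `κ F`. -/
theorem integral_density_mul_coord_mul (hm0 : P.m 0 = 0) (hm1 : P.m P.depth = 1)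
    (hH : PolyBdd I H) (hQ : QuadBdd P.c I H) (hF : PolyBdd I F) {θ : ℝ} (hθ : θ ∈ I) {i : ι}
    (hFi : ∀ ω s, F θ (Function.update ω i s) = F θ ω) (κ : ℝ)
    (hd : ∀ ω s, HasDerivAt (fun s => H θ (Function.update ω i s)) (κ * F θ ω) s) :
    ∫ ω, P.density (H θ) 0 P.depth ω * (ω i * F θ ω) ∂(stdGauss ι) =
      κ * (∫ ω, P.density (H θ) 0 P.depth ω * F θ ω ^ 2 ∂(stdGauss ι) -
        ∑ b ∈ Finset.range P.depth, (P.m (b + 1) - P.m b) * if P.level i ≤ b then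
          ∫ ω, P.density (H θ) 0 b ω * P.state (H θ) b (F θ) ω ^ 2 ∂(stdGauss ι) else 0) := by
  have hH' : PolyBdd I fun θ ω => κ * F θ ω := hF.const_mul κ
  have hd' : ∀ ω s, HasDerivAt (fun s => H θ (Function.update ω i s))
      (κ * F θ (Function.update ω i s)) s := fun ω s => by simpa only [hFi] using hd ω s
  set D : ℕ → (ι → ℝ) → ℝ := fun b => P.coordDeriv (H θ) (fun ω => κ * F θ ω) i b with hD
  have hDp : ∀ b, b ≤ P.depth → PolyBdd I fun θ => P.coordDeriv (H θ) (fun ω => κ * F θ ω) i b :=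
    fun b hb => polyBdd_coordDeriv hH hQ hH' i hb
  have hdm := measurable_density hH hQ hθ 0 le_rfl
  have hFm := hF.1 θ hθ
  have hS : PolyBdd I fun θ ω => F θ ω * ∑ b ∈ Finset.range P.depth, P.m (b + 1) *
      (P.coordDeriv (H θ) (fun ω => κ * F θ ω) i (b + 1) ω -
        P.coordDeriv (H θ) (fun ω => κ * F θ ω) i b ω) :=
    hF.mul (PolyBdd.sum _ fun b hb => ((hDp (b + 1) (Finset.mem_range.1 hb)).sub
      (hDp b (Finset.mem_range.1 hb).le)).const_mul _)
  have hSm := hS.1 θ hθ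
  have hibp := integral_coord_mul (g := fun ω => P.density (H θ) 0 P.depth ω * F θ ω)
    (g' := fun ω => P.density (H θ) 0 P.depth ω * (F θ ω * ∑ b ∈ Finset.range P.depth,
      P.m (b + 1) * (D (b + 1) ω - D b ω))) i
    (fun ω s => by
      have := (hasDerivAt_density_update hH hQ hH' hθ hd' ω s).mul_const (F θ ω)
      simp only [hFi]
      refine this.congr_deriv ?_
      simp only [hD]
      ring)
    (by fun_prop) (hdm.mul hSm) (integrable_density_mul hH hQ hF hθ)
    ((integrable_density_mul hH hQ ((polyBdd_coord i).mul hF) hθ).congr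
      (Eventually.of_forall fun ω => by ring))
    (integrable_density_mul hH hQ hS hθ)
  have hl : ∫ ω, P.density (H θ) 0 P.depth ω * (ω i * F θ ω) ∂(stdGauss ι) =
      ∫ ω, ω i * (P.density (H θ) 0 P.depth ω * F θ ω) ∂(stdGauss ι) := by
    congr 1; funext ω; ring
  rw [hl, hibp]
  have hpt : ∀ ω, P.density (H θ) 0 P.depth ω * (F θ ω * ∑ b ∈ Finset.range P.depth,
      P.m (b + 1) * (D (b + 1) ω - D b ω)) =
      κ * (P.density (H θ) 0 P.depth ω * F θ ω ^ 2) - ∑ b ∈ Finset.range P.depth,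
        (P.m (b + 1) - P.m b) * (P.density (H θ) 0 P.depth ω * (F θ ω * D b ω)) := by
    intro ω
    -- The boundary terms of the Abel summation: m = 0 at level 0 removes the lower one, and m = 1
    -- at the last level, where no average is left, produces κF.
    rw [sum_mul_sub_eq P.m (fun b => D b ω), hm0, hm1]
    have : D P.depth ω = κ * F θ ω := by
      simp [hD, coordDeriv, P.level_le i, state_depth]
    rw [this, mul_sub, mul_sub, Finset.mul_sum, Finset.mul_sum]
    congr 1
    · ring
    · refine Finset.sum_congr rfl fun b _ => by ring
  simp only [hpt]
  have hi1 := (integrable_density_mul hH hQ (hF.pow 2) hθ).const_mul κ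
  have hi2 : ∀ b ∈ Finset.range P.depth, Integrable (fun ω => (P.m (b + 1) - P.m b) *
      (P.density (H θ) 0 P.depth ω * (F θ ω * D b ω))) (stdGauss ι) := fun b hb =>
    (integrable_density_mul hH hQ (hF.mul (hDp b (Finset.mem_range.1 hb).le)) hθ).const_mul _
  rw [integral_sub hi1 (integrable_finsetSum _ hi2), integral_finsetSum _ hi2,
    integral_const_mul, mul_sub, Finset.mul_sum]
  congr 1
  refine Finset.sum_congr rfl fun b hb => ?_
  rw [integral_const_mul]
  by_cases hi : P.level i ≤ b
  · simp only [hD, coordDeriv, if_pos hi]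
    -- Conditioning on the levels up to b makes both factors states, which gives the square.
    rw [integral_density_mul_state hH hQ hF hH' (Finset.mem_range.1 hb).le hθ, mul_left_comm,
      ← integral_const_mul κ]
    congr 2
    funext ω
    rw [state_const_mul]
    ring
  · simp [hD, coordDeriv, if_neg hi]

end Cascade

/-! ### One Gaussian vector for couplings, fields and configuration -/

section Sites

variable {N K : ℕ}

/-- The indices of all the Gaussian variables: couplings, fields and configuration. -/
abbrev Site (N K : ℕ) : Type := (Fin N × Fin N) ⊕ ((Fin K × Fin N) ⊕ Fin N)

/-- The external noise, as a function of all the Gaussian variables. -/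
def noise (ω : Site N K → ℝ) : Noise N K :=
  (fun i j => ω (.inl (i, j)), fun a i => ω (.inr (.inl (a, i))))

/-- The configuration, as a function of all the Gaussian variables. -/
def cfg (ω : Site N K → ℝ) : Fin N → ℝ := fun i => ω (.inr (.inr i))

/-- The Gaussian variables with a given noise and a vanishing configuration. -/
def liftNoise (ξ : Noise N K) : Site N K → ℝ :=
  Sum.elim (fun p => ξ.1 p.1 p.2) (Sum.elim (fun p => ξ.2 p.1 p.2) fun _ => 0)

lemma noise_liftNoise (ξ : Noise N K) : noise (liftNoise ξ) = ξ := rfl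

lemma measurable_noise : Measurable (noise : (Site N K → ℝ) → Noise N K) := by
  unfold noise; fun_prop

lemma measurable_cfg : Measurable (cfg : (Site N K → ℝ) → Fin N → ℝ) := by
  unfold cfg; fun_prop

lemma measurable_liftNoise : Measurable (liftNoise : Noise N K → Site N K → ℝ) := by
  refine measurable_pi_lambda _ fun s => ?_
  rcases s with p | p | i
  · simp only [liftNoise, Sum.elim_inl]; fun_prop
  · simp only [liftNoise, Sum.elim_inl, Sum.elim_inr]; fun_prop
  · simp only [liftNoise, Sum.elim_inr]; fun_prop

lemma measurable_of_comp_noise {G : Noise N K → ℝ}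
    (hG : Measurable fun ω : Site N K → ℝ => G (noise ω)) : Measurable G := by
  have := hG.comp measurable_liftNoise
  simpa only [Function.comp_def, noise_liftNoise] using this

/-- Distinct coordinates of a standard Gaussian vector are independent standard Gaussians, whatever
their selection and order. -/
lemma measurePreserving_reindex {ι κ : Type*} [Fintype ι] [Fintype κ] {e : κ → ι}
    (he : Function.Injective e) :
    MeasurePreserving (fun (ω : ι → ℝ) k => ω (e k)) (stdGauss ι) (stdGauss κ) := by
  refine ⟨by fun_prop, ?_⟩
  have h : iIndepFun (fun (i : ι) (ω : ι → ℝ) => ω i) (stdGauss ι) :=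
    iIndepFun_pi (X := fun _ => id) fun _ => aemeasurable_id
  have h' := (h.precomp he).map_fun_eq_pi_map fun k => (measurable_pi_apply _).aemeasurable
  rw [h', stdGauss]
  congr 1
  funext k
  exact (measurePreserving_eval (fun _ : ι => gaussianReal 0 1) (e k)).map_eq

lemma measurePreserving_curry (ι κ : Type*) [Fintype ι] [Fintype κ] :
    MeasurePreserving (fun (ω : ι × κ → ℝ) i k => ω (i, k)) (stdGauss (ι × κ))
      (Measure.pi fun _ : ι => stdGauss κ) := by
  refine ⟨by fun_prop, ?_⟩
  have := Measure.infinitePi_map_curry (ι := ι) (κ := κ) (X := ℝ) fun _ _ => gaussianReal 0 1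
  simp only [Measure.infinitePi_eq_pi] at this
  exact this

lemma measurePreserving_cfg :
    MeasurePreserving (cfg : (Site N K → ℝ) → _) (stdGauss (Site N K)) (gaussVec N) :=
  measurePreserving_reindex (e := fun i : Fin N => (.inr (.inr i) : Site N K))
    fun _ _ h => Sum.inr_injective (Sum.inr_injective h)

lemma measurePreserving_field (a : Fin K) :
    MeasurePreserving (fun ω : Site N K → ℝ => (noise ω).2 a) (stdGauss (Site N K))
      (gaussVec N) :=
  measurePreserving_reindex (e := fun i : Fin N => (.inr (.inl (a, i)) : Site N K))
    fun _ _ h => (Prod.mk.inj (Sum.inl_injective (Sum.inr_injective h))).2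

lemma measurePreserving_fields :
    MeasurePreserving (fun ω : Site N K → ℝ => (noise ω).2) (stdGauss (Site N K))
      (fieldLaw N K) :=
  (measurePreserving_curry (Fin K) (Fin N)).comp
    (measurePreserving_reindex (e := fun p : Fin K × Fin N => (.inr (.inl p) : Site N K))
    fun _ _ h => Sum.inl_injective (Sum.inr_injective h))

lemma measurePreserving_noise :
    MeasurePreserving (noise : (Site N K → ℝ) → _) (stdGauss (Site N K)) (noiseLaw N K) := by
  have h1 := measurePreserving_reindex
    (e := (Sum.map id Sum.inl : (Fin N × Fin N) ⊕ (Fin K × Fin N) → Site N K))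
    (Sum.map_injective.2 ⟨Function.injective_id, Sum.inl_injective⟩)
  have h2 := measurePreserving_sumPiEquivProdPi
    (X := fun _ : (Fin N × Fin N) ⊕ (Fin K × Fin N) => ℝ) fun _ => gaussianReal 0 1
  have h3 := (measurePreserving_curry (Fin N) (Fin N)).prod (measurePreserving_curry (Fin K) (Fin N))
  exact h3.comp (h2.comp h1)

/-- The levels of the Gaussian variables. -/
def siteLevel : Site N K → ℕ
  | .inl _ => 0
  | .inr (.inl p) => p.1 + 1
  | .inr (.inr _) => K + 1

/-- The cascade of a step order parameter: the couplings have level `0`, the fields have the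
levels `1, …, K` and the configuration has level `K + 1`. -/
def cascade (N : ℕ) {K : ℕ} (x : StepOrderParameter K) : Cascade (Site N K) where
  level := siteLevel
  depth := K + 1
  -- Exponents beyond level K + 1 play no role; the value 1 keeps them in [0, 1].
  m a := if h : a < K + 2 then x.m ⟨a, h⟩ else 1
  -- The couplings have level 0 and are never averaged exponentially, so their coefficient need not
  -- be small.
  c := Sum.elim (fun _ => 1) fun _ => 1 / 8
  level_le s := by
    rcases s with p | p | i <;> simp only [siteLevel] <;> omega
  m_nonneg a := by
    split_ifs with h
    · rw [← x.m_zero]; exact x.m_mono (Fin.zero_le _)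
    · exact zero_le_one
  m_le_one a := by
    split_ifs with h
    · rw [← x.m_last]; exact x.m_mono (Fin.le_last _)
    · exact le_rfl
  c_nonneg s := by rcases s with p | s <;> simp
  c_le s hs := by
    rcases s with p | s
    · exact absurd rfl hs
    · simp

variable (x : StepOrderParameter K)

lemma cascade_depth : (cascade N x).depth = K + 1 := rfl

lemma cascade_m (a : Fin (K + 2)) : (cascade N x).m a = x.m a := by
  simp [cascade]

lemma cascade_m_zero : (cascade N x).m 0 = 0 := by
  rw [← x.m_zero]; exact cascade_m x 0

lemma cascade_m_last : (cascade N x).m (K + 1) = 1 := by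
  rw [← x.m_last]; exact cascade_m x (Fin.last _)

lemma noise_mix_block (a : Fin K) (η ω : Site N K → ℝ) :
    noise (mix ((cascade N x).block (a + 1)) η ω) =
      ((noise ω).1, Function.update (noise ω).2 a ((noise η).2 a)) := by
  refine Prod.ext ?_ ?_
  · funext i j
    exact mix_of_notMem (by simp [Cascade.block, cascade, siteLevel]) η ω
  · funext b i
    by_cases h : b = a
    · subst h
      simp only [Function.update_self]
      exact mix_of_mem (by simp [Cascade.block, cascade, siteLevel]) η ω
    · simp only [Function.update_of_ne h]
      refine mix_of_notMem ?_ η ω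
      simpa [Cascade.block, cascade, siteLevel, Fin.val_inj] using h

lemma noise_mix_last (η ω : Site N K → ℝ) :
    noise (mix ((cascade N x).block (K + 1)) η ω) = noise ω := by
  refine Prod.ext ?_ ?_
  · funext i j
    exact mix_of_notMem (by simp [Cascade.block, cascade, siteLevel]) η ω
  · funext b i
    refine mix_of_notMem ?_ η ω
    have := b.2
    simp only [Cascade.block, cascade, siteLevel, mem_ofPred_eq]
    omega

lemma cfg_mix_last (η ω : Site N K → ℝ) :
    cfg (mix ((cascade N x).block (K + 1)) η ω) = cfg η := by
  funext i
  exact mix_of_mem (by simp [Cascade.block, cascade, siteLevel]) η ω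

/-- The field with index `b : Fin K` has level b + 1, so it is resampled exactly when a ≤ b.
Removing the levels above K leaves the configuration out. -/
lemma noise_mix_above (a : Fin (K + 1)) (η ω : Site N K → ℝ) :
    noise (mix ((cascade N x).above a \ (cascade N x).above K) η ω) =
      ((noise ω).1, splice a (noise ω).2 (noise η).2) := by
  refine Prod.ext ?_ ?_
  · funext i j
    exact mix_of_notMem (by simp [Cascade.above, cascade, siteLevel]) η ω
  · funext b i
    have hb := b.2
    by_cases h : b.castSucc < a
    · simp only [splice, if_pos h]
      refine mix_of_notMem ?_ η ω
      rw [Fin.lt_def, Fin.val_castSucc] at h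
      simp only [Cascade.above, cascade, siteLevel, Set.mem_sdiff, mem_ofPred_eq]
      omega
    · simp only [splice, if_neg h]
      refine mix_of_mem ?_ η ω
      rw [Fin.lt_def, Fin.val_castSucc] at h
      simp only [Cascade.above, cascade, siteLevel, Set.mem_sdiff, mem_ofPred_eq]
      omega

lemma measurable_comp_update {G : Noise N K → ℝ}
    (hG : Measurable fun ω : Site N K → ℝ => G (noise ω)) (a : Fin K) (ξ : Noise N K) :
    Measurable fun y : Fin N → ℝ => G (ξ.1, Function.update ξ.2 a y) :=
  (measurable_of_comp_noise hG).comp (measurable_const.prodMk (measurable_update ξ.2))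

lemma levelAvg_noise {G : Noise N K → ℝ} (hG : Measurable fun ω : Site N K → ℝ => G (noise ω))
    (a : Fin K) (ω : Site N K → ℝ) :
    levelAvg a G (noise ω) = avg ((cascade N x).block (a + 1)) (fun η => G (noise η)) ω := by
  rw [levelAvg, ← (measurePreserving_field (N := N) a).map_eq,
    integral_map (measurePreserving_field a).measurable.aemeasurable
      (measurable_comp_update hG a (noise ω)).aestronglyMeasurable]
  simp only [avg, noise_mix_block]

lemma integrable_levelAvg {G : Noise N K → ℝ}
    (hG : Measurable fun ω : Site N K → ℝ => G (noise ω)) (a : Fin K)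
    (hi : AvgIntegrable ((cascade N x).block (a + 1)) fun η => G (noise η)) (ξ : Noise N K) :
    Integrable (fun y => G (ξ.1, Function.update ξ.2 a y)) (gaussVec N) := by
  refine ((measurePreserving_field a).integrable_comp
    (measurable_comp_update hG a ξ).aestronglyMeasurable).1 ?_
  have := hi (liftNoise ξ)
  simpa only [noise_mix_block, noise_liftNoise, Function.comp_def] using this

lemma tailAvg_noise {G : Noise N K → ℝ} (hG : Measurable fun ω : Site N K → ℝ => G (noise ω))
    (a : Fin (K + 1)) (ω : Site N K → ℝ) :
    tailAvg a G (noise ω) =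
      avg ((cascade N x).above a \ (cascade N x).above K) (fun η => G (noise η)) ω := by
  have hs : Measurable fun Y' => splice a (noise ω).2 Y' := by
    refine measurable_pi_lambda _ fun b => ?_
    by_cases h : b.castSucc < a
    · simp only [splice, if_pos h]; fun_prop
    · simp only [splice, if_neg h]; fun_prop
  have hm : Measurable fun Y' => G ((noise ω).1, splice a (noise ω).2 Y') :=
    (measurable_of_comp_noise hG).comp (measurable_const.prodMk hs)
  rw [tailAvg, ← (measurePreserving_fields (N := N)).map_eq,
    integral_map measurePreserving_fields.measurable.aemeasurable hm.aestronglyMeasurable]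
  simp only [avg, noise_mix_above]

lemma integral_noiseLaw {G : Noise N K → ℝ}
    (hG : Measurable fun ω : Site N K → ℝ => G (noise ω)) :
    ∫ ξ, G ξ ∂(noiseLaw N K) = ∫ ω, G (noise ω) ∂(stdGauss (Site N K)) := by
  rw [← measurePreserving_noise.map_eq, integral_map measurable_noise.aemeasurable
    (measurable_of_comp_noise hG).aestronglyMeasurable]

lemma integrable_noiseLaw {G : Noise N K → ℝ}
    (hG : Measurable fun ω : Site N K → ℝ => G (noise ω))
    (hi : Integrable (fun ω => G (noise ω)) (stdGauss (Site N K))) :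
    Integrable G (noiseLaw N K) :=
  (measurePreserving_noise.integrable_comp
    (measurable_of_comp_noise hG).aestronglyMeasurable).1 hi

end Sites

/-! ### Growth and t-derivative of the Boltzmann exponent -/

section Hamiltonian

variable {N K : ℕ} (β h lam C : ℝ) (x : StepOrderParameter K)

/-- The exponent of the Boltzmann factor, as a function of all the Gaussian variables. -/
def ham (t : ℝ) (ω : Site N K → ℝ) : ℝ := boltzmannExponent β h lam C x t (noise ω) (cfg ω)

lemma PolyBdd.coeff_mul {ι : Type*} [Fintype ι] {u v : ℝ} {a : ℝ → ℝ} {F : ℝ → (ι → ℝ) → ℝ}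
    (ha : ContinuousOn a (Icc u v)) (hF : PolyBdd (Ioo u v) F) :
    PolyBdd (Ioo u v) fun θ ω => a θ * F θ ω := by
  obtain ⟨C, hC⟩ := isCompact_Icc.exists_bound_of_continuousOn ha
  exact (polyBdd_coeff ⟨C, fun θ hθ => hC θ (Ioo_subset_Icc_self hθ)⟩).mul hF

variable {I : Set ℝ}

lemma polyBdd_cfg (i : Fin N) : PolyBdd I fun _ (ω : Site N K → ℝ) => cfg ω i :=
  polyBdd_coord _

lemma polyBdd_sum_coupling : PolyBdd I fun _ (ω : Site N K → ℝ) =>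
    ∑ i, ∑ j, (noise ω).1 i j * cfg ω i * cfg ω j :=
  PolyBdd.sum _ fun i _ => PolyBdd.sum _ fun j _ =>
    ((polyBdd_coord (.inl (i, j))).mul (polyBdd_cfg i)).mul (polyBdd_cfg j)

lemma polyBdd_sum_sq : PolyBdd I fun _ (ω : Site N K → ℝ) => ∑ i, cfg ω i ^ 2 :=
  PolyBdd.sum _ fun i _ => (polyBdd_cfg i).pow 2

lemma polyBdd_sum_field : PolyBdd I fun _ (ω : Site N K → ℝ) =>
    ∑ a : Fin K, √(x.q a.succ - x.q a.castSucc) * ∑ i, (noise ω).2 a i * cfg ω i :=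
  PolyBdd.sum _ fun a _ => PolyBdd.const_mul (PolyBdd.sum _ fun i _ =>
    (polyBdd_coord (.inr (.inl (a, i)))).mul (polyBdd_cfg i)) _

lemma polyBdd_ham (u v : ℝ) : PolyBdd (Ioo u v) fun t (ω : Site N K → ℝ) =>
    ham β h lam C x t ω := by
  unfold ham boltzmannExponent
  refine (((((PolyBdd.coeff_mul ?_ polyBdd_sum_coupling).sub
    (PolyBdd.coeff_mul ?_ (polyBdd_sum_sq.pow 2))).add
    (PolyBdd.coeff_mul ?_ (polyBdd_sum_field x))).add
    (PolyBdd.coeff_mul ?_ polyBdd_sum_sq)).add (PolyBdd.const_mul (PolyBdd.sum _ fun i _ =>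
      polyBdd_cfg i) _)).add (PolyBdd.const_mul polyBdd_sum_sq _)
  all_goals fun_prop

/-- The derivative of `ham` with respect to the interpolation parameter. -/
def hamDeriv (t : ℝ) (ω : Site N K → ℝ) : ℝ :=
  β * (1 / (2 * N) / (2 * √(t / (2 * N)))) * ∑ i, ∑ j, (noise ω).1 i j * cfg ω i * cfg ω j
    - β ^ 2 / (4 * N) * (∑ i, cfg ω i ^ 2) ^ 2
    + β * (-1 / (2 * √(1 - t))) *
      ∑ a : Fin K, √(x.q a.succ - x.q a.castSucc) * ∑ i, (noise ω).2 a i * cfg ω i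
    - C / 2 * ∑ i, cfg ω i ^ 2

/-- The derivatives of the two square roots blow up at t = 0 and t = 1, hence the interval away from
both ends. -/
lemma polyBdd_hamDeriv (hN : 0 < N) {u v : ℝ} (hu : 0 < u) (hv : v < 1) :
    PolyBdd (Ioo u v) fun t (ω : Site N K → ℝ) => hamDeriv β C x t ω := by
  unfold hamDeriv
  have hN' : (0 : ℝ) < N := by exact_mod_cast hN
  refine (((PolyBdd.coeff_mul ?_ polyBdd_sum_coupling).sub
    (PolyBdd.const_mul (polyBdd_sum_sq.pow 2) _)).add
    (PolyBdd.coeff_mul ?_ (polyBdd_sum_field x))).sub (PolyBdd.const_mul polyBdd_sum_sq _)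
  · refine continuousOn_const.mul (continuousOn_const.div (by fun_prop) fun t ht => ?_)
    have : 0 < t := hu.trans_le ht.1
    positivity
  · refine continuousOn_const.mul (continuousOn_const.div (by fun_prop) fun t ht => ?_)
    have : 0 < 1 - t := by linarith [ht.2]
    positivity

lemma hasDerivAt_ham (hN : 0 < N) {t : ℝ} (ht : t ∈ Ioo (0 : ℝ) 1) (ω : Site N K → ℝ) :
    HasDerivAt (fun t => ham β h lam C x t ω) (hamDeriv β C x t ω) t := by
  have hN' : (0 : ℝ) < N := by exact_mod_cast hN
  have h1 : HasDerivAt (fun t : ℝ => √(t / (2 * N))) (1 / (2 * N) / (2 * √(t / (2 * N)))) t :=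
    ((hasDerivAt_id t).div_const _).sqrt (by have := ht.1; simp; constructor <;> linarith)
  have h2 : HasDerivAt (fun t : ℝ => √(1 - t)) (-1 / (2 * √(1 - t))) t :=
    ((hasDerivAt_id t).const_sub 1).sqrt (by have := ht.2; simp; linarith)
  have h3 := ((((((h1.const_mul β).mul_const
    (∑ i, ∑ j, (noise ω).1 i j * cfg ω i * cfg ω j)).sub
    (((hasDerivAt_id t).mul_const (β ^ 2 / (4 * N))).mul_const ((∑ i, cfg ω i ^ 2) ^ 2))).add
    ((h2.const_mul β).mul_const
      (∑ a : Fin K, √(x.q a.succ - x.q a.castSucc) * ∑ i, (noise ω).2 a i * cfg ω i))).add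
    ((((hasDerivAt_id t).const_sub 1).mul_const (C / 2)).mul_const (∑ i, cfg ω i ^ 2))).add_const
    (β * h * ∑ i, cfg ω i)).add_const (lam / 2 * ∑ i, cfg ω i ^ 2)
  refine h3.congr_deriv ?_
  simp only [hamDeriv]
  ring

lemma sum_cascade_c (ω : Site N K → ℝ) : ∑ s, (cascade N x).c s * ω s ^ 2 =
    ∑ i, ∑ j, (noise ω).1 i j ^ 2 + (1 / 8 * ∑ a, ∑ i, (noise ω).2 a i ^ 2 +
      1 / 8 * ∑ i, cfg ω i ^ 2) := by
  simp [cascade, Fintype.sum_sum_type, Fintype.sum_prod_type, noise, cfg, Finset.mul_sum]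

lemma mul_mul_le_sq_add (k y z : ℝ) : k * (y * z) ≤ y ^ 2 / 8 + 2 * k ^ 2 * z ^ 2 := by
  nlinarith [sq_nonneg (y - 4 * (k * z))]

/-- Young's inequality bounds the coupling term by Σ J_ij² plus half of the quartic term. The other
half, at least `δ * s ^ 2` because t stays above u > 0, absorbs every term of order s = Σ z_i². The
field term is split so that its Gaussians keep the coefficient 1/8. -/
lemma quadBdd_ham (hN : 0 < N) (hβ : 0 < β) {u v : ℝ} (hu : 0 < u) (hv : v < 1) :
    QuadBdd (cascade N x).c (Ioo u v) fun t (ω : Site N K → ℝ) => ham β h lam C x t ω := by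
  have hN' : (0 : ℝ) < N := by exact_mod_cast hN
  have hq : ∀ a : Fin K, 0 ≤ x.q a.succ - x.q a.castSucc := fun a =>
    sub_nonneg.2 (x.q_mono (Fin.castSucc_le_succ a))
  set A := ∑ a : Fin K, (x.q a.succ - x.q a.castSucc) with hA
  -- `D` collects the coefficients of s: from the fields, from C, from the linear term in h, and
  -- from lam.
  set D := 2 * β ^ 2 * A + |C| + 1 + |lam| with hD
  set δ := β ^ 2 * u / (8 * N) with hδ
  have hδ0 : 0 < δ := by positivity
  refine ⟨N * (β * h) ^ 2 + D ^ 2 / (4 * δ), by positivity, fun t ht ω => ?_⟩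
  have ht0 : 0 < t := hu.trans ht.1
  have ht1 : t < 1 := ht.2.trans hv
  rw [sum_cascade_c]
  simp only [ham, boltzmannExponent]
  set s := ∑ i, cfg ω i ^ 2 with hs
  have hs0 : 0 ≤ s := Finset.sum_nonneg fun i _ => sq_nonneg _
  have e1 : β * √(t / (2 * N)) * ∑ i, ∑ j, (noise ω).1 i j * cfg ω i * cfg ω j ≤
      ∑ i, ∑ j, (noise ω).1 i j ^ 2 + β ^ 2 * t / (8 * N) * s ^ 2 := by
    have hk : (β * √(t / (2 * N))) ^ 2 = β ^ 2 * t / (2 * N) := by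
      rw [mul_pow, Real.sq_sqrt (by positivity)]; ring
    have hss : s ^ 2 = ∑ i, ∑ j, cfg ω i ^ 2 * cfg ω j ^ 2 := by
      rw [sq, hs, Finset.sum_mul_sum]
    rw [hss]
    simp only [Finset.mul_sum, ← Finset.sum_add_distrib]
    refine Finset.sum_le_sum fun i _ => Finset.sum_le_sum fun j _ => ?_
    have : β ^ 2 * t / (8 * N) = (β * √(t / (2 * N))) ^ 2 / 4 := by
      rw [hk]; field_simp; norm_num
    rw [this]
    nlinarith [sq_nonneg ((noise ω).1 i j - β * √(t / (2 * N)) / 2 * (cfg ω i * cfg ω j))]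
  have e2 : β * √(1 - t) *
      ∑ a : Fin K, √(x.q a.succ - x.q a.castSucc) * ∑ i, (noise ω).2 a i * cfg ω i ≤
      1 / 8 * ∑ a, ∑ i, (noise ω).2 a i ^ 2 + 2 * β ^ 2 * A * s := by
    have : 2 * β ^ 2 * A * s =
        ∑ a : Fin K, ∑ i, 2 * (β ^ 2 * (x.q a.succ - x.q a.castSucc)) * cfg ω i ^ 2 := by
      simp only [← Finset.mul_sum, ← Finset.sum_mul]
      ring
    rw [this]
    simp only [Finset.mul_sum, ← Finset.sum_add_distrib]
    refine Finset.sum_le_sum fun a _ => Finset.sum_le_sum fun i _ => ?_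
    have h1 := mul_mul_le_sq_add (β * √(1 - t) * √(x.q a.succ - x.q a.castSucc))
      ((noise ω).2 a i) (cfg ω i)
    have h2 : (β * √(1 - t) * √(x.q a.succ - x.q a.castSucc)) ^ 2 ≤
        β ^ 2 * (x.q a.succ - x.q a.castSucc) := by
      rw [mul_pow, mul_pow, Real.sq_sqrt (by linarith), Real.sq_sqrt (hq a)]
      have : 0 ≤ β ^ 2 * (x.q a.succ - x.q a.castSucc) := mul_nonneg (sq_nonneg _) (hq a)
      nlinarith
    have h3 := mul_le_mul_of_nonneg_right h2 (sq_nonneg (cfg ω i))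
    linarith
  have e3 : (1 - t) * (C / 2) * s ≤ |C| * s := by
    refine mul_le_mul_of_nonneg_right ?_ hs0
    nlinarith [le_abs_self C, abs_nonneg C]
  have e4 : β * h * ∑ i, cfg ω i ≤ N * (β * h) ^ 2 + s := by
    have : (N : ℝ) * (β * h) ^ 2 = ∑ _i : Fin N, (β * h) ^ 2 := by simp
    rw [this, hs, ← Finset.sum_add_distrib, Finset.mul_sum]
    refine Finset.sum_le_sum fun i _ => ?_
    nlinarith [sq_nonneg (β * h - cfg ω i), sq_nonneg (β * h), sq_nonneg (cfg ω i)]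
  have e5 : lam / 2 * s ≤ |lam| * s := by
    refine mul_le_mul_of_nonneg_right ?_ hs0
    linarith [le_abs_self lam, abs_nonneg lam]
  have e6 : β ^ 2 * t / (8 * N) * s ^ 2 - t * (β ^ 2 / (4 * N)) * s ^ 2 ≤ -(δ * s ^ 2) := by
    have : β ^ 2 * t / (8 * N) * s ^ 2 - t * (β ^ 2 / (4 * N)) * s ^ 2 =
        -(β ^ 2 * t / (8 * N) * s ^ 2) := by
      field_simp; ring
    rw [this, hδ]
    have := ht.1
    gcongr
  -- The maximum over s of a concave quadratic.
  have e7 : D * s - δ * s ^ 2 ≤ D ^ 2 / (4 * δ) := by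
    rw [le_div_iff₀ (by positivity)]
    nlinarith [sq_nonneg (D - 2 * δ * s)]
  have e8 : D * s = 2 * β ^ 2 * A * s + |C| * s + s + |lam| * s := by rw [hD]; ring
  linarith

end Hamiltonian

/-! ### Identification of the spin glass quantities with those of the cascade -/

section Transfer

variable {N K : ℕ} {β h lam C : ℝ} {x : StepOrderParameter K} {I : Set ℝ} {t : ℝ}

lemma measurable_boltzmannFactor (ξ : Noise N K) :
    Measurable (boltzmannFactor β h lam C x t ξ) := by
  unfold boltzmannFactor boltzmannExponent
  fun_prop

lemma integral_mul_boltzmannFactor {O : (Fin N → ℝ) → ℝ}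
    (hO : Measurable fun ω : Site N K → ℝ => O (cfg ω)) (ω : Site N K → ℝ) :
    ∫ z, O z * boltzmannFactor β h lam C x t (noise ω) z ∂(gaussVec N) =
      avg ((cascade N x).block (K + 1))
        (fun η => Real.exp (ham β h lam C x t η) * O (cfg η)) ω := by
  have hO' : Measurable O := by
    have hl : Measurable fun z : Fin N → ℝ => (Sum.elim (fun _ => 0) (Sum.elim (fun _ => 0) z) :
        Site N K → ℝ) := by
      refine measurable_pi_lambda _ fun s => ?_
      rcases s with p | p | i
      · simp only [Sum.elim_inl]; fun_prop
      · simp only [Sum.elim_inl, Sum.elim_inr]; fun_prop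
      · simp only [Sum.elim_inr]; fun_prop
    exact hO.comp hl
  have hm : Measurable fun z => O z * boltzmannFactor β h lam C x t (noise ω) z :=
    hO'.mul (measurable_boltzmannFactor _)
  rw [← (measurePreserving_cfg (N := N) (K := K)).map_eq,
    integral_map measurable_cfg.aemeasurable hm.aestronglyMeasurable]
  simp only [avg, ham, noise_mix_last, cfg_mix_last, boltzmannFactor, mul_comm]

lemma interpZ_noise (ω : Site N K → ℝ) :
    interpZ β h lam C x t (noise ω) =
      avg ((cascade N x).block (K + 1)) (fun η => Real.exp (ham β h lam C x t η)) ω := by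
  have := integral_mul_boltzmannFactor (β := β) (h := h) (lam := lam) (C := C) (x := x) (t := t)
    (O := fun _ => 1) measurable_const ω
  simp only [one_mul, mul_one] at this
  exact this

lemma levelZ_last : levelZ (N := N) β h lam C x t (Fin.last K) = interpZ β h lam C x t := by
  simp [levelZ]

lemma levelZ_castSucc (b : Fin K) (ξ : Noise N K) : levelZ β h lam C x t b.castSucc ξ =
    if x.m b.succ.castSucc = 0 then
      Real.exp (levelAvg b (fun η => Real.log (levelZ β h lam C x t b.succ η)) ξ)
    else (levelAvg b (fun η => levelZ β h lam C x t b.succ η ^ x.m b.succ.castSucc) ξ) ^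
      (1 / x.m b.succ.castSucc) := by
  simp [levelZ]

lemma cascade_m_succ (b : Fin K) : (cascade N x).m (b + 1) = x.m b.succ.castSucc := by
  rw [← cascade_m (N := N)]; rfl

lemma prod_filter_fin (w : ℕ → ℝ) (p : ℕ → Prop) [DecidablePred p] :
    ∏ b : Fin K with p b.val, w b = ∏ j ∈ Finset.range K with p j, w j := by
  rw [Finset.prod_filter, Finset.prod_filter, ← Fin.prod_univ_eq_prod_range
    (fun j => if p j then w j else 1)]

lemma measurable_energy_ham
    (hH : PolyBdd I fun s (ω : Site N K → ℝ) => ham β h lam C x s ω)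
    (hQ : QuadBdd (cascade N x).c I fun s ω => ham β h lam C x s ω) (ht : t ∈ I)
    {a : ℕ} (ha : a ≤ K + 1) :
    Measurable ((cascade N x).energy (ham β h lam C x t) a) :=
  (Cascade.polyBdd_energy (P := cascade N x) hH hQ ha).1.1 t ht

lemma avgIntegrable_exp_energy
    (hH : PolyBdd I fun s (ω : Site N K → ℝ) => ham β h lam C x s ω)
    (hQ : QuadBdd (cascade N x).c I fun s ω => ham β h lam C x s ω) (ht : t ∈ I)
    {a : ℕ} (ha : a ≤ K) :
    AvgIntegrable ((cascade N x).block (a + 1)) fun η =>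
      Real.exp ((cascade N x).m (a + 1) * (cascade N x).energy (ham β h lam C x t) (a + 1) η) := by
  obtain ⟨h1, h2⟩ := Cascade.polyBdd_energy (P := cascade N x) hH hQ (a := a + 1)
    (by rw [cascade_depth]; omega)
  exact avgIntegrable_exp_mul (cascade N x).c_nonneg ((cascade N x).c_le_block a)
    ((cascade N x).m_nonneg _) ((cascade N x).m_le_one _) h1 h2 ht

lemma exp_mul_energy
    (hH : PolyBdd I fun s (ω : Site N K → ℝ) => ham β h lam C x s ω)
    (hQ : QuadBdd (cascade N x).c I fun s ω => ham β h lam C x s ω) (ht : t ∈ I)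
    {a : ℕ} (ha : a ≤ K) (ω : Site N K → ℝ) :
    Real.exp ((cascade N x).m (a + 1) * (cascade N x).energy (ham β h lam C x t) a ω) =
      avg ((cascade N x).block (a + 1)) (fun η =>
        Real.exp ((cascade N x).m (a + 1) *
          (cascade N x).energy (ham β h lam C x t) (a + 1) η)) ω := by
  have ha' : a < (cascade N x).depth := by rw [cascade_depth]; omega
  obtain ⟨h1, h2⟩ := Cascade.polyBdd_energy (P := cascade N x) hH hQ (a := a + 1) ha'
  rw [Cascade.energy_of_lt _ _ ha']
  exact exp_mul_logAvg (cascade N x).c_nonneg ((cascade N x).c_le_block a)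
    ((cascade N x).m_nonneg _) ((cascade N x).m_le_one _) h1 h2 ht ω

/-- Downward induction: the partition function is the step with exponent m_{K+1} = 1, and the
convention for m = 0 is the same in both recursions. -/
lemma levelZ_noise
    (hH : PolyBdd I fun s (ω : Site N K → ℝ) => ham β h lam C x s ω)
    (hQ : QuadBdd (cascade N x).c I fun s ω => ham β h lam C x s ω) (ht : t ∈ I)
    (a : Fin (K + 1)) (ω : Site N K → ℝ) :
    levelZ β h lam C x t a (noise ω) =
      Real.exp ((cascade N x).energy (ham β h lam C x t) a ω) := by
  induction a using Fin.reverseInduction generalizing ω with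
  | last =>
    have := exp_mul_energy hH hQ ht le_rfl ω
    rw [levelZ_last, interpZ_noise]
    rw [cascade_m_last] at this
    have hd : (cascade N x).energy (ham β h lam C x t) (K + 1) = ham β h lam C x t :=
      Cascade.energy_depth (cascade N x) _
    simp only [one_mul, hd] at this
    simpa using this.symm
  | cast b ih =>
    have hb : (b : ℕ) < (cascade N x).depth := by rw [cascade_depth]; omega
    have hm := measurable_energy_ham hH hQ ht (a := b + 1) (by omega)
    rw [levelZ_castSucc, ← cascade_m_succ (N := N)]
    simp only [Fin.val_castSucc, Fin.val_succ] at ih ⊢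
    split_ifs with h0
    · rw [levelAvg_noise x (by simp only [ih, Real.log_exp]; exact hm)]
      simp only [ih, Real.log_exp]
      rw [Cascade.energy_of_lt _ _ hb, logAvg, if_pos h0]
    · have he := exp_mul_energy hH hQ ht (a := b) b.2.le ω
      rw [levelAvg_noise x (by simp only [ih, ← Real.exp_mul]; fun_prop)]
      simp only [ih, ← Real.exp_mul, mul_comm _ ((cascade N x).m (b + 1))]
      rw [← he, ← Real.exp_mul]
      congr 1
      field_simp

lemma levelWeight_noise
    (hH : PolyBdd I fun s (ω : Site N K → ℝ) => ham β h lam C x s ω)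
    (hQ : QuadBdd (cascade N x).c I fun s ω => ham β h lam C x s ω) (ht : t ∈ I)
    (a : Fin K) (ω : Site N K → ℝ) :
    levelWeight β h lam C x t a (noise ω) =
      (cascade N x).weight (ham β h lam C x t) a ω := by
  have hm := measurable_energy_ham hH hQ ht (a := a + 1) (by omega)
  have hz : ∀ ω : Site N K → ℝ, levelZ β h lam C x t a.succ (noise ω) ^ x.m a.succ.castSucc =
      Real.exp ((cascade N x).m (a + 1) *
        (cascade N x).energy (ham β h lam C x t) (a + 1) ω) := fun ω => by
    rw [levelZ_noise hH hQ ht, ← Real.exp_mul, ← cascade_m_succ (N := N), mul_comm]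
    rfl
  rw [levelWeight, levelAvg_noise x (by simp only [hz]; fun_prop)]
  simp only [hz]
  rw [← exp_mul_energy hH hQ ht a.2.le, ← Real.exp_sub, Cascade.weight, mul_sub]

lemma headWeight_noise
    (hH : PolyBdd I fun s (ω : Site N K → ℝ) => ham β h lam C x s ω)
    (hQ : QuadBdd (cascade N x).c I fun s ω => ham β h lam C x s ω) (ht : t ∈ I)
    (a : Fin (K + 1)) (ω : Site N K → ℝ) :
    headWeight β h lam C x t a (noise ω) =
      (cascade N x).density (ham β h lam C x t) 0 a ω := by
  have h2 := prod_filter_fin (K := K) (fun j => (cascade N x).weight (ham β h lam C x t) j ω)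
    (fun j => j < a)
  simp only [headWeight, levelWeight_noise hH hQ ht, Cascade.density, Fin.lt_def,
    Fin.val_castSucc]
  rw [h2]
  congr 1
  ext j
  have := a.2
  simp only [Finset.mem_filter, Finset.mem_range, Finset.mem_Ico]
  omega

lemma tailWeight_noise
    (hH : PolyBdd I fun s (ω : Site N K → ℝ) => ham β h lam C x s ω)
    (hQ : QuadBdd (cascade N x).c I fun s ω => ham β h lam C x s ω) (ht : t ∈ I)
    (a : Fin (K + 1)) (ω : Site N K → ℝ) :
    tailWeight β h lam C x t a (noise ω) =
      (cascade N x).density (ham β h lam C x t) a K ω := by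
  have h2 := prod_filter_fin (K := K) (fun j => (cascade N x).weight (ham β h lam C x t) j ω)
    (fun j => a ≤ j)
  simp only [tailWeight, levelWeight_noise hH hQ ht, Cascade.density, Fin.le_def,
    Fin.val_castSucc]
  rw [h2]
  congr 1
  ext j
  simp only [Finset.mem_filter, Finset.mem_range, Finset.mem_Ico]
  omega

/-- The Boltzmann state is the tilted average over the last block with exponent 1, because the state
at full depth is the observable itself. -/
lemma gibbs_noise
    (hH : PolyBdd I fun s (ω : Site N K → ℝ) => ham β h lam C x s ω)
    (hQ : QuadBdd (cascade N x).c I fun s ω => ham β h lam C x s ω) (ht : t ∈ I)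
    {O : (Fin N → ℝ) → ℝ} (hO : PolyBdd I fun _ (ω : Site N K → ℝ) => O (cfg ω))
    (ω : Site N K → ℝ) : gibbs β h lam C x t O (noise ω) =
      (cascade N x).state (ham β h lam C x t) K (fun η => O (cfg η)) ω := by
  have hK : K < (cascade N x).depth := by rw [cascade_depth]; omega
  have hd : (cascade N x).energy (ham β h lam C x t) (K + 1) = ham β h lam C x t :=
    Cascade.energy_depth (cascade N x) _
  have hs : (cascade N x).state (ham β h lam C x t) (K + 1) (fun η => O (cfg η)) =
      fun η => O (cfg η) := Cascade.state_depth (cascade N x) _ _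
  have he := levelZ_noise hH hQ ht (Fin.last K) ω
  rw [levelZ_last, Fin.val_last] at he
  rw [Cascade.state_of_lt hH hQ hO hK ht, tilt_eq, hs, hd, cascade_m_last, gibbs, he,
    integral_mul_boltzmannFactor (hO.1 t ht), Real.exp_neg]
  have hl : (cascade N x).energy (ham β h lam C x t) K =
      logAvg ((cascade N x).block (K + 1)) 1 (ham β h lam C x t) := by
    rw [Cascade.energy_of_lt _ _ hK, hd, cascade_m_last]
  simp only [one_mul, hl]

lemma levelState_noise
    (hH : PolyBdd I fun s (ω : Site N K → ℝ) => ham β h lam C x s ω)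
    (hQ : QuadBdd (cascade N x).c I fun s ω => ham β h lam C x s ω) (ht : t ∈ I)
    {O : (Fin N → ℝ) → ℝ}
    (hO : PolyBdd I fun _ (ω : Site N K → ℝ) => O (cfg ω)) (a : Fin (K + 1)) (ω : Site N K → ℝ) :
    levelState β h lam C x t a O (noise ω) =
      (cascade N x).state (ham β h lam C x t) a (fun η => O (cfg η)) ω := by
  have hK : K ≤ (cascade N x).depth := by rw [cascade_depth]; omega
  have hm1 := Cascade.measurable_density hH hQ ht a hK
  have hm2 := (Cascade.polyBdd_state hH hQ hO hK).1 t ht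
  have heq : ∀ ω : Site N K → ℝ, tailWeight β h lam C x t a (noise ω) *
      gibbs β h lam C x t O (noise ω) = (cascade N x).density (ham β h lam C x t) a K ω *
        (cascade N x).state (ham β h lam C x t) K (fun η => O (cfg η)) ω := fun ω => by
    rw [tailWeight_noise hH hQ ht, gibbs_noise hH hQ ht hO]
  rw [levelState, tailAvg_noise x (by simp only [heq]; exact hm1.mul hm2),
    Cascade.state_eq_avg_state hH hQ hO (Nat.lt_succ_iff.1 a.2) hK ht]
  simp only [heq]

/-- The two-replica state of the squared deviation of the overlap. -/
lemma levelState₂_noise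
    (hH : PolyBdd I fun s (ω : Site N K → ℝ) => ham β h lam C x s ω)
    (hQ : QuadBdd (cascade N x).c I fun s ω => ham β h lam C x s ω) (ht : t ∈ I)
    (r : ℝ) (a : Fin (K + 1)) (ω : Site N K → ℝ) :
    levelState₂ β h lam C x t a (fun z₁ z₂ => (overlap z₁ z₂ - r) ^ 2) (noise ω) =
      1 / (N : ℝ) ^ 2 * ∑ i, ∑ j, (cascade N x).state (ham β h lam C x t) a
          (fun η => cfg η i * cfg η j) ω ^ 2
        - 2 * r / N * ∑ i, (cascade N x).state (ham β h lam C x t) a (fun η => cfg η i) ω ^ 2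
        + r ^ 2 := by
  have ha : (a : ℕ) ≤ (cascade N x).depth := by rw [cascade_depth]; omega
  -- The state of any quadratic polynomial in z with constant term r². It is used once per replica;
  -- in the second use the coefficients are states of the first.
  have hexp : ∀ (A : Fin N → Fin N → ℝ) (B : Fin N → ℝ) (O : (Fin N → ℝ) → ℝ),
      (∀ z, O z = ∑ i, ∑ j, A i j * (z i * z j) + (∑ i, B i * z i + r ^ 2)) →
      levelState β h lam C x t a O (noise ω) =
        ∑ i, ∑ j, A i j * (cascade N x).state (ham β h lam C x t) a
          (fun η => cfg η i * cfg η j) ω + (∑ i, B i *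
            (cascade N x).state (ham β h lam C x t) a (fun η => cfg η i) ω + r ^ 2) := by
    intro A B O hO
    have p1 : ∀ i j, PolyBdd I fun _ (ω : Site N K → ℝ) => A i j * (cfg ω i * cfg ω j) :=
      fun i j => ((polyBdd_cfg i).mul (polyBdd_cfg j)).const_mul _
    have p2 : ∀ i, PolyBdd I fun _ (ω : Site N K → ℝ) => B i * cfg ω i :=
      fun i => (polyBdd_cfg i).const_mul _
    have p3 : ∀ i, PolyBdd I fun _ (ω : Site N K → ℝ) => ∑ j, A i j * (cfg ω i * cfg ω j) :=
      fun i => PolyBdd.sum _ fun j _ => p1 i j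
    have p4 : PolyBdd I fun _ (ω : Site N K → ℝ) => ∑ i, ∑ j, A i j * (cfg ω i * cfg ω j) :=
      PolyBdd.sum _ fun i _ => p3 i
    have p5 : PolyBdd I fun _ (ω : Site N K → ℝ) => ∑ i, B i * cfg ω i :=
      PolyBdd.sum _ fun i _ => p2 i
    have p6 : PolyBdd I fun _ (_ : Site N K → ℝ) => r ^ 2 := polyBdd_const _
    rw [levelState_noise hH hQ ht (by simp only [hO]; exact p4.add (p5.add p6))]
    simp only [hO]
    rw [Cascade.state_add hH hQ p4 (p5.add p6) ha ht, Cascade.state_add hH hQ p5 p6 ha ht,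
      Cascade.state_const hH hQ _ ha ht,
      Cascade.state_sum (F := fun i _ ω => ∑ j, A i j * (cfg ω i * cfg ω j)) _ hH hQ
        (fun i _ => p3 i) ha ht,
      Cascade.state_sum (F := fun i _ ω => B i * cfg ω i) _ hH hQ (fun i _ => p2 i) ha ht]
    simp only [Cascade.state_const_mul]
    congr 1
    refine Finset.sum_congr rfl fun i _ => ?_
    rw [Cascade.state_sum (F := fun j _ ω => A i j * (cfg ω i * cfg ω j)) _ hH hQ
      (fun j _ => p1 i j) ha ht]
    simp only [Cascade.state_const_mul]
  set S₂ := fun i j => (cascade N x).state (ham β h lam C x t) a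
    (fun η => cfg η i * cfg η j) ω with hS₂
  set S₁ := fun i => (cascade N x).state (ham β h lam C x t) a (fun η => cfg η i) ω with hS₁
  -- For fixed first replica, the squared deviation is a quadratic polynomial in the second.
  have hov : ∀ z₁ z₂ : Fin N → ℝ, (overlap z₁ z₂ - r) ^ 2 =
      ∑ i, ∑ j, (1 / (N : ℝ) ^ 2 * (z₁ i * z₁ j)) * (z₂ i * z₂ j) +
        (∑ i, (-(2 * r / N) * z₁ i) * z₂ i + r ^ 2) := fun z₁ z₂ => by
    have e1 : ∑ i, ∑ j, (1 / (N : ℝ) ^ 2 * (z₁ i * z₁ j)) * (z₂ i * z₂ j) =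
        1 / (N : ℝ) ^ 2 * (∑ i, z₁ i * z₂ i) ^ 2 := by
      rw [sq (∑ i, z₁ i * z₂ i), Finset.sum_mul_sum]
      simp only [Finset.mul_sum]
      refine Finset.sum_congr rfl fun i _ => Finset.sum_congr rfl fun j _ => by ring
    have e2 : ∑ i, (-(2 * r / N) * z₁ i) * z₂ i = -(2 * r / N) * ∑ i, z₁ i * z₂ i := by
      simp only [Finset.mul_sum, mul_assoc]
    rw [e1, e2, overlap]
    ring
  have hin : ∀ z₁ : Fin N → ℝ,
      levelState β h lam C x t a (fun z₂ => (overlap z₁ z₂ - r) ^ 2) (noise ω) =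
      ∑ i, ∑ j, (1 / (N : ℝ) ^ 2 * S₂ i j) * (z₁ i * z₁ j) +
        (∑ i, (-(2 * r / N) * S₁ i) * z₁ i + r ^ 2) := fun z₁ => by
    rw [hexp _ _ _ (hov z₁)]
    congr 1
    · refine Finset.sum_congr rfl fun i _ => Finset.sum_congr rfl fun j _ => by
        simp only [hS₂]; ring
    · congr 1
      refine Finset.sum_congr rfl fun i _ => by simp only [hS₁]; ring
  rw [levelState₂, hexp _ _ _ hin]
  simp only [Finset.mul_sum]
  rw [sub_eq_add_neg, ← Finset.sum_neg_distrib, add_assoc]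
  congr 1
  · refine Finset.sum_congr rfl fun i _ => Finset.sum_congr rfl fun j _ => by ring
  · congr 1
    refine Finset.sum_congr rfl fun i _ => by ring

end Transfer

lemma polyBdd_levelState₂ {N K : ℕ} {β h lam C : ℝ} {x : StepOrderParameter K} {I : Set ℝ}
    (hH : PolyBdd I fun s (ω : Site N K → ℝ) => ham β h lam C x s ω)
    (hQ : QuadBdd (cascade N x).c I fun s ω => ham β h lam C x s ω) (r : ℝ) (a : Fin (K + 1)) :
    PolyBdd I fun s (ω : Site N K → ℝ) => 1 / (N : ℝ) ^ 2 *
      ∑ i, ∑ j, (cascade N x).state (ham β h lam C x s) a (fun η => cfg η i * cfg η j) ω ^ 2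
        - 2 * r / N * ∑ i, (cascade N x).state (ham β h lam C x s) a (fun η => cfg η i) ω ^ 2
        + r ^ 2 := by
  have ha : (a : ℕ) ≤ (cascade N x).depth := by rw [cascade_depth]; omega
  refine ((PolyBdd.const_mul (PolyBdd.sum _ fun i _ => PolyBdd.sum _ fun j _ =>
    (Cascade.polyBdd_state hH hQ ((polyBdd_cfg i).mul (polyBdd_cfg j)) ha).pow 2) _).sub
    (PolyBdd.const_mul (PolyBdd.sum _ fun i _ =>
      (Cascade.polyBdd_state hH hQ (polyBdd_cfg i) ha).pow 2) _)).add (polyBdd_const _)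

/-- Every weight has conditional average one: the state of the constant 1 is 1 both at level a and
at level 0. -/
lemma Cascade.integral_density {ι : Type*} [Fintype ι] {P : Cascade ι} {I : Set ℝ}
    {H : ℝ → (ι → ℝ) → ℝ} (hH : PolyBdd I H) (hQ : QuadBdd P.c I H) {a : ℕ} (ha : a ≤ P.depth)
    {θ : ℝ} (hθ : θ ∈ I) : ∫ ω, P.density (H θ) 0 a ω ∂(stdGauss ι) = 1 := by
  have h1 := integral_density_mul_state hH hQ (F := fun _ _ => 1) (G := fun _ _ => 1)
    (polyBdd_const 1) (polyBdd_const 1) ha hθ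
  have h2 := integral_density_mul hH hQ (F := fun _ _ => 1) (polyBdd_const 1) hθ
  simp only [state_const hH hQ 1 ha hθ, mul_one] at h1
  simp only [state_const hH hQ 1 (Nat.zero_le _) hθ, mul_one] at h2
  rw [← h1, h2]
  simp

/-! ### Derivatives of the exponent in a coupling and in a field -/

section FieldDerivatives

variable {N K : ℕ} (β h lam C : ℝ) (x : StepOrderParameter K) (t : ℝ)

lemma hasDerivAt_update_apply {ι : Type*} [Fintype ι] [DecidableEq ι] (ω : ι → ℝ) (i j : ι)
    (s : ℝ) : HasDerivAt (fun s => Function.update ω i s j) (Pi.single (M := fun _ => ℝ) i 1 j) s :=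
  hasDerivAt_pi.1 (hasDerivAt_update ω i s) j

lemma cfg_update_coupling (ω : Site N K → ℝ) (p : Fin N × Fin N) (s : ℝ) :
    cfg (Function.update ω (.inl p) s) = cfg ω := by
  funext i; simp [cfg]

lemma cfg_update_field (ω : Site N K → ℝ) (p : Fin K × Fin N) (s : ℝ) :
    cfg (Function.update ω (.inr (.inl p)) s) = cfg ω := by
  funext i; simp [cfg]

lemma hasDerivAt_ham_coupling (i j : Fin N) (ω : Site N K → ℝ) (s : ℝ) :
    HasDerivAt (fun s => ham β h lam C x t (Function.update ω (.inl (i, j)) s))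
      (β * √(t / (2 * N)) * (cfg ω i * cfg ω j)) s := by
  have h2 : ∀ s, (noise (Function.update ω (.inl (i, j)) s)).2 = (noise ω).2 := fun s => by
    funext a k; simp [noise]
  simp only [ham, boltzmannExponent, cfg_update_coupling, h2]
  refine HasDerivAt.add_const _ (HasDerivAt.add_const _ (HasDerivAt.add_const _
    (HasDerivAt.add_const _ (HasDerivAt.sub_const _ ?_))))
  refine HasDerivAt.const_mul _ ?_
  have h3 : HasDerivAt (fun s => ∑ k, ∑ l,
      (noise (Function.update ω (.inl (i, j)) s)).1 k l * cfg ω k * cfg ω l)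
      (∑ k, ∑ l, Pi.single (M := fun _ => ℝ) (Sum.inl (i, j) : Site N K) 1 (.inl (k, l)) *
        cfg ω k * cfg ω l) s :=
    HasDerivAt.fun_sum fun k _ => HasDerivAt.fun_sum fun l _ =>
      ((hasDerivAt_update_apply ω _ _ s).mul_const _).mul_const _
  refine h3.congr_deriv ?_
  rw [Finset.sum_eq_single i, Finset.sum_eq_single j]
  · simp
  · intro l _ hl
    simp [hl]
  · simp
  · intro k _ hk
    refine Finset.sum_eq_zero fun l _ => ?_
    simp [hk]
  · simp

lemma hasDerivAt_ham_field (a : Fin K) (i : Fin N) (ω : Site N K → ℝ) (s : ℝ) :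
    HasDerivAt (fun s => ham β h lam C x t (Function.update ω (.inr (.inl (a, i))) s))
      (β * √(1 - t) * √(x.q a.succ - x.q a.castSucc) * cfg ω i) s := by
  have h2 : ∀ s, (noise (Function.update ω (.inr (.inl (a, i))) s)).1 = (noise ω).1 := fun s => by
    funext a k; simp [noise]
  simp only [ham, boltzmannExponent, cfg_update_field, h2]
  refine HasDerivAt.add_const _ (HasDerivAt.add_const _ (HasDerivAt.add_const _
    (HasDerivAt.const_add _ ?_)))
  rw [mul_assoc]
  refine HasDerivAt.const_mul _ ?_
  have h3 : HasDerivAt (fun s => ∑ b : Fin K, √(x.q b.succ - x.q b.castSucc) *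
      ∑ k, (noise (Function.update ω (.inr (.inl (a, i))) s)).2 b k * cfg ω k)
      (∑ b : Fin K, √(x.q b.succ - x.q b.castSucc) *
        ∑ k, Pi.single (M := fun _ => ℝ) (.inr (.inl (a, i)) : Site N K) 1 (.inr (.inl (b, k))) *
        cfg ω k) s :=
    HasDerivAt.fun_sum fun k _ => HasDerivAt.const_mul _ (HasDerivAt.fun_sum fun l _ =>
      ((hasDerivAt_update_apply ω _ _ s).mul_const _))
  refine h3.congr_deriv ?_
  rw [Finset.sum_eq_single a, Finset.sum_eq_single i]
  · simp
  · intro l _ hl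
    simp [hl]
  · simp
  · intro k _ hk
    rw [Finset.sum_eq_zero fun l _ => ?_, mul_zero]
    simp [hk]
  · simp

end FieldDerivatives

/-! ### Brackets, convergence, and the average of the t-derivative -/

section Interpolation

variable {N K : ℕ} {β h lam C : ℝ} {x : StepOrderParameter K} {I : Set ℝ} {t : ℝ}

/-- The average `E (f_1 ⋯ f_b ω̃_b(F) ^ 2)`. -/
def stateSq (P : Cascade (Site N K)) (H : (Site N K → ℝ) → ℝ) (b : ℕ) (F : (Site N K → ℝ) → ℝ) :
    ℝ := ∫ ω, P.density H 0 b ω * P.state H b F ω ^ 2 ∂(stdGauss (Site N K))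

/-- The variance increments telescope from q_0 = 0. The indicator selects the fields of level at
most b, the ones shared by the two replicas of ⟨·⟩_b. -/
lemma sum_fin_eq_q (b : Fin (K + 1)) :
    ∑ a : Fin K, (x.q a.succ - x.q a.castSucc) * (if (a : ℕ) + 1 ≤ b then 1 else 0) = x.q b := by
  induction b using Fin.induction with
  | zero => simp [x.q_zero]
  | succ b ih =>
    have : ∀ a : Fin K, (if (a : ℕ) + 1 ≤ b.succ then (1 : ℝ) else 0) =
        (if (a : ℕ) + 1 ≤ b.castSucc then 1 else 0) + if a = b then 1 else 0 := fun a => by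
      simp only [Fin.val_succ, Fin.val_castSucc, Fin.ext_iff]
      split_ifs <;> first | omega | simp
    simp only [this, mul_add, Finset.sum_add_distrib, ih]
    simp

lemma sum_range_cascade (f : ℕ → ℝ) : ∑ b ∈ Finset.range (cascade N x).depth,
    ((cascade N x).m (b + 1) - (cascade N x).m b) * f b =
      ∑ b : Fin (K + 1), (x.m b.succ - x.m b.castSucc) * f b := by
  rw [cascade_depth, Finset.sum_range]
  refine Finset.sum_congr rfl fun b _ => ?_
  rw [← cascade_m (N := N), ← cascade_m (N := N)]
  rfl

lemma bracket_eq
    (hH : PolyBdd I fun s (ω : Site N K → ℝ) => ham β h lam C x s ω)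
    (hQ : QuadBdd (cascade N x).c I fun s ω => ham β h lam C x s ω) (ht : t ∈ I)
    (a : Fin (K + 1)) (r : ℝ) :
    bracket (N := N) β h lam C x t a (fun z₁ z₂ => (overlap z₁ z₂ - r) ^ 2) =
      1 / (N : ℝ) ^ 2 * ∑ i, ∑ j, stateSq (cascade N x) (ham β h lam C x t) a
          (fun η => cfg η i * cfg η j)
        - 2 * r / N * ∑ i, stateSq (cascade N x) (ham β h lam C x t) a (fun η => cfg η i)
        + r ^ 2 := by
  have ha : (a : ℕ) ≤ (cascade N x).depth := by rw [cascade_depth]; omega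
  have hmd := Cascade.measurable_density hH hQ ht 0 ha
  have hp := polyBdd_levelState₂ hH hQ r a
  have hi : ∀ F : (Site N K → ℝ) → ℝ, PolyBdd I (fun _ => F) →
      Integrable (fun ω => (cascade N x).density (ham β h lam C x t) 0 a ω *
        (cascade N x).state (ham β h lam C x t) a F ω ^ 2) (stdGauss (Site N K)) := fun F hF =>
    Cascade.integrable_density_mul_of_dependsOn hH hQ
      (F := fun s ω => (cascade N x).state (ham β h lam C x s) a F ω ^ 2)
      ((Cascade.polyBdd_state hH hQ hF ha).pow 2) ha ht
      fun y z hyz => by simp only [Cascade.dependsOn_state _ _ _ _ hyz]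
  have h1 : ∀ i j, Integrable (fun ω => (cascade N x).density (ham β h lam C x t) 0 a ω *
      (cascade N x).state (ham β h lam C x t) a (fun η => cfg η i * cfg η j) ω ^ 2)
      (stdGauss (Site N K)) := fun i j => hi _ ((polyBdd_cfg i).mul (polyBdd_cfg j))
  have h2 : ∀ i, Integrable (fun ω => (cascade N x).density (ham β h lam C x t) 0 a ω *
      (cascade N x).state (ham β h lam C x t) a (fun η => cfg η i) ω ^ 2)
      (stdGauss (Site N K)) := fun i => hi _ (polyBdd_cfg i)
  have h3 : Integrable (fun ω => (cascade N x).density (ham β h lam C x t) 0 a ω)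
      (stdGauss (Site N K)) := by
    have := hi (fun _ => 1) (polyBdd_const 1)
    simpa [Cascade.state_const hH hQ 1 ha ht] using this
  rw [bracket, integral_noiseLaw]
  · simp only [headWeight_noise hH hQ ht, levelState₂_noise hH hQ ht]
    have hpt : ∀ ω, (cascade N x).density (ham β h lam C x t) 0 a ω * (1 / (N : ℝ) ^ 2 *
        ∑ i, ∑ j, (cascade N x).state (ham β h lam C x t) a (fun η => cfg η i * cfg η j) ω ^ 2
        - 2 * r / N * ∑ i, (cascade N x).state (ham β h lam C x t) a (fun η => cfg η i) ω ^ 2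
        + r ^ 2) = 1 / (N : ℝ) ^ 2 * ∑ i, ∑ j, (cascade N x).density (ham β h lam C x t) 0 a ω *
          (cascade N x).state (ham β h lam C x t) a (fun η => cfg η i * cfg η j) ω ^ 2
        - 2 * r / N * ∑ i, (cascade N x).density (ham β h lam C x t) 0 a ω *
          (cascade N x).state (ham β h lam C x t) a (fun η => cfg η i) ω ^ 2
        + r ^ 2 * (cascade N x).density (ham β h lam C x t) 0 a ω := fun ω => by
      simp only [← Finset.mul_sum]
      ring
    simp only [hpt]
    have i1 := (integrable_finsetSum Finset.univ fun i _ =>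
      integrable_finsetSum Finset.univ fun j _ => h1 i j).const_mul (1 / (N : ℝ) ^ 2)
    have i2 := (integrable_finsetSum Finset.univ fun i _ => h2 i).const_mul (2 * r / N)
    rw [integral_add (i1.sub' i2) (h3.const_mul _), integral_sub i1 i2, integral_const_mul,
      integral_const_mul, integral_const_mul, Cascade.integral_density hH hQ ha ht, mul_one,
      integral_finsetSum _ fun i _ => integrable_finsetSum Finset.univ fun j _ => h1 i j,
      integral_finsetSum _ fun i _ => h2 i]
    simp only [integral_finsetSum _ fun j _ => h1 _ j, stateSq]
  · simp only [headWeight_noise hH hQ ht, levelState₂_noise hH hQ ht]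
    exact hmd.mul (hp.1 t ht)

lemma integrable_bracket
    (hH : PolyBdd I fun s (ω : Site N K → ℝ) => ham β h lam C x s ω)
    (hQ : QuadBdd (cascade N x).c I fun s ω => ham β h lam C x s ω) (ht : t ∈ I)
    (a : Fin (K + 1)) (r : ℝ) :
    Integrable (fun ξ : Noise N K => headWeight β h lam C x t a ξ *
      levelState₂ β h lam C x t a (fun z₁ z₂ => (overlap z₁ z₂ - r) ^ 2) ξ) (noiseLaw N K) := by
  have ha : (a : ℕ) ≤ (cascade N x).depth := by rw [cascade_depth]; omega
  have hmd := Cascade.measurable_density hH hQ ht 0 ha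
  have hp := polyBdd_levelState₂ hH hQ r a
  apply integrable_noiseLaw
  · simp only [headWeight_noise hH hQ ht, levelState₂_noise hH hQ ht]
    exact hmd.mul (hp.1 t ht)
  · simp only [headWeight_noise hH hQ ht, levelState₂_noise hH hQ ht]
    exact Cascade.integrable_density_mul_of_dependsOn hH hQ hp ha ht fun y z hyz => by
      simp only [Cascade.dependsOn_state _ _ _ _ hyz]

lemma phiConverges
    (hH : PolyBdd I fun s (ω : Site N K → ℝ) => ham β h lam C x s ω)
    (hQ : QuadBdd (cascade N x).c I fun s ω => ham β h lam C x s ω) (ht : t ∈ I) : PhiConverges N β h lam C x t := by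
  refine ⟨fun ξ => ?_, fun a ξ => ⟨?_, ?_⟩, ?_⟩
  · have h1 := avgIntegrable_exp_energy hH hQ ht (le_refl K) (liftNoise ξ)
    have hd : (cascade N x).energy (ham β h lam C x t) (K + 1) = ham β h lam C x t :=
      Cascade.energy_depth (cascade N x) _
    simp only [cascade_m_last, one_mul, hd, ham, noise_mix_last, cfg_mix_last,
      noise_liftNoise] at h1
    exact (measurePreserving_cfg.integrable_comp
      (measurable_boltzmannFactor ξ).aestronglyMeasurable).1 h1
  · have hm := measurable_energy_ham hH hQ ht (a := a + 1) (by omega)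
    have hz : ∀ ω : Site N K → ℝ, levelZ β h lam C x t a.succ (noise ω) ^ x.m a.succ.castSucc =
        Real.exp ((cascade N x).m (a + 1) *
          (cascade N x).energy (ham β h lam C x t) (a + 1) ω) := fun ω => by
      rw [levelZ_noise hH hQ ht, ← Real.exp_mul, ← cascade_m_succ (N := N), mul_comm]
      rfl
    refine integrable_levelAvg x
      (G := fun ξ => levelZ β h lam C x t a.succ ξ ^ x.m a.succ.castSucc) ?_ a ?_ ξ
    · simp only [hz]; fun_prop
    · simp only [hz]; exact avgIntegrable_exp_energy hH hQ ht a.2.le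
  · have hm := measurable_energy_ham hH hQ ht (a := a + 1) (by omega)
    refine integrable_levelAvg x (G := fun ξ => Real.log (levelZ β h lam C x t a.succ ξ)) ?_ a ?_ ξ
    · simp only [levelZ_noise hH hQ ht, Real.log_exp]; exact hm
    · simp only [levelZ_noise hH hQ ht, Real.log_exp]
      exact (Cascade.polyBdd_energy hH hQ (a := a + 1)
        (by rw [cascade_depth]; omega)).1.avgIntegrable _ ht
  · refine integrable_noiseLaw ?_ ?_
    · simp only [levelZ_noise hH hQ ht, Real.log_exp]
      exact measurable_energy_ham hH hQ ht (Nat.zero_le _)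
    · simp only [levelZ_noise hH hQ ht, Real.log_exp]
      exact (Cascade.polyBdd_energy hH hQ (Nat.zero_le _)).1.integrable ht

lemma interpPhi_eq
    (hH : PolyBdd I fun s (ω : Site N K → ℝ) => ham β h lam C x s ω)
    (hQ : QuadBdd (cascade N x).c I fun s ω => ham β h lam C x s ω) (ht : t ∈ I) : interpPhi N β h lam C x t =
    1 / (N : ℝ) * ∫ ω, (cascade N x).energy (ham β h lam C x t) 0 ω ∂(stdGauss (Site N K)) := by
  rw [interpPhi, integral_noiseLaw]
  · simp only [levelZ_noise hH hQ ht, Real.log_exp]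
    rfl
  · simp only [levelZ_noise hH hQ ht, Real.log_exp]
    exact measurable_energy_ham hH hQ ht (Nat.zero_le _)

/-- Couplings have level 0, so every level of the cascade responds to them and no indicator remains.
-/
lemma integral_coupling_mul
    (hH : PolyBdd I fun s (ω : Site N K → ℝ) => ham β h lam C x s ω)
    (hQ : QuadBdd (cascade N x).c I fun s ω => ham β h lam C x s ω) (ht : t ∈ I)
    (i j : Fin N) :
    ∫ ω, (cascade N x).density (ham β h lam C x t) 0 (cascade N x).depth ω *
      (ω (.inl (i, j)) * (cfg ω i * cfg ω j)) ∂(stdGauss (Site N K)) =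
    β * √(t / (2 * N)) * (∫ ω, (cascade N x).density (ham β h lam C x t) 0 (cascade N x).depth ω *
      (cfg ω i * cfg ω j) ^ 2 ∂(stdGauss (Site N K)) -
      ∑ b : Fin (K + 1), (x.m b.succ - x.m b.castSucc) *
        stateSq (cascade N x) (ham β h lam C x t) b (fun η => cfg η i * cfg η j)) := by
  have := Cascade.integral_density_mul_coord_mul (P := cascade N x) (cascade_m_zero x)
    (cascade_m_last x) hH hQ (F := fun _ ω => cfg ω i * cfg ω j)
    ((polyBdd_cfg i).mul (polyBdd_cfg j)) ht (i := .inl (i, j))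
    (fun ω s => by simp only [cfg_update_coupling]) (β * √(t / (2 * N)))
    (hasDerivAt_ham_coupling β h lam C x t i j)
  rw [this, sum_range_cascade]
  have hl : ∀ b, (cascade N x).level (.inl (i, j)) ≤ b := fun b => Nat.zero_le b
  simp only [hl, if_true]
  rfl

/-- The field with index `a` has level a + 1; states of lower index average over it and do not
respond. -/
lemma integral_field_mul
    (hH : PolyBdd I fun s (ω : Site N K → ℝ) => ham β h lam C x s ω)
    (hQ : QuadBdd (cascade N x).c I fun s ω => ham β h lam C x s ω) (ht : t ∈ I)
    (a : Fin K) (i : Fin N) :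
    ∫ ω, (cascade N x).density (ham β h lam C x t) 0 (cascade N x).depth ω *
      (ω (.inr (.inl (a, i))) * cfg ω i) ∂(stdGauss (Site N K)) =
    β * √(1 - t) * √(x.q a.succ - x.q a.castSucc) *
      (∫ ω, (cascade N x).density (ham β h lam C x t) 0 (cascade N x).depth ω *
      cfg ω i ^ 2 ∂(stdGauss (Site N K)) -
      ∑ b : Fin (K + 1), (x.m b.succ - x.m b.castSucc) *
        (stateSq (cascade N x) (ham β h lam C x t) b (fun η => cfg η i) *
          if (a : ℕ) + 1 ≤ b then 1 else 0)) := by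
  have := Cascade.integral_density_mul_coord_mul (P := cascade N x) (cascade_m_zero x)
    (cascade_m_last x) hH hQ (F := fun _ ω => cfg ω i)
    (polyBdd_cfg i) ht (i := .inr (.inl (a, i)))
    (fun ω s => by simp only [cfg_update_field])
    (β * √(1 - t) * √(x.q a.succ - x.q a.castSucc))
    (hasDerivAt_ham_field β h lam C x t a i)
  rw [this, sum_range_cascade]
  simp only [mul_ite, mul_one, mul_zero]
  rfl

/-- The square roots cancel between the t-derivative and the integration by parts. The fourth
moments from the couplings cancel the quartic term, and the second moments from the fields cancel
the term with C = -β²Q. Only the replica terms are left. -/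
lemma integral_density_mul_hamDeriv
    (hH : PolyBdd I fun s (ω : Site N K → ℝ) => ham β h lam C x s ω)
    (hQ : QuadBdd (cascade N x).c I fun s ω => ham β h lam C x s ω) (ht : t ∈ I)
    (hN : 0 < N) (hC : C = -β ^ 2 * x.Q)
    (ht01 : t ∈ Ioo (0 : ℝ) 1) :
    ∫ ω, (cascade N x).density (ham β h lam C x t) 0 (cascade N x).depth ω *
      hamDeriv β C x t ω ∂(stdGauss (Site N K)) =
    ∑ b : Fin (K + 1), (x.m b.succ - x.m b.castSucc) *
      (β ^ 2 / 2 * x.q b *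
          ∑ i, stateSq (cascade N x) (ham β h lam C x t) b (fun η => cfg η i)
        - β ^ 2 / (4 * N) * ∑ i, ∑ j, stateSq (cascade N x) (ham β h lam C x t) b
          (fun η => cfg η i * cfg η j)) := by
  have hN' : (0 : ℝ) < N := by exact_mod_cast hN
  set P := cascade N x with hP
  set H := ham (N := N) β h lam C x t with hHdef
  have hi : ∀ {F : (Site N K → ℝ) → ℝ}, PolyBdd I (fun _ => F) →
      Integrable (fun ω => P.density H 0 P.depth ω * F ω) (stdGauss (Site N K)) := fun hF =>
    Cascade.integrable_density_mul hH hQ hF ht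
  set E : ((Site N K → ℝ) → ℝ) → ℝ := fun F =>
    ∫ ω, P.density H 0 P.depth ω * F ω ∂(stdGauss (Site N K)) with hE
  have hJ : ∀ i j, PolyBdd I fun _ (ω : Site N K → ℝ) => ω (.inl (i, j)) * (cfg ω i * cfg ω j) :=
    fun i j => (polyBdd_coord _).mul ((polyBdd_cfg i).mul (polyBdd_cfg j))
  have hY : ∀ a i, PolyBdd I fun _ (ω : Site N K → ℝ) => ω (.inr (.inl (a, i))) * cfg ω i :=
    fun a i => (polyBdd_coord _).mul (polyBdd_cfg i)
  have hz4 : ∀ i j, PolyBdd I fun _ (ω : Site N K → ℝ) => (cfg ω i * cfg ω j) ^ 2 :=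
    fun i j => ((polyBdd_cfg i).mul (polyBdd_cfg j)).pow 2
  have hz2 : ∀ i, PolyBdd I fun _ (ω : Site N K → ℝ) => cfg ω i ^ 2 :=
    fun i => (polyBdd_cfg i).pow 2
  have hsum1 : ∫ ω, P.density H 0 P.depth ω * hamDeriv β C x t ω ∂(stdGauss (Site N K)) =
      β * (1 / (2 * N) / (2 * √(t / (2 * N)))) *
          ∑ i, ∑ j, E (fun ω => ω (.inl (i, j)) * (cfg ω i * cfg ω j))
        - β ^ 2 / (4 * N) * ∑ i, ∑ j, E (fun ω => (cfg ω i * cfg ω j) ^ 2)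
        + β * (-1 / (2 * √(1 - t))) * ∑ a : Fin K, √(x.q a.succ - x.q a.castSucc) *
          ∑ i, E (fun ω => ω (.inr (.inl (a, i))) * cfg ω i)
        - C / 2 * ∑ i, E (fun ω => cfg ω i ^ 2) := by
    have hpt : ∀ ω : Site N K → ℝ, P.density H 0 P.depth ω * hamDeriv β C x t ω =
        β * (1 / (2 * N) / (2 * √(t / (2 * N)))) *
          ∑ i, ∑ j, P.density H 0 P.depth ω * (ω (.inl (i, j)) * (cfg ω i * cfg ω j))
        - β ^ 2 / (4 * N) * ∑ i, ∑ j, P.density H 0 P.depth ω * (cfg ω i * cfg ω j) ^ 2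
        + β * (-1 / (2 * √(1 - t))) * ∑ a : Fin K, √(x.q a.succ - x.q a.castSucc) *
          ∑ i, P.density H 0 P.depth ω * (ω (.inr (.inl (a, i))) * cfg ω i)
        - C / 2 * ∑ i, P.density H 0 P.depth ω * cfg ω i ^ 2 := fun ω => by
      have e1 : (∑ i, cfg ω i ^ 2) ^ 2 = ∑ i, ∑ j, (cfg ω i * cfg ω j) ^ 2 := by
        rw [sq, Finset.sum_mul_sum]
        simp only [mul_pow]
      have e2 : ∑ a : Fin K, √(x.q a.succ - x.q a.castSucc) *
          ∑ i, P.density H 0 P.depth ω * (ω (.inr (.inl (a, i))) * cfg ω i) =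
          P.density H 0 P.depth ω * ∑ a : Fin K, √(x.q a.succ - x.q a.castSucc) *
          ∑ i, ω (.inr (.inl (a, i))) * cfg ω i := by
        rw [Finset.mul_sum]
        refine Finset.sum_congr rfl fun a _ => ?_
        rw [← Finset.mul_sum]
        ring
      rw [e2, hamDeriv, e1]
      simp only [← Finset.mul_sum]
      simp only [noise, mul_assoc]
      ring
    simp only [hpt]
    have i1 := (integrable_finsetSum Finset.univ fun i _ =>
      integrable_finsetSum Finset.univ fun j _ => hi (hJ i j)).const_mul
        (β * (1 / (2 * N) / (2 * √(t / (2 * N)))))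
    have i2 := (integrable_finsetSum Finset.univ fun i _ =>
      integrable_finsetSum Finset.univ fun j _ => hi (hz4 i j)).const_mul (β ^ 2 / (4 * N))
    have i3' := fun a : Fin K => (integrable_finsetSum Finset.univ fun i _ =>
      hi (hY a i)).const_mul √(x.q a.succ - x.q a.castSucc)
    have i3 := (integrable_finsetSum Finset.univ fun a _ => i3' a).const_mul
      (β * (-1 / (2 * √(1 - t))))
    have i4 := (integrable_finsetSum Finset.univ fun i _ => hi (hz2 i)).const_mul (C / 2)
    refine (integral_sub ((i1.sub i2).add i3) i4).trans ?_
    rw [integral_add' (i1.sub i2) i3, integral_sub' i1 i2,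
      integral_const_mul, integral_const_mul, integral_const_mul, integral_const_mul,
      integral_finsetSum _ fun i _ => integrable_finsetSum Finset.univ fun j _ => hi (hJ i j),
      integral_finsetSum _ fun i _ => integrable_finsetSum Finset.univ fun j _ => hi (hz4 i j),
      integral_finsetSum _ fun a _ => i3' a,
      integral_finsetSum _ fun i _ => hi (hz2 i)]
    simp only [integral_finsetSum _ fun j _ => hi (hJ _ j),
      integral_finsetSum _ fun j _ => hi (hz4 _ j), integral_const_mul,
      integral_finsetSum _ fun j _ => hi (hY _ j), hE]
  have hc : ∀ i j, E (fun ω => ω (.inl (i, j)) * (cfg ω i * cfg ω j)) = _ := fun i j =>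
    integral_coupling_mul hH hQ ht i j
  have hf : ∀ a i, E (fun ω => ω (.inr (.inl (a, i))) * cfg ω i) = _ := fun a i =>
    integral_field_mul hH hQ ht a i
  rw [hsum1]
  simp only [hc, hf]
  have hE4 : ∀ i j, ∫ ω, P.density H 0 P.depth ω * (cfg ω i * cfg ω j) ^ 2
    ∂(stdGauss (Site N K)) = E (fun ω => (cfg ω i * cfg ω j) ^ 2) := fun _ _ => rfl
  have hE2 : ∀ i, ∫ ω, P.density H 0 P.depth ω * cfg ω i ^ 2
    ∂(stdGauss (Site N K)) = E (fun ω => cfg ω i ^ 2) := fun _ => rfl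
  simp only [← hP, ← hHdef, hE4, hE2]
  -- What follows is algebra in the values of `E`, which may be arbitrary numbers.
  generalize E = E'
  set e4 := ∑ i, ∑ j, E' (fun ω => (cfg ω i * cfg ω j) ^ 2) with he4
  set e2 := ∑ i, E' (fun ω => cfg ω i ^ 2) with he2
  have t1 : β * (1 / (2 * N) / (2 * √(t / (2 * N)))) * ∑ i, ∑ j, β * √(t / (2 * N)) *
      (E' (fun ω => (cfg ω i * cfg ω j) ^ 2) - ∑ b : Fin (K + 1),
        (x.m b.succ - x.m b.castSucc) * stateSq P H b (fun η => cfg η i * cfg η j)) =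
      β ^ 2 / (4 * N) * e4 - ∑ b : Fin (K + 1), (x.m b.succ - x.m b.castSucc) *
        (β ^ 2 / (4 * N) * ∑ i, ∑ j, stateSq P H b (fun η => cfg η i * cfg η j)) := by
    have hsq : (0 : ℝ) < √(t / (2 * N)) := by
      have := ht01.1
      positivity
    have hcoef : β * (1 / (2 * N) / (2 * √(t / (2 * N)))) * (β * √(t / (2 * N))) =
        β ^ 2 / (4 * N) := by field_simp; norm_num
    have hswap : ∑ i, ∑ j, ∑ b : Fin (K + 1),
        (x.m b.succ - x.m b.castSucc) * stateSq P H b (fun η => cfg η i * cfg η j) =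
        ∑ b : Fin (K + 1), (x.m b.succ - x.m b.castSucc) *
          ∑ i, ∑ j, stateSq P H b (fun η => cfg η i * cfg η j) := by
      simp only [Finset.mul_sum]
      exact (Finset.sum_congr rfl fun i _ => Finset.sum_comm).trans Finset.sum_comm
    simp only [← Finset.mul_sum, Finset.sum_sub_distrib]
    rw [← mul_assoc, hcoef, hswap, mul_sub, ← he4]
    congr 1
    rw [Finset.mul_sum]
    refine Finset.sum_congr rfl fun b _ => by ring
  -- The diagonal part carries the full variance Q, while the replica part at level b only collects
  -- q_b.
  have t2 : β * (-1 / (2 * √(1 - t))) * ∑ a : Fin K, √(x.q a.succ - x.q a.castSucc) *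
      ∑ i, β * √(1 - t) * √(x.q a.succ - x.q a.castSucc) *
        (E' (fun ω => cfg ω i ^ 2) - ∑ b : Fin (K + 1), (x.m b.succ - x.m b.castSucc) *
          (stateSq P H b (fun η => cfg η i) * if (a : ℕ) + 1 ≤ b then 1 else 0)) =
      -(β ^ 2 / 2 * x.Q * e2) + ∑ b : Fin (K + 1), (x.m b.succ - x.m b.castSucc) *
        (β ^ 2 / 2 * x.q b * ∑ i, stateSq P H b (fun η => cfg η i)) := by
    have hsq : (0 : ℝ) < √(1 - t) := Real.sqrt_pos.2 (by linarith [ht01.2])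
    set S := fun b : Fin (K + 1) => ∑ i, stateSq P H b (fun η => cfg η i) with hS
    have hlevel : ∀ a : Fin K, √(x.q a.succ - x.q a.castSucc) *
        ∑ i, β * √(1 - t) * √(x.q a.succ - x.q a.castSucc) *
        (E' (fun ω => cfg ω i ^ 2) - ∑ b : Fin (K + 1), (x.m b.succ - x.m b.castSucc) *
          (stateSq P H b (fun η => cfg η i) * if (a : ℕ) + 1 ≤ b then 1 else 0)) =
        β * √(1 - t) * ((x.q a.succ - x.q a.castSucc) * e2 -
          ∑ b : Fin (K + 1), (x.m b.succ - x.m b.castSucc) * S b *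
            ((x.q a.succ - x.q a.castSucc) * if (a : ℕ) + 1 ≤ b then 1 else 0)) := fun a => by
      have hq : √(x.q a.succ - x.q a.castSucc) * √(x.q a.succ - x.q a.castSucc) =
          x.q a.succ - x.q a.castSucc :=
        Real.mul_self_sqrt (sub_nonneg.2 (x.q_mono (Fin.castSucc_le_succ a)))
      have hsw : ∑ i, ∑ b : Fin (K + 1), (x.m b.succ - x.m b.castSucc) *
          (stateSq P H b (fun η => cfg η i) * if (a : ℕ) + 1 ≤ b then 1 else 0) =
          ∑ b : Fin (K + 1), (x.m b.succ - x.m b.castSucc) * S b *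
            if (a : ℕ) + 1 ≤ b then 1 else 0 := by
        rw [Finset.sum_comm]
        refine Finset.sum_congr rfl fun b _ => ?_
        rw [← Finset.mul_sum, ← Finset.sum_mul, mul_assoc]
      rw [← Finset.mul_sum, Finset.sum_sub_distrib, hsw, ← he2]
      simp only [mul_left_comm _ (x.q a.succ - x.q a.castSucc)]
      rw [← Finset.mul_sum, ← mul_sub]
      linear_combination (β * √(1 - t) * (e2 - ∑ b : Fin (K + 1),
        (x.m b.succ - x.m b.castSucc) * S b * if (a : ℕ) + 1 ≤ b then 1 else 0)) * hq
    simp only [hlevel]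
    rw [← Finset.mul_sum, Finset.sum_sub_distrib, ← Finset.sum_mul, Finset.sum_comm]
    simp only [← Finset.mul_sum, sum_fin_eq_q]
    have hQ' : ∑ a : Fin K, (x.q a.succ - x.q a.castSucc) = x.Q := by
      rw [StepOrderParameter.Q, ← sum_fin_eq_q (Fin.last K)]
      refine Finset.sum_congr rfl fun a _ => ?_
      rw [if_pos (by have := a.2; simp only [Fin.val_last]; omega), mul_one]
    rw [hQ', ← mul_assoc]
    have hcoef : β * (-1 / (2 * √(1 - t))) * (β * √(1 - t)) = -(β ^ 2 / 2) := by
      field_simp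
    rw [hcoef]
    have hfin : ∑ b : Fin (K + 1), (x.m b.succ - x.m b.castSucc) * (β ^ 2 / 2 * x.q b * S b) =
        β ^ 2 / 2 * ∑ b : Fin (K + 1), (x.m b.succ - x.m b.castSucc) * S b * x.q b := by
      rw [Finset.mul_sum]
      refine Finset.sum_congr rfl fun b _ => by ring
    rw [hfin]
    ring
  rw [t1, t2, hC]
  simp only [mul_sub, Finset.sum_sub_distrib]
  ring

end Interpolation

end GaussianSpinGlass

end

/-! ### The derivative of the interpolating function -/

open GaussianSpinGlass in
theorem theorem6 (N : ℕ) (hN : 0 < N) (K : ℕ) (x : StepOrderParameter K)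
    (β h lam C : ℝ) (hβ : 0 < β) (hC : C = -β ^ 2 * x.Q)
    (t : ℝ) (ht : t ∈ Set.Ioo (0 : ℝ) 1) :
    PhiConverges N β h lam C x t ∧
    (∀ a : Fin (K + 1), MeasureTheory.Integrable
      (fun ξ : Noise N K => headWeight β h lam C x t a ξ *
        levelState₂ β h lam C x t a (fun z₁ z₂ => (overlap z₁ z₂ - x.q a) ^ 2) ξ)
      (noiseLaw N K)) ∧
    HasDerivAt (fun s : ℝ => interpPhi N β h lam C x s)
      (β ^ 2 / 4 * ∑ a : Fin (K + 1), (x.m a.succ - x.m a.castSucc) * x.q a ^ 2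
        - β ^ 2 / 4 * ∑ a : Fin (K + 1), (x.m a.succ - x.m a.castSucc) *
            bracket (N := N) β h lam C x t a (fun z₁ z₂ => (overlap z₁ z₂ - x.q a) ^ 2))
      t := by
  have hN' : (0 : ℝ) < N := by exact_mod_cast hN
  -- A neighbourhood of t away from 0 and 1, so that the growth bounds hold uniformly on it.
  have hu : 0 < t / 2 := by linarith [ht.1]
  have hv : (1 + t) / 2 < 1 := by linarith [ht.2]
  have htI : t ∈ Set.Ioo (t / 2) ((1 + t) / 2) := ⟨by linarith [ht.1], by linarith [ht.2]⟩
  have hH := polyBdd_ham (N := N) β h lam C x (t / 2) ((1 + t) / 2)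
  have hQ := quadBdd_ham (N := N) β h lam C x hN hβ hu hv
  refine ⟨phiConverges hH hQ htI, fun a => integrable_bracket hH hQ htI a _, ?_⟩
  have hd := Cascade.hasDerivAt_integral_energy isOpen_Ioo hH hQ
    (polyBdd_hamDeriv (N := N) β C x hN hu hv)
    (fun s hs ω => hasDerivAt_ham β h lam C x hN ⟨hu.trans hs.1, hs.2.trans hv⟩ ω) htI
  have hphi : (fun s => interpPhi N β h lam C x s) =ᶠ[nhds t] fun s => 1 / (N : ℝ) *
      ∫ ω, (cascade N x).energy (ham β h lam C x s) 0 ω ∂(stdGauss (Site N K)) := by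
    filter_upwards [isOpen_Ioo.mem_nhds htI] with s hs
    exact interpPhi_eq hH hQ hs
  refine ((hd.const_mul (1 / (N : ℝ))).congr_of_eventuallyEq hphi).congr_deriv ?_
  rw [integral_density_mul_hamDeriv hH hQ htI hN hC ht]
  simp only [bracket_eq hH hQ htI]
  rw [Finset.mul_sum, Finset.mul_sum, Finset.mul_sum, ← Finset.sum_sub_distrib]
  refine Finset.sum_congr rfl fun b _ => ?_
  -- Completing the square level by level: the term q_b² inside the bracket cancels the explicit
  -- one.
  field_simp
  ring
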